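/- Let $\mathcal A=\mathbb C[a,b,c,d]/(ad-bc-1)$ be the function algebra of $SL(2,\mathbb C)$, with comultiplication $\Delta(T)=T\otimes T$ for $T=\begin{pmatrix}a&b\\c&d\end{pmatrix}$. Let $\mathcal M$ be the external algebra of $SL(2)$: the $\mathbb Z_2$-graded algebra generated by $\mathcal A$ (even) and odd generators $\theta^0,\theta^1,\theta^2$ that commute with $\mathcal A$ and anticommute with each other. Extend $\Delta$ to algebra homomorphisms $\Delta_L,\Delta_R:\mathcal M\to\mathcal M\otimes\mathcal M$ by $\Delta_R\theta^i=\theta^i\otimes 1$ and $$\begin{aligned}\Delta_L\theta^0&=(1+2bc)\otimes\theta^0-ac\otimes\theta^1+bd\otimes\theta^2,\\ \Delta_L\theta^1&=-2ab\otimes\theta^0+a^2\otimes\theta^1-b^2\otimes\theta^2,\\ \Delta_L\theta^2&=2cd\otimes\theta^0-c^2\otimes\theta^1+d^2\otimes\theta^2.\end{aligned}$$ A *graded bracket* on $\mathcal M$ is a $\mathbb C$-bilinear map $\{\,,\}:\mathcal M\times\mathcal M\to\mathcal M$ such that, for homogeneous $x,y,z$, $\deg\{x,y\}=\deg x+\deg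 y \bmod 2$, $\{x,y\}=(-1)^{\deg x\deg y+1}\{y,x\}$ and $\{xy,z\}=x\{y,z\}+(-1)^{\deg y\deg z}\{x,z\}y$. It is *graded Poisson* if moreover $(-1)^{\deg x\deg z}\{\{x,y\},z\}+(-1)^{\deg y\deg z}\{\{z,x\},y\}+(-1)^{\deg x\deg y}\{\{y,z\},x\}=0$. It is extended to $\mathcal M\otimes\mathcal M$ by $\{x\otimes y,z\otimes w\}=(-1)^{\deg y\deg z}(\{x,z\}\otimes yw+xz\otimes\{y,w\})$. It *prolongs the Sklyanin bracket* if $\{a,b\}=-ab$, $\{b,d\}=-bd$, $\{c,b\}=0$, $\{a,c\}=-ac$, $\{c,d\}=-cd$, $\{a,d\}=-2bc$. Consider the covariance conditions, for all $f,h\in\mathcal A$ and all $i,j$: (1) $\Delta\{f,h\}=\{\Delta f,\Delta h\}$; (2) $\Delta_{L,R}\{\theta^i,f\}=\{\Delta_{L,R}\theta^i,\Delta f\}$; (3) $\Delta_{L,R}\{\theta^i,\theta^j\}=\{\Delta_{L,R}\theta^i,\Delta_{L,R}\theta^j\}$. A bracket is *of the first order* if (1), (2) hold, and *of the second order* if (1),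 (3) hold. A *graded Poisson–Lie structure* on $\mathcal M$ is a graded Poisson bracket satisfying (1), (2), (3) for which each $\{\theta^i,\theta^j\}$ is quadratic in the forms, i.e. $\{\theta^i,\theta^j\}=\sum_{m,n}C^{ij}_{mn}\theta^m\theta^n$ with $C^{ij}_{mn}\in\mathcal A$. **Theorem.** There are exactly two graded Poisson–Lie structures on $\mathcal M$ prolonging the Sklyanin bracket. One has the brackets $\{\theta,t\}$ of type I, $$\begin{array}{lll}\{\theta^0,a\}=-2c\theta^1,&\{\theta^1,a\}=a\theta^1,&\{\theta^2,a\}=4c\theta^0-a\theta^2,\\ \{\theta^0,b\}=-2d\theta^1,&\{\theta^1,b\}=b\theta^1,&\{\theta^2,b\}=4d\theta^0-b\theta^2,\\ \{\theta^0,c\}=0,&\{\theta^1,c\}=-c\theta^1,&\{\theta^2,c\}=c\theta^2,\\ \{\theta^0,d\}=0,&\{\theta^1,d\}=-d\theta^1,&\{\theta^2,d\}=d\theta^2,\end{array}$$ the other one those of type II, $$\begin{array}{lll}\{\theta^0,a\}=0,&\{\theta^1,a\}=-a\theta^1,&\{\theta^2,a\}=a\theta^2,\\ \{\theta^0,b\}=0,&\{\theta^1,b\}=-b\theta^1,&\{\theta^2,b\}=b\theta^2,\\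 \{\theta^0,c\}=-2a\theta^2,&\{\theta^1,c\}=4a\theta^0+c\theta^1,&\{\theta^2,c\}=-c\theta^2,\\ \{\theta^0,d\}=-2b\theta^2,&\{\theta^1,d\}=4b\theta^0+d\theta^1,&\{\theta^2,d\}=-d\theta^2,\end{array}$$ and both have $$\{\theta^0,\theta^0\}=-2\theta^1\theta^2,\quad \{\theta^0,\theta^1\}=-2\theta^0\theta^1,\quad \{\theta^0,\theta^2\}=2\theta^0\theta^2,\quad \{\theta^1,\theta^1\}=\{\theta^1,\theta^2\}=\{\theta^2,\theta^2\}=0.\tag{$*$}$$ Moreover: (a) Every graded Poisson bracket of the first order that prolongs the Sklyanin bracket has $\{\theta,t\}$ of type I or of type II. (b) A graded bracket (Jacobi not assumed) that prolongs the Sklyanin bracket and for which all $\{\theta^i,a\},\{\theta^i,b\},\{\theta^i,c\},\{\theta^i,d\}$ lie in $\sum_j\mathcal A\theta^j$ is of the first order if and only if, for some $\eta\in\mathbb C$, $$\begin{array}{lll}\{\theta^0,a\}=\eta c\theta^1,&\{\theta^1,a\}=-(1+\eta)a\theta^1,&\{\theta^2,a\}=-2\eta c\theta^0+(1+\eta)a\theta^2,\\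 \{\theta^0,b\}=\eta d\theta^1,&\{\theta^1,b\}=-(1+\eta)b\theta^1,&\{\theta^2,b\}=-2\eta d\theta^0+(1+\eta)b\theta^2,\\ \{\theta^0,c\}=-(2+\eta)a\theta^2,&\{\theta^1,c\}=(4+2\eta)a\theta^0+(1+\eta)c\theta^1,&\{\theta^2,c\}=-(1+\eta)c\theta^2,\\ \{\theta^0,d\}=-(2+\eta)b\theta^2,&\{\theta^1,d\}=(4+2\eta)b\theta^0+(1+\eta)d\theta^1,&\{\theta^2,d\}=-(1+\eta)d\theta^2.\end{array}$$ Every $\eta\in\mathbb C$ occurs for some graded bracket prolonging the Sklyanin bracket. For such a bracket with parameter $\eta$, the Jacobi identities $\{\{\theta^i,f\},h\}+\{\{h,\theta^i\},f\}+\{\{f,h\},\theta^i\}=0$ ($f,h\in\mathcal A$, $i=0,1,2$) hold if and only if $\eta=0$ or $\eta=-2$; type I is $\eta=-2$ and type II is $\eta=0$. (c) A graded bracket that prolongs the Sklyanin bracket, with each $\{\theta^i,\theta^j\}$ quadratic in the forms, is of the second order if and only if it satisfies $(*)$. -/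

import Mathlib

open scoped TensorProduct

noncomputable section

namespace SL2Ext

/-! ### The function algebra of `SL(2, ℂ)` -/

/-- The function algebra `𝒜 = ℂ[t₀₀, t₀₁, t₁₀, t₁₁] / (det T - 1)` on `SL(2, ℂ)`. -/
def FunAlg : Type :=
  MvPolynomial (Fin 2 × Fin 2) ℂ ⧸
    Ideal.span {(Matrix.mvPolynomialX (Fin 2) (Fin 2) ℂ).det - 1}

instance : CommRing FunAlg :=
  inferInstanceAs (CommRing (MvPolynomial (Fin 2 × Fin 2) ℂ ⧸
    Ideal.span {(Matrix.mvPolynomialX (Fin 2) (Fin 2) ℂ).det - 1}))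

instance : Algebra ℂ FunAlg :=
  inferInstanceAs (Algebra ℂ (MvPolynomial (Fin 2 × Fin 2) ℂ ⧸
    Ideal.span {(Matrix.mvPolynomialX (Fin 2) (Fin 2) ℂ).det - 1}))

/-- The quotient map `ℂ[t₀₀, t₀₁, t₁₀, t₁₁] → 𝒜`. -/
def quot : MvPolynomial (Fin 2 × Fin 2) ℂ →ₐ[ℂ] FunAlg :=
  Ideal.Quotient.mkₐ ℂ (Ideal.span {(Matrix.mvPolynomialX (Fin 2) (Fin 2) ℂ).det - 1})

/-- The matrix `T = (a b; c d)` of generators of `𝒜`. -/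
def T : Matrix (Fin 2) (Fin 2) FunAlg :=
  (Matrix.mvPolynomialX (Fin 2) (Fin 2) ℂ).map quot

def a : FunAlg := T 0 0
def b : FunAlg := T 0 1
def c : FunAlg := T 1 0
def d : FunAlg := T 1 1

theorem det_T : T.det = 1 := by
  have h : quot ((Matrix.mvPolynomialX (Fin 2) (Fin 2) ℂ).det - 1) = 0 :=
    Ideal.Quotient.eq_zero_iff_mem.mpr (Ideal.subset_span rfl)
  rw [map_sub, map_one, sub_eq_zero, AlgHom.map_det] at h
  exact h

/-- The matrix with entries `∑ₖ tᵢₖ ⊗ tₖⱼ`. -/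
def comulT : Matrix (Fin 2) (Fin 2) (FunAlg ⊗[ℂ] FunAlg) :=
  T.map (Algebra.TensorProduct.includeLeft : FunAlg →ₐ[ℂ] FunAlg ⊗[ℂ] FunAlg) *
    T.map (Algebra.TensorProduct.includeRight : FunAlg →ₐ[ℂ] FunAlg ⊗[ℂ] FunAlg)

theorem det_comulT : comulT.det = 1 := by
  have h (f : FunAlg →ₐ[ℂ] FunAlg ⊗[ℂ] FunAlg) : (T.map f).det = 1 := by
    have := AlgHom.map_det f T
    rw [det_T, map_one] at this
    exact this.symm
  rw [comulT, Matrix.det_mul, h, h, one_mul]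

/-- The comultiplication of `𝒜`: the algebra homomorphism with `Δ(T) = T ⊗ T`. -/
def comul : FunAlg →ₐ[ℂ] FunAlg ⊗[ℂ] FunAlg :=
  Ideal.Quotient.liftₐ _ (MvPolynomial.aeval fun p : Fin 2 × Fin 2 => comulT p.1 p.2) (by
    intro x hx
    rw [← RingHom.mem_ker]
    refine (Ideal.span_le.mpr ?_) hx
    rintro _ rfl
    rw [SetLike.mem_coe, RingHom.mem_ker, map_sub, map_one, sub_eq_zero]
    have h := AlgHom.map_det (MvPolynomial.aeval fun p : Fin 2 × Fin 2 => comulT p.1 p.2)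
      (Matrix.mvPolynomialX (Fin 2) (Fin 2) ℂ)
    refine h.trans ?_
    rw [← det_comulT]
    congr 1
    ext i j
    simp [Matrix.mvPolynomialX])

/-! ### The external algebra of `SL(2)` -/

/-- The algebra `Ω` of right-invariant forms: the exterior algebra on `θ⁰, θ¹, θ²`. -/
abbrev Forms : Type := ExteriorAlgebra ℂ (Fin 3 → ℂ)

/-- The external algebra `ℳ = 𝒜 ⊗ Ω`: generated by commuting `tₘₙ ∈ 𝒜` and anticommuting `θⁱ`,
the `tₘₙ` commuting with the `θⁱ`. -/
abbrev ExtAlg : Type := FunAlg ⊗[ℂ] Forms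

/-- The inclusion `𝒜 ⊆ ℳ`. -/
def incl : FunAlg →ₐ[ℂ] ExtAlg := Algebra.TensorProduct.includeLeft

/-- The odd generators `θⁱ` of `ℳ`. -/
def θ (i : Fin 3) : ExtAlg := 1 ⊗ₜ ExteriorAlgebra.ι ℂ (Pi.single i 1)

/-- The parity automorphism of `ℳ`: identity on `𝒜` and `θⁱ ↦ -θⁱ`. -/
def parity : ExtAlg →ₐ[ℂ] ExtAlg :=
  Algebra.TensorProduct.map (AlgHom.id ℂ FunAlg)
    (CliffordAlgebra.involute : Forms →ₐ[ℂ] Forms)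

/-- The sign `(-1)^(p q)` for `p, q ∈ ℤ/2`. -/
def koszul (p q : ZMod 2) : ℂ := if p = 1 ∧ q = 1 then -1 else 1

/-- The homogeneous part of degree `p ∈ ℤ/2` of `ℳ`, i.e. the `(-1)^p`-eigenspace of the
parity automorphism. -/
def degPart (p : ZMod 2) : Submodule ℂ ExtAlg :=
  LinearMap.ker (parity.toLinearMap - koszul p 1 • LinearMap.id)

/-- The projection of `ℳ` onto its homogeneous part of degree `p`. -/
def degProj (p : ZMod 2) : ExtAlg →ₗ[ℂ] ExtAlg :=
  (2⁻¹ : ℂ) • (LinearMap.id + koszul p 1 • parity.toLinearMap)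

/-! ### Left and right comultiplications

Both `Δ_L` and `Δ_R` extend `Δ : 𝒜 → 𝒜 ⊗ 𝒜` to algebra homomorphisms on `ℳ`, with values in
`𝒜 ⊗ ℳ` and `ℳ ⊗ 𝒜`.  As `𝒜` is even, these are subalgebras of the graded tensor product
`ℳ ⊗ ℳ` on which the graded multiplication is the ordinary one. -/

/-- The matrix of the adjoint representation: `(Ad_g e_j)^i` is the entry `(i, j)`. -/
def adMat : Matrix (Fin 3) (Fin 3) FunAlg :=
  !![1 + 2 * b * c, -(a * c), b * d;
     -(2 * a * b), a ^ 2, -(b ^ 2);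
     2 * c * d, -(c ^ 2), d ^ 2]

theorem θ_mul_swap (i j : Fin 3) : θ i * θ j = -(θ j * θ i) := by
  have h := ExteriorAlgebra.ι_add_mul_swap (R := ℂ)
    (Pi.single i 1 : Fin 3 → ℂ) (Pi.single j 1)
  rw [eq_neg_iff_add_eq_zero]
  simp only [θ, Algebra.TensorProduct.tmul_mul_tmul, ← TensorProduct.tmul_add, h,
    TensorProduct.tmul_zero]

theorem θ_mul_self (i : Fin 3) : θ i * θ i = 0 := by
  simp [θ, Algebra.TensorProduct.tmul_mul_tmul]

/-- `Δ_L θⁱ = ∑ⱼ (Ad_g e_j)^i ⊗ θʲ`. -/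
def comulLθ (i : Fin 3) : FunAlg ⊗[ℂ] ExtAlg := ∑ j, adMat i j ⊗ₜ θ j

theorem comulLθ_mul_swap (i j : Fin 3) : comulLθ i * comulLθ j = -(comulLθ j * comulLθ i) := by
  simp only [comulLθ, Finset.sum_mul_sum, Algebra.TensorProduct.tmul_mul_tmul]
  rw [Finset.sum_comm, ← Finset.sum_neg_distrib]
  refine Finset.sum_congr rfl fun k _ => ?_
  rw [← Finset.sum_neg_distrib]
  refine Finset.sum_congr rfl fun l _ => ?_
  rw [θ_mul_swap l k, TensorProduct.tmul_neg, mul_comm]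

theorem sq_zero_of_anticomm {X : Type*} [Ring X] [Algebra ℂ X] (x : Fin 3 → X)
    (h : ∀ i j, x i * x j = -(x j * x i)) (v : Fin 3 → ℂ) :
    Fintype.linearCombination ℂ x v * Fintype.linearCombination ℂ x v = 0 := by
  have e : Fintype.linearCombination ℂ x v * Fintype.linearCombination ℂ x v =
      -(Fintype.linearCombination ℂ x v * Fintype.linearCombination ℂ x v) := by
    simp only [Fintype.linearCombination_apply, Finset.sum_mul_sum, smul_mul_smul_comm]
    conv_lhs => rw [Finset.sum_comm]
    rw [← Finset.sum_neg_distrib]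
    refine Finset.sum_congr rfl fun k _ => ?_
    rw [← Finset.sum_neg_distrib]
    refine Finset.sum_congr rfl fun l _ => ?_
    rw [h l k, smul_neg, mul_comm]
  have e2 : (2 : ℂ) • (Fintype.linearCombination ℂ x v * Fintype.linearCombination ℂ x v) = 0 := by
    rw [two_smul]
    exact add_eq_zero_iff_eq_neg.mpr e
  exact (smul_eq_zero_iff_right (two_ne_zero)).mp e2

/-- The algebra homomorphism `Ω → X` that sends `θⁱ` to `x i`, for anticommuting `x i`. -/
def liftForms {X : Type*} [Ring X] [Algebra ℂ X] (x : Fin 3 → X)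
    (h : ∀ i j, x i * x j = -(x j * x i)) : Forms →ₐ[ℂ] X :=
  ExteriorAlgebra.lift ℂ ⟨Fintype.linearCombination ℂ x, sq_zero_of_anticomm x h⟩

theorem commute_liftForms {X : Type*} [Ring X] [Algebra ℂ X] (x : Fin 3 → X)
    (h : ∀ i j, x i * x j = -(x j * x i)) (y : X) (hy : ∀ i, Commute y (x i)) (w : Forms) :
    Commute y (liftForms x h w) := by
  induction w using ExteriorAlgebra.induction with
  | algebraMap r => rw [AlgHom.commutes]; exact (Algebra.commutes r y).symm
  | ι v =>
    simp only [liftForms, ExteriorAlgebra.lift_ι_apply, Fintype.linearCombination_apply]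
    exact Commute.sum_right _ _ _ fun i _ => (hy i).smul_right _
  | mul u v hu hv => rw [map_mul]; exact hu.mul_right hv
  | add u v hu hv => rw [map_add]; exact hu.add_right hv

theorem commute_incl (f : FunAlg) (x : ExtAlg) : Commute (incl f) x := by
  induction x using TensorProduct.induction_on with
  | zero => exact Commute.zero_right _
  | tmul g w => simp [incl, Commute, SemiconjBy, mul_comm]
  | add u v hu hv => exact hu.add_right hv

/-- The left comultiplication `Δ_L : ℳ → 𝒜 ⊗ ℳ`. -/
def comulL : ExtAlg →ₐ[ℂ] FunAlg ⊗[ℂ] ExtAlg :=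
  Algebra.TensorProduct.lift
    ((Algebra.TensorProduct.map (AlgHom.id ℂ FunAlg) incl).comp comul)
    (liftForms comulLθ comulLθ_mul_swap) (by
      intro f w
      refine commute_liftForms _ _ _ (fun i => ?_) w
      rw [AlgHom.comp_apply]
      induction comul f using TensorProduct.induction_on with
      | zero => rw [map_zero]; exact Commute.zero_left _
      | tmul g h =>
        refine Commute.sum_right _ _ _ fun j _ => ?_
        rw [Algebra.TensorProduct.map_tmul]
        exact (Commute.all g (adMat i j)).tmul (commute_incl h (θ j))
      | add u v hu hv => rw [map_add]; exact hu.add_left hv)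

/-- The right comultiplication `Δ_R : ℳ → ℳ ⊗ 𝒜`, with `Δ_R θⁱ = θⁱ ⊗ 1`. -/
def comulR : ExtAlg →ₐ[ℂ] ExtAlg ⊗[ℂ] FunAlg :=
  Algebra.TensorProduct.lift
    ((Algebra.TensorProduct.map incl (AlgHom.id ℂ FunAlg)).comp comul)
    (liftForms (fun i => θ i ⊗ₜ 1) (by
      intro i j
      rw [Algebra.TensorProduct.tmul_mul_tmul, θ_mul_swap, TensorProduct.neg_tmul,
        Algebra.TensorProduct.tmul_mul_tmul])) (by
      intro f w
      refine commute_liftForms _ _ _ (fun i => ?_) w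
      rw [AlgHom.comp_apply]
      induction comul f using TensorProduct.induction_on with
      | zero => rw [map_zero]; exact Commute.zero_left _
      | tmul g h =>
        rw [Algebra.TensorProduct.map_tmul]
        exact (commute_incl g (θ i)).tmul (Commute.one_right _)
      | add u v hu hv => rw [map_add]; exact hu.add_left hv)

/-- `Δ_L` as a map to `ℳ ⊗ ℳ`. -/
def ΔL : ExtAlg →ₗ[ℂ] ExtAlg ⊗[ℂ] ExtAlg :=
  TensorProduct.map incl.toLinearMap LinearMap.id ∘ₗ comulL.toLinearMap

/-- `Δ_R` as a map to `ℳ ⊗ ℳ`. -/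
def ΔR : ExtAlg →ₗ[ℂ] ExtAlg ⊗[ℂ] ExtAlg :=
  TensorProduct.map LinearMap.id incl.toLinearMap ∘ₗ comulR.toLinearMap

/-- `Δ` on `𝒜` as a map to `ℳ ⊗ ℳ`. -/
def ΔA : FunAlg →ₗ[ℂ] ExtAlg ⊗[ℂ] ExtAlg :=
  TensorProduct.map incl.toLinearMap incl.toLinearMap ∘ₗ comul.toLinearMap

/-! ### Graded Poisson brackets -/

/-- Bilinear operations on `ℳ`. -/
abbrev Bracket : Type := ExtAlg →ₗ[ℂ] ExtAlg →ₗ[ℂ] ExtAlg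

/-- A graded bracket: a bilinear operation compatible with the `ℤ/2`-grading, graded
antisymmetric, and satisfying the graded Leibniz rule (but not necessarily Jacobi). -/
structure IsGradedBracket (B : Bracket) : Prop where
  degree : ∀ (p q : ZMod 2) (x y : ExtAlg), x ∈ degPart p → y ∈ degPart q →
    B x y ∈ degPart (p + q)
  symm : ∀ (p q : ZMod 2) (x y : ExtAlg), x ∈ degPart p → y ∈ degPart q →
    B x y = -(koszul p q • B y x)
  leibniz : ∀ (p q r : ZMod 2) (x y z : ExtAlg),
    x ∈ degPart p → y ∈ degPart q → z ∈ degPart r →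
    B (x * y) z = x * B y z + koszul q r • (B x z * y)

/-- A graded Poisson bracket: a graded bracket with the super Jacobi identity. -/
structure IsGradedPoisson (B : Bracket) : Prop extends IsGradedBracket B where
  jacobi : ∀ (p q r : ZMod 2) (x y z : ExtAlg),
    x ∈ degPart p → y ∈ degPart q → z ∈ degPart r →
    koszul p r • B (B x y) z + koszul q r • B (B z x) y + koszul p q • B (B y z) x = 0

/-- The extension of a bracket to `ℳ ⊗ ℳ`: for homogeneous `y, z`,
`{x ⊗ y, z ⊗ w} = (-1)^(deg y deg z) ({x, z} ⊗ y w + x z ⊗ {y, w})`. -/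
def tensorBracket (B : Bracket) :
    ExtAlg ⊗[ℂ] ExtAlg →ₗ[ℂ] ExtAlg ⊗[ℂ] ExtAlg →ₗ[ℂ] ExtAlg ⊗[ℂ] ExtAlg :=
  ∑ p : ZMod 2, ∑ q : ZMod 2, koszul p q •
    (TensorProduct.map₂ (B.compl₂ (degProj q)) (LinearMap.mul ℂ ExtAlg ∘ₗ degProj p) +
      TensorProduct.map₂ ((LinearMap.mul ℂ ExtAlg).compl₂ (degProj q)) (B ∘ₗ degProj p))

/-- `B` prolongs the Sklyanin bracket. -/
structure ProlongsSklyanin (B : Bracket) : Prop where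
  ab : B (incl a) (incl b) = incl (-(a * b))
  bd : B (incl b) (incl d) = incl (-(b * d))
  cb : B (incl c) (incl b) = 0
  ac : B (incl a) (incl c) = incl (-(a * c))
  cd : B (incl c) (incl d) = incl (-(c * d))
  ad : B (incl a) (incl d) = incl (-(2 * b * c))

/-- `Δ {f, h} = {Δ f, Δ h}` for `f, h ∈ 𝒜`. -/
def FunCovariant (B : Bracket) : Prop :=
  ∀ f h : FunAlg,
    ΔL (B (incl f) (incl h)) = tensorBracket B (ΔA f) (ΔA h) ∧
    ΔR (B (incl f) (incl h)) = tensorBracket B (ΔA f) (ΔA h)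

/-- `Δ_{L,R} {θⁱ, f} = {Δ_{L,R} θⁱ, Δ f}` for `f ∈ 𝒜`. -/
def MixedCovariant (B : Bracket) : Prop :=
  ∀ (i : Fin 3) (f : FunAlg),
    ΔL (B (θ i) (incl f)) = tensorBracket B (ΔL (θ i)) (ΔA f) ∧
    ΔR (B (θ i) (incl f)) = tensorBracket B (ΔR (θ i)) (ΔA f)

/-- `Δ_{L,R} {θⁱ, θʲ} = {Δ_{L,R} θⁱ, Δ_{L,R} θʲ}`. -/
def FormsCovariant (B : Bracket) : Prop :=
  ∀ i j : Fin 3,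
    ΔL (B (θ i) (θ j)) = tensorBracket B (ΔL (θ i)) (ΔL (θ j)) ∧
    ΔR (B (θ i) (θ j)) = tensorBracket B (ΔR (θ i)) (ΔR (θ j))

/-- Covariance of the first order. -/
def FirstOrder (B : Bracket) : Prop := FunCovariant B ∧ MixedCovariant B

/-- Covariance of the second order. -/
def SecondOrder (B : Bracket) : Prop := FunCovariant B ∧ FormsCovariant B

/-- `{θⁱ, tₘₙ} = ∑ⱼ Cⱼ θʲ` with coefficients in `𝒜`. -/
def MixedLinear (B : Bracket) : Prop :=
  ∀ (i : Fin 3) (m n : Fin 2),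
    B (θ i) (incl (T m n)) ∈ Submodule.span FunAlg (Set.range θ)

/-- `{θⁱ, θʲ} = ∑ Cₘₙ θᵐ θⁿ` with coefficients in `𝒜`. -/
def FormsQuadratic (B : Bracket) : Prop :=
  ∀ i j : Fin 3,
    B (θ i) (θ j) ∈ Submodule.span FunAlg (Set.range fun k : Fin 3 × Fin 3 => θ k.1 * θ k.2)

/-- A graded Poisson-Lie structure on `ℳ` that prolongs the Sklyanin bracket. -/
structure IsGradedPoissonLie (B : Bracket) : Prop where
  poisson : IsGradedPoisson B
  sklyanin : ProlongsSklyanin B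
  quadratic : FormsQuadratic B
  funCov : FunCovariant B
  mixedCov : MixedCovariant B
  formsCov : FormsCovariant B

/-- The super Jacobi identity for one `θⁱ` and two functions. -/
def MixedJacobi (B : Bracket) : Prop :=
  ∀ (i : Fin 3) (f h : FunAlg),
    B (B (θ i) (incl f)) (incl h) + B (B (incl h) (θ i)) (incl f)
      + B (B (incl f) (incl h)) (θ i) = 0

/-! ### The tables of brackets; `f • ω` is the product in `ℳ` of `f ∈ 𝒜` and `ω` -/

/-- The one-parameter family of candidates for `{θ, t}`. -/
structure MixedFamily (η : ℂ) (B : Bracket) : Prop where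
  θ0a : B (θ 0) (incl a) = η • c • θ 1
  θ0b : B (θ 0) (incl b) = η • d • θ 1
  θ0c : B (θ 0) (incl c) = -(2 + η) • a • θ 2
  θ0d : B (θ 0) (incl d) = -(2 + η) • b • θ 2
  θ1a : B (θ 1) (incl a) = -(1 + η) • a • θ 1
  θ1b : B (θ 1) (incl b) = -(1 + η) • b • θ 1
  θ1c : B (θ 1) (incl c) = (4 + 2 * η) • a • θ 0 + (1 + η) • c • θ 1
  θ1d : B (θ 1) (incl d) = (4 + 2 * η) • b • θ 0 + (1 + η) • d • θ 1
  θ2a : B (θ 2) (incl a) = (-2 * η) • c • θ 0 + (1 + η) • a • θ 2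
  θ2b : B (θ 2) (incl b) = (-2 * η) • d • θ 0 + (1 + η) • b • θ 2
  θ2c : B (θ 2) (incl c) = -(1 + η) • c • θ 2
  θ2d : B (θ 2) (incl d) = -(1 + η) • d • θ 2

/-- The I-type brackets `{θ, t}`. -/
structure TypeI (B : Bracket) : Prop where
  θ0a : B (θ 0) (incl a) = (-2 * c) • θ 1
  θ0b : B (θ 0) (incl b) = (-2 * d) • θ 1
  θ0c : B (θ 0) (incl c) = 0
  θ0d : B (θ 0) (incl d) = 0
  θ1a : B (θ 1) (incl a) = a • θ 1
  θ1b : B (θ 1) (incl b) = b • θ 1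
  θ1c : B (θ 1) (incl c) = -(c • θ 1)
  θ1d : B (θ 1) (incl d) = -(d • θ 1)
  θ2a : B (θ 2) (incl a) = (4 * c) • θ 0 - a • θ 2
  θ2b : B (θ 2) (incl b) = (4 * d) • θ 0 - b • θ 2
  θ2c : B (θ 2) (incl c) = c • θ 2
  θ2d : B (θ 2) (incl d) = d • θ 2

/-- The II-type brackets `{θ, t}`. -/
structure TypeII (B : Bracket) : Prop where
  θ0a : B (θ 0) (incl a) = 0
  θ0b : B (θ 0) (incl b) = 0
  θ0c : B (θ 0) (incl c) = (-2 * a) • θ 2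
  θ0d : B (θ 0) (incl d) = (-2 * b) • θ 2
  θ1a : B (θ 1) (incl a) = -(a • θ 1)
  θ1b : B (θ 1) (incl b) = -(b • θ 1)
  θ1c : B (θ 1) (incl c) = (4 * a) • θ 0 + c • θ 1
  θ1d : B (θ 1) (incl d) = (4 * b) • θ 0 + d • θ 1
  θ2a : B (θ 2) (incl a) = a • θ 2
  θ2b : B (θ 2) (incl b) = b • θ 2
  θ2c : B (θ 2) (incl c) = -(c • θ 2)
  θ2d : B (θ 2) (incl d) = -(d • θ 2)

/-- The brackets `{θ, θ}`. -/
structure FormsTable (B : Bracket) : Prop where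
  θ00 : B (θ 0) (θ 0) = -2 * (θ 1 * θ 2)
  θ01 : B (θ 0) (θ 1) = -2 * (θ 0 * θ 1)
  θ02 : B (θ 0) (θ 2) = 2 * (θ 0 * θ 2)
  θ11 : B (θ 1) (θ 1) = 0
  θ12 : B (θ 1) (θ 2) = 0
  θ22 : B (θ 2) (θ 2) = 0

end SL2Ext

end

/-!
Write `{θⁱ, ·}` and `{θⁱ, θʲ}` in the frame `θ⁰, θ¹, θ²` and its products. Right covariance says
that the coefficients of `{θⁱ, f}` are right-invariant vector fields in `f`, and that those of
`{θⁱ, θʲ}` are constants; a covariant bracket is thus determined by finitely many values at the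
unit of the group. Left covariance becomes an equivariance condition on these values under the
adjoint action, inhomogeneous because the Sklyanin bracket enters. Evaluated at one point of the
torus and one unipotent point of `SL(2)`, it leaves a line, with parameter `η`, for the mixed
brackets, up to a multiple `x` of the volume form `θ⁰θ¹θ²`, and a single solution for the brackets
of forms, since there is no nonzero equivariant map `Sym² 𝔰𝔩₂ → Λ² 𝔰𝔩₂`.

The mixed Jacobi expression of `θⁱ, f, h` is a right-invariant bivector field applied to `f, h`, so
it vanishes if and only if its value at the unit does; this gives `η (η + 2) = 0`, and then `x = 0`
through the volume form component. Conversely, every value of the parameters is attained by a sum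
of products `D ∧ D'` of graded derivations, and the Jacobi identity need only be checked on the
generators `a, b, c, d, θⁱ`.
-/

noncomputable section

namespace SL2Ext

/-! ### Functions and vector fields on `SL(2)` -/

theorem det_relation : a * d - b * c = 1 := by
  have h := det_T
  rwa [Matrix.det_fin_two] at h

theorem quot_surjective : Function.Surjective quot := Ideal.Quotient.mk_surjective

theorem quot_X (p : Fin 2 × Fin 2) : quot (MvPolynomial.X p) = T p.1 p.2 := by
  simp only [T, Matrix.mvPolynomialX, Matrix.map_apply, Matrix.of_apply]

@[elab_as_elim]
theorem FunAlg.induction {P : FunAlg → Prop} (f : FunAlg)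
    (algebraMap : ∀ r : ℂ, P (algebraMap ℂ FunAlg r)) (T : ∀ i j, P (T i j))
    (add : ∀ f g, P f → P g → P (f + g)) (mul : ∀ f g, P f → P g → P (f * g)) : P f := by
  obtain ⟨p, rfl⟩ := quot_surjective f
  induction p using MvPolynomial.induction_on with
  | C r => exact quot.commutes r ▸ algebraMap r
  | add p q hp hq => rw [map_add]; exact add _ _ hp hq
  | mul_X p n hp => rw [map_mul, quot_X]; exact mul _ _ hp (T _ _)

theorem derivation_ext {M : Type*} [AddCommGroup M] [Module ℂ M] [Module FunAlg M]
    {D D' : Derivation ℂ FunAlg M} (h : ∀ i j, D (T i j) = D' (T i j)) :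
    D = D' := by
  ext f
  induction f using FunAlg.induction with
  | algebraMap r => rw [D.map_algebraMap, D'.map_algebraMap]
  | T i j => exact h i j
  | add f g hf hg => rw [map_add, map_add, hf, hg]
  | mul f g hf hg => rw [D.leibniz, D'.leibniz, hf, hg]

theorem derivation_sum_apply {M ι : Type*} [AddCommGroup M] [Module ℂ M] [Module FunAlg M]
    (s : Finset ι) (D : ι → Derivation ℂ FunAlg M) (f : FunAlg) :
    (∑ i ∈ s, D i) f = ∑ i ∈ s, D i f := by
  rw [← Derivation.coeFnAddMonoidHom_apply, map_sum, Finset.sum_apply]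
  rfl

/-- Evaluation of functions at an `R`-valued point `M` of `SL(2)`. -/
def point {R : Type*} [CommRing R] [Algebra ℂ R] (M : Matrix (Fin 2) (Fin 2) R) (hM : M.det = 1) :
    FunAlg →ₐ[ℂ] R :=
  Ideal.Quotient.liftₐ _ (MvPolynomial.aeval fun n : Fin 2 × Fin 2 => M n.1 n.2) fun x hx => by
    rw [← RingHom.mem_ker]
    refine (Ideal.span_le.mpr ?_) hx
    rintro _ rfl
    rw [SetLike.mem_coe, RingHom.mem_ker, map_sub, map_one, sub_eq_zero, ← hM]
    refine (AlgHom.map_det _ _).trans (congrArg _ ?_)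
    ext i j
    simp [Matrix.mvPolynomialX]

@[simp]
theorem point_T {R : Type*} [CommRing R] [Algebra ℂ R] (M : Matrix (Fin 2) (Fin 2) R)
    (hM : M.det = 1) (i j : Fin 2) : point M hM (T i j) = M i j := by
  rw [← quot_X (i, j)]
  exact MvPolynomial.aeval_X _ _

/-- The counit of `𝒜`: evaluation at the unit of `SL(2)`. -/
def counit : FunAlg →ₐ[ℂ] ℂ := point 1 Matrix.det_one

@[simp]
theorem counit_T (i j : Fin 2) : counit (T i j) = (1 : Matrix (Fin 2) (Fin 2) ℂ) i j :=
  point_T _ _ i j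

theorem counit_apply : counit a = 1 ∧ counit b = 0 ∧ counit c = 0 ∧ counit d = 1 := by
  simp [a, b, c, d]

/-- The vector field on `SL(2)` with value `V` at `T`; the hypothesis says that `V` is tangent to
the hypersurface `det T = 1`. -/
def vectorField (V : Matrix (Fin 2) (Fin 2) FunAlg) (hV : (T.adjugate * V).trace = 0) :
    Derivation ℂ FunAlg FunAlg :=
  Derivation.liftOfSurjective (f := quot) quot_surjective
    (d := MvPolynomial.mkDerivation ℂ fun p : Fin 2 × Fin 2 =>
      Function.surjInv quot_surjective (V p.1 p.2)) fun x hx => by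
    obtain ⟨y, rfl⟩ := Ideal.mem_span_singleton'.mp (Ideal.Quotient.eq_zero_iff_mem.mp hx)
    have hdet : quot ((Matrix.mvPolynomialX (Fin 2) (Fin 2) ℂ).det - 1) = 0 :=
      Ideal.Quotient.eq_zero_iff_mem.mpr (Ideal.subset_span rfl)
    rw [Derivation.leibniz, map_add, smul_eq_mul, smul_eq_mul, map_mul, map_mul, hdet, zero_mul,
      add_zero, Matrix.det_fin_two, Derivation.map_sub, Derivation.map_one_eq_zero, sub_zero]
    simp only [Matrix.mvPolynomialX, Matrix.of_apply, map_sub, Derivation.leibniz, map_add,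
      MvPolynomial.mkDerivation_X, smul_eq_mul, map_mul, quot_X, Function.surjInv_eq]
    rw [Matrix.adjugate_fin_two, Matrix.trace_fin_two] at hV
    simp only [Matrix.mul_apply, Fin.sum_univ_two, Matrix.of_apply, Matrix.cons_val_zero,
      Matrix.cons_val_one, Matrix.cons_val', Matrix.cons_val_fin_one] at hV
    linear_combination quot y * hV

@[simp]
theorem vectorField_T (V : Matrix (Fin 2) (Fin 2) FunAlg) (hV : (T.adjugate * V).trace = 0)
    (i j : Fin 2) : vectorField V hV (T i j) = V i j := by
  rw [← quot_X (i, j), vectorField, Derivation.liftOfSurjective_apply,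
    MvPolynomial.mkDerivation_X]
  exact Function.surjInv_eq quot_surjective _

/-- The traceless matrix with components `X` along the standard basis `H, E, F` of `sl(2)`. -/
def sl2Matrix (X : Fin 3 → ℂ) : Matrix (Fin 2) (Fin 2) FunAlg :=
  !![algebraMap ℂ FunAlg (X 0), algebraMap ℂ FunAlg (X 1);
     algebraMap ℂ FunAlg (X 2), -algebraMap ℂ FunAlg (X 0)]

theorem trace_adjugate_mul_sl2Matrix_mul (X : Fin 3 → ℂ) :
    (T.adjugate * (sl2Matrix X * T)).trace = 0 := by
  rw [Matrix.trace_mul_comm, mul_assoc, Matrix.mul_adjugate, det_T, one_smul, mul_one,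
    Matrix.trace_fin_two]
  exact add_neg_cancel _

theorem trace_adjugate_mul_mul_sl2Matrix (X : Fin 3 → ℂ) :
    (T.adjugate * (T * sl2Matrix X)).trace = 0 := by
  rw [← mul_assoc, Matrix.adjugate_mul, det_T, one_smul, one_mul, Matrix.trace_fin_two]
  exact add_neg_cancel _

theorem sl2Matrix_add (X Y : Fin 3 → ℂ) : sl2Matrix (X + Y) = sl2Matrix X + sl2Matrix Y := by
  ext i j
  fin_cases i <;> fin_cases j <;> simp [sl2Matrix, add_comm]

theorem sl2Matrix_smul (r : ℂ) (X : Fin 3 → ℂ) : sl2Matrix (r • X) = r • sl2Matrix X := by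
  ext i j
  fin_cases i <;> fin_cases j <;> simp [sl2Matrix, Algebra.smul_def]

/-- The right-invariant vector field `T ↦ X T`. -/
def rightField : (Fin 3 → ℂ) →ₗ[ℂ] Derivation ℂ FunAlg FunAlg where
  toFun X := vectorField (sl2Matrix X * T) (trace_adjugate_mul_sl2Matrix_mul X)
  map_add' X Y := derivation_ext fun i j => by
    simp only [vectorField_T, sl2Matrix_add, add_mul, Derivation.add_apply, Matrix.add_apply]
  map_smul' r X := derivation_ext fun i j => by
    simp only [vectorField_T, sl2Matrix_smul, Derivation.smul_apply, Matrix.smul_mul,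
      Matrix.smul_apply, RingHom.id_apply]

/-- The left-invariant vector field `T ↦ T X`. -/
def leftField : (Fin 3 → ℂ) →ₗ[ℂ] Derivation ℂ FunAlg FunAlg where
  toFun X := vectorField (T * sl2Matrix X) (trace_adjugate_mul_mul_sl2Matrix X)
  map_add' X Y := derivation_ext fun i j => by
    simp only [vectorField_T, sl2Matrix_add, mul_add, Derivation.add_apply, Matrix.add_apply]
  map_smul' r X := derivation_ext fun i j => by
    simp only [vectorField_T, sl2Matrix_smul, Derivation.smul_apply, Matrix.mul_smul,
      Matrix.smul_apply, RingHom.id_apply]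

theorem rightField_T (X : Fin 3 → ℂ) (i j : Fin 2) :
    rightField X (T i j) = (sl2Matrix X * T) i j :=
  vectorField_T _ (trace_adjugate_mul_sl2Matrix_mul X) i j

theorem leftField_T (X : Fin 3 → ℂ) (i j : Fin 2) :
    leftField X (T i j) = (T * sl2Matrix X) i j :=
  vectorField_T _ (trace_adjugate_mul_mul_sl2Matrix X) i j

section Values

variable (X : Fin 3 → ℂ)

@[simp]
theorem rightField_a : rightField X a = X 0 • a + X 1 • c := by
  simp [a, c, rightField_T, sl2Matrix, Matrix.mul_apply, Algebra.smul_def]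

@[simp]
theorem rightField_b : rightField X b = X 0 • b + X 1 • d := by
  simp [b, d, rightField_T, sl2Matrix, Matrix.mul_apply, Algebra.smul_def]

@[simp]
theorem rightField_c : rightField X c = X 2 • a - X 0 • c := by
  simp [a, c, rightField_T, sl2Matrix, Matrix.mul_apply, Algebra.smul_def, sub_eq_add_neg]

@[simp]
theorem rightField_d : rightField X d = X 2 • b - X 0 • d := by
  simp [b, d, rightField_T, sl2Matrix, Matrix.mul_apply, Algebra.smul_def, sub_eq_add_neg]

@[simp]
theorem leftField_a : leftField X a = X 0 • a + X 2 • b := by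
  simp [a, b, leftField_T, sl2Matrix, Matrix.mul_apply, Algebra.smul_def, mul_comm]

@[simp]
theorem leftField_b : leftField X b = X 1 • a - X 0 • b := by
  simp [a, b, leftField_T, sl2Matrix, Matrix.mul_apply, Algebra.smul_def, mul_comm,
    sub_eq_add_neg]

@[simp]
theorem leftField_c : leftField X c = X 0 • c + X 2 • d := by
  simp [c, d, leftField_T, sl2Matrix, Matrix.mul_apply, Algebra.smul_def, mul_comm]

@[simp]
theorem leftField_d : leftField X d = X 1 • c - X 0 • d := by
  simp [c, d, leftField_T, sl2Matrix, Matrix.mul_apply, Algebra.smul_def, mul_comm,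
    sub_eq_add_neg]

end Values

theorem derivation_sl2Matrix (D : Derivation ℂ FunAlg FunAlg) (X : Fin 3 → ℂ) (i j : Fin 2) :
    D (sl2Matrix X i j) = 0 := by
  fin_cases i <;> fin_cases j <;> simp [sl2Matrix]

theorem derivation_sl2Matrix_mul_T (D : Derivation ℂ FunAlg FunAlg) (X : Fin 3 → ℂ)
    (i j : Fin 2) : D ((sl2Matrix X * T) i j) = (sl2Matrix X * T.map D) i j := by
  simp only [Matrix.mul_apply, map_sum, Derivation.leibniz, derivation_sl2Matrix, smul_eq_mul,
    mul_zero, add_zero, Matrix.map_apply]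

theorem derivation_T_mul_sl2Matrix (D : Derivation ℂ FunAlg FunAlg) (X : Fin 3 → ℂ)
    (i j : Fin 2) : D ((T * sl2Matrix X) i j) = (T.map D * sl2Matrix X) i j := by
  simp only [Matrix.mul_apply, map_sum, Derivation.leibniz, derivation_sl2Matrix, smul_eq_mul,
    mul_zero, zero_add, Matrix.map_apply, mul_comm (sl2Matrix _ _ _)]

theorem map_rightField_T (X : Fin 3 → ℂ) : T.map (rightField X) = sl2Matrix X * T :=
  Matrix.ext (rightField_T X)

theorem map_leftField_T (X : Fin 3 → ℂ) : T.map (leftField X) = T * sl2Matrix X :=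
  Matrix.ext (leftField_T X)

theorem rightField_leftField_lie (X Y : Fin 3 → ℂ) : ⁅rightField X, leftField Y⁆ = 0 := by
  refine derivation_ext fun i j => ?_
  rw [Derivation.commutator_apply, rightField_T, leftField_T, derivation_T_mul_sl2Matrix,
    derivation_sl2Matrix_mul_T, map_rightField_T, map_leftField_T, mul_assoc, sub_self,
    Derivation.zero_apply]

/-- The Lie bracket of `sl(2)` in the basis `H, E, F`. -/
def sl2Lie (X Y : Fin 3 → ℂ) : Fin 3 → ℂ :=
  ![X 1 * Y 2 - X 2 * Y 1, 2 * (X 0 * Y 1 - X 1 * Y 0), 2 * (X 2 * Y 0 - X 0 * Y 2)]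

theorem sl2Matrix_commutator (X Y : Fin 3 → ℂ) :
    sl2Matrix X * sl2Matrix Y - sl2Matrix Y * sl2Matrix X = sl2Matrix (sl2Lie X Y) := by
  ext i j
  fin_cases i <;> fin_cases j <;> simp [sl2Matrix, sl2Lie, Algebra.smul_def, map_ofNat] <;>
    ring

theorem rightField_lie (X Y : Fin 3 → ℂ) :
    ⁅rightField X, rightField Y⁆ = rightField (sl2Lie Y X) := by
  refine derivation_ext fun i j => ?_
  rw [Derivation.commutator_apply, rightField_T, rightField_T, derivation_sl2Matrix_mul_T,
    derivation_sl2Matrix_mul_T, map_rightField_T, map_rightField_T, ← mul_assoc, ← mul_assoc,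
    ← Matrix.sub_apply, ← sub_mul, sl2Matrix_commutator, rightField_T]

/-! ### The Sklyanin bracket -/

/-- The bracket of functions given by the bivector field `D ∧ D'`. -/
def wedge (D D' : Derivation ℂ FunAlg FunAlg) : FunAlg →ₗ[ℂ] Derivation ℂ FunAlg FunAlg where
  toFun f := D f • D' - D' f • D
  map_add' f g := by rw [map_add, map_add, add_smul, add_smul, add_sub_add_comm]
  map_smul' r f := by
    rw [Derivation.map_smul, Derivation.map_smul, smul_assoc, smul_assoc, smul_sub,
      RingHom.id_apply]

theorem wedge_apply (D D' : Derivation ℂ FunAlg FunAlg) (f h : FunAlg) :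
    wedge D D' f h = D f * D' h - D' f * D h :=
  rfl

theorem derivation_wedge (D D₁ D₂ : Derivation ℂ FunAlg FunAlg) (f h : FunAlg) :
    D (wedge D₁ D₂ f h) = wedge D₁ D₂ (D f) h + wedge D₁ D₂ f (D h) +
      (wedge ⁅D, D₁⁆ D₂ f h + wedge D₁ ⁅D, D₂⁆ f h) := by
  simp only [wedge_apply, Derivation.commutator_apply, map_sub, Derivation.leibniz, smul_eq_mul]
  ring

/-- The right-invariant bivector field with value `w` at the unit, where `Λ² sl(2)` has the basis
`E ∧ F, F ∧ H, H ∧ E`. -/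
def rightWedge : (Fin 3 → ℂ) →ₗ[ℂ] FunAlg →ₗ[ℂ] Derivation ℂ FunAlg FunAlg :=
  (LinearMap.proj 0).smulRight (wedge (rightField ![0, 1, 0]) (rightField ![0, 0, 1])) +
    (LinearMap.proj 1).smulRight (wedge (rightField ![0, 0, 1]) (rightField ![1, 0, 0])) +
    (LinearMap.proj 2).smulRight (wedge (rightField ![1, 0, 0]) (rightField ![0, 1, 0]))

theorem counit_rightWedge (w : Fin 3 → ℂ) :
    counit (rightWedge w b c) = w 0 ∧ counit (rightWedge w c a) = w 1 ∧
      counit (rightWedge w a b) = w 2 := by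
  simp [rightWedge, wedge_apply, counit_apply]

theorem rightWedge_eq_zero_iff {w : Fin 3 → ℂ} : (∀ f h, rightWedge w f h = 0) ↔ w = 0 := by
  refine ⟨fun hw => ?_, fun hw f h => by rw [hw, map_zero]; rfl⟩
  obtain ⟨h₀, h₁, h₂⟩ := counit_rightWedge w
  ext k
  fin_cases k
  · exact h₀.symm.trans (by rw [hw, map_zero]; rfl)
  · exact h₁.symm.trans (by rw [hw, map_zero]; rfl)
  · exact h₂.symm.trans (by rw [hw, map_zero]; rfl)

/-- The Sklyanin bracket: the bivector field `E ∧ F`, translated from the left, minus the same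
translated from the right. -/
def sklyanin : FunAlg →ₗ[ℂ] Derivation ℂ FunAlg FunAlg :=
  wedge (leftField ![0, 1, 0]) (leftField ![0, 0, 1]) -
    wedge (rightField ![0, 1, 0]) (rightField ![0, 0, 1])

theorem rightField_eq_sum (X : Fin 3 → ℂ) :
    rightField X = X 0 • rightField ![1, 0, 0] + X 1 • rightField ![0, 1, 0] +
      X 2 • rightField ![0, 0, 1] := by
  rw [← map_smul, ← map_smul, ← map_smul, ← map_add, ← map_add]
  congr 1
  ext k
  fin_cases k <;> simp

open scoped Matrix in
theorem wedge_rightField (X Y : Fin 3 → ℂ) :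
    wedge (rightField X) (rightField Y) = rightWedge (X ⨯₃ Y) := by
  ext f h
  rw [rightField_eq_sum X, rightField_eq_sum Y]
  simp [rightWedge, wedge_apply, cross_apply, Algebra.smul_def]
  ring

theorem rightField_sklyanin (X : Fin 3 → ℂ) (f h : FunAlg) :
    rightField X (sklyanin f h) = sklyanin (rightField X f) h + sklyanin f (rightField X h) +
      rightWedge ![0, X 2, -X 1] f h := by
  have hzero (D : Derivation ℂ FunAlg FunAlg) : wedge 0 D f h = 0 ∧ wedge D 0 f h = 0 := by
    simp only [wedge_apply, Derivation.zero_apply, zero_mul, mul_zero, sub_zero, and_self]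
  have hinvariant : wedge ⁅rightField X, rightField ![0, 1, 0]⁆ (rightField ![0, 0, 1]) f h +
      wedge (rightField ![0, 1, 0]) ⁅rightField X, rightField ![0, 0, 1]⁆ f h =
        -rightWedge ![0, X 2, -X 1] f h := by
    rw [rightField_lie, rightField_lie, wedge_rightField, wedge_rightField]
    simp [rightWedge, sl2Lie, cross_apply, Algebra.smul_def]
    ring
  simp only [sklyanin, LinearMap.sub_apply, Derivation.sub_apply, map_sub, derivation_wedge,
    rightField_leftField_lie, hzero, hinvariant]
  ring

theorem sklyanin_swap (f h : FunAlg) : sklyanin f h = -sklyanin h f := by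
  simp only [sklyanin, LinearMap.sub_apply, Derivation.sub_apply, wedge_apply]
  ring

theorem sklyanin_self (f : FunAlg) : sklyanin f f = 0 := by
  simp only [sklyanin, LinearMap.sub_apply, Derivation.sub_apply, wedge_apply]
  ring

theorem sklyanin_mul_left (f g h : FunAlg) :
    sklyanin (f * g) h = f * sklyanin g h + g * sklyanin f h := by
  rw [sklyanin_swap, Derivation.leibniz, smul_eq_mul, smul_eq_mul, sklyanin_swap h,
    sklyanin_swap h]
  ring

theorem sklyanin_a_b : sklyanin a b = -(a * b) := by
  simp [sklyanin, wedge_apply, mul_comm]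

theorem sklyanin_b_d : sklyanin b d = -(b * d) := by
  simp [sklyanin, wedge_apply, mul_comm]

theorem sklyanin_c_b : sklyanin c b = 0 := by
  simp [sklyanin, wedge_apply, mul_comm]

theorem sklyanin_a_c : sklyanin a c = -(a * c) := by
  simp [sklyanin, wedge_apply, mul_comm]

theorem sklyanin_c_d : sklyanin c d = -(c * d) := by
  simp [sklyanin, wedge_apply, mul_comm]

theorem sklyanin_a_d : sklyanin a d = -(2 * b * c) := by
  simp [sklyanin, wedge_apply]
  ring

theorem sklyanin_b_a : sklyanin b a = a * b := by rw [sklyanin_swap, sklyanin_a_b, neg_neg]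

theorem sklyanin_d_b : sklyanin d b = b * d := by rw [sklyanin_swap, sklyanin_b_d, neg_neg]

theorem sklyanin_b_c : sklyanin b c = 0 := by rw [sklyanin_swap, sklyanin_c_b, neg_zero]

theorem sklyanin_c_a : sklyanin c a = a * c := by rw [sklyanin_swap, sklyanin_a_c, neg_neg]

theorem sklyanin_d_c : sklyanin d c = c * d := by rw [sklyanin_swap, sklyanin_c_d, neg_neg]

theorem sklyanin_d_a : sklyanin d a = 2 * b * c := by rw [sklyanin_swap, sklyanin_a_d, neg_neg]

theorem sklyanin_lie (f g : FunAlg) :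
    ⁅sklyanin f, sklyanin g⁆ = sklyanin (sklyanin f g) := by
  have hrotate {f g h : FunAlg} (e : ⁅sklyanin f, sklyanin g⁆ h = sklyanin (sklyanin f g) h) :
      ⁅sklyanin g, sklyanin h⁆ f = sklyanin (sklyanin g h) f := by
    rw [Derivation.commutator_apply] at e ⊢
    rw [sklyanin_swap h f, sklyanin_swap g f, sklyanin_swap _ f, map_neg, map_neg,
      sklyanin_swap h (sklyanin f g), ← e]
    ring
  have hlast {f g : FunAlg}
      (e : ∀ i j, ⁅sklyanin f, sklyanin g⁆ (T i j) = sklyanin (sklyanin f g) (T i j)) (h : FunAlg) :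
      ⁅sklyanin f, sklyanin g⁆ h = sklyanin (sklyanin f g) h :=
    DFunLike.congr_fun (derivation_ext e) h
  have hgen : ∀ i j k l m n, ⁅sklyanin (T i j), sklyanin (T k l)⁆ (T m n) =
      -sklyanin (T m n) (sklyanin (T i j) (T k l)) := by
    have hT : T 0 0 = a ∧ T 0 1 = b ∧ T 1 0 = c ∧ T 1 1 = d := ⟨rfl, rfl, rfl, rfl⟩
    simp only [Fin.forall_fin_two, hT, Derivation.commutator_apply, sklyanin_self, sklyanin_a_b,
      sklyanin_a_c, sklyanin_a_d, sklyanin_b_a, sklyanin_b_c, sklyanin_b_d, sklyanin_c_a,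
      sklyanin_c_b, sklyanin_c_d, sklyanin_d_a, sklyanin_d_b, sklyanin_d_c, two_mul,
      add_mul, map_neg, map_add, map_zero, Derivation.leibniz, smul_eq_mul]
    constructorm* _ ∧ _ <;> ring
  exact derivation_ext fun i j => hrotate <| hlast (fun k l => hrotate <|
    hlast (fun m n => (hgen k l i j m n).trans (sklyanin_swap _ _).symm) f) g

/-! ### The external algebra as a graded commutative algebra -/

theorem incl_apply (f : FunAlg) : incl f = f ⊗ₜ 1 := rfl

theorem incl_mul (f : FunAlg) (x : ExtAlg) : incl f * x = f • x := by
  rw [← one_mul (f • x), mul_smul_comm, ← smul_mul_assoc]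
  congr 1
  rw [incl_apply, Algebra.TensorProduct.one_def, TensorProduct.smul_tmul', smul_eq_mul, mul_one]

theorem incl_eq_smul (f : FunAlg) : incl f = f • (1 : ExtAlg) := by
  rw [← incl_mul, mul_one]

theorem mul_incl (f : FunAlg) (x : ExtAlg) : x * incl f = f • x := by
  rw [incl_eq_smul, mul_smul_comm, mul_one]

theorem one_tmul_ι (v : Fin 3 → ℂ) :
    (1 ⊗ₜ ExteriorAlgebra.ι ℂ v : ExtAlg) = ∑ i, v i • θ i := by
  conv_lhs => rw [pi_eq_sum_univ' v]
  simp only [map_sum, map_smul, TensorProduct.tmul_sum, TensorProduct.tmul_smul, θ]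

@[elab_as_elim]
theorem ExtAlg.induction {P : ExtAlg → Prop} (x : ExtAlg) (one : P 1)
    (smul : ∀ (f : FunAlg) x, P x → P (f • x)) (θ_mul : ∀ i x, P x → P (θ i * x))
    (add : ∀ x y, P x → P y → P (x + y)) : P x := by
  have hforms (w : Forms) : ∀ x, P x → P ((1 ⊗ₜ w) * x) := by
    induction w using ExteriorAlgebra.induction with
    | algebraMap r =>
      intro x hx
      rw [Algebra.algebraMap_eq_smul_one, TensorProduct.tmul_smul,
        ← Algebra.TensorProduct.one_def, smul_mul_assoc, one_mul, ← algebraMap_smul FunAlg r x]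
      exact smul _ x hx
    | ι v =>
      intro x hx
      have hsmul (i : Fin 3) : P (v i • θ i * x) := by
        rw [smul_mul_assoc, ← algebraMap_smul FunAlg (v i) (θ i * x)]
        exact smul _ _ (θ_mul i x hx)
      rw [one_tmul_ι, Fin.sum_univ_three, add_mul, add_mul]
      exact add _ _ (add _ _ (hsmul 0) (hsmul 1)) (hsmul 2)
    | mul u v hu hv =>
      intro x hx
      have h := hu _ (hv x hx)
      rwa [← mul_assoc, Algebra.TensorProduct.tmul_mul_tmul, one_mul] at h
    | add u v hu hv =>
      intro x hx
      rw [TensorProduct.tmul_add, add_mul]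
      exact add _ _ (hu x hx) (hv x hx)
  induction x using TensorProduct.induction_on with
  | zero => simpa only [zero_smul] using smul 0 1 one
  | add x y hx hy => exact add x y hx hy
  | tmul f w =>
    have h := smul f _ (hforms w 1 one)
    rwa [mul_one, TensorProduct.smul_tmul', smul_eq_mul, mul_one] at h

@[simp]
theorem parity_incl (f : FunAlg) : parity (incl f) = incl f := by
  rw [parity, incl_apply, Algebra.TensorProduct.map_tmul, map_one, AlgHom.id_apply]

@[simp]
theorem parity_θ (i : Fin 3) : parity (θ i) = -θ i := by
  simp [parity, θ, ExteriorAlgebra.ι, CliffordAlgebra.involute_ι, TensorProduct.tmul_neg]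

@[simp]
theorem parity_smul (f : FunAlg) (x : ExtAlg) : parity (f • x) = f • parity x := by
  rw [← incl_mul, map_mul, parity_incl, incl_mul]

@[simp]
theorem parity_parity (x : ExtAlg) : parity (parity x) = x := by
  induction x using ExtAlg.induction with
  | one => rw [map_one, map_one]
  | smul f x hx => rw [parity_smul, parity_smul, hx]
  | θ_mul i x hx => rw [map_mul, map_mul, parity_θ, map_neg, parity_θ, neg_neg, hx]
  | add x y hx hy => rw [map_add, map_add, hx, hy]

@[simp]
theorem koszul_zero_left (q : ZMod 2) : koszul 0 q = 1 := if_neg (by simp)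

@[simp]
theorem koszul_zero_right (p : ZMod 2) : koszul p 0 = 1 := if_neg (by simp)

@[simp]
theorem koszul_one_one : koszul 1 1 = -1 := if_pos ⟨rfl, rfl⟩

theorem zmod_two_cases (p : ZMod 2) : p = 0 ∨ p = 1 := by
  revert p
  decide

theorem koszul_comm (p q : ZMod 2) : koszul p q = koszul q p := by
  simp only [koszul, and_comm]

theorem koszul_add_right (p q r : ZMod 2) : koszul p (q + r) = koszul p q * koszul p r := by
  have h : (1 : ZMod 2) + 1 = 0 := rfl
  obtain rfl | rfl := zmod_two_cases p <;> obtain rfl | rfl := zmod_two_cases q <;>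
    obtain rfl | rfl := zmod_two_cases r <;> simp [h]

theorem koszul_add_left (p q r : ZMod 2) : koszul (p + q) r = koszul p r * koszul q r := by
  rw [koszul_comm, koszul_add_right, koszul_comm r p, koszul_comm r q]

@[simp]
theorem koszul_mul_self (p q : ZMod 2) : koszul p q * koszul p q = 1 := by
  rw [← koszul_add_right, CharTwo.add_self_eq_zero, koszul_zero_right]

theorem mem_degPart {p : ZMod 2} {x : ExtAlg} : x ∈ degPart p ↔ parity x = koszul p 1 • x := by
  simp [degPart, sub_eq_zero]

theorem incl_mem_degPart (f : FunAlg) : incl f ∈ degPart 0 := by simp [mem_degPart]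

theorem θ_mem_degPart (i : Fin 3) : θ i ∈ degPart 1 := by simp [mem_degPart]

theorem mul_mem_degPart {p q : ZMod 2} {x y : ExtAlg} (hx : x ∈ degPart p) (hy : y ∈ degPart q) :
    x * y ∈ degPart (p + q) := by
  rw [mem_degPart] at hx hy ⊢
  rw [map_mul, hx, hy, smul_mul_smul_comm, koszul_add_left]

theorem exists_degPart_add (x : ExtAlg) : ∃ y ∈ degPart 0, ∃ z ∈ degPart 1, x = y + z := by
  refine ⟨(2⁻¹ : ℂ) • (x + parity x), ?_, (2⁻¹ : ℂ) • (x - parity x), ?_, ?_⟩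
  · simp [mem_degPart, add_comm]
  · simp [mem_degPart]
  · rw [← smul_add, add_add_sub_cancel, ← two_smul ℂ x, inv_smul_smul₀ two_ne_zero]

/-- The automorphism of `ℳ` that multiplies elements of degree `q` by `(-1)^(p q)`. -/
def twist (p : ZMod 2) : ExtAlg →ₐ[ℂ] ExtAlg := if p = 1 then parity else AlgHom.id ℂ ExtAlg

theorem twist_of_mem {p q : ZMod 2} {x : ExtAlg} (hx : x ∈ degPart q) :
    twist p x = koszul p q • x := by
  rw [mem_degPart] at hx
  obtain rfl | rfl := zmod_two_cases p
  · simp [twist]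
  · rw [twist, if_pos rfl, hx, koszul_comm]

theorem mul_comm_of_mem {p q : ZMod 2} {x y : ExtAlg} (hx : x ∈ degPart p)
    (hy : y ∈ degPart q) : x * y = koszul p q • (y * x) := by
  have hθ (i : Fin 3) (z : ExtAlg) : z * θ i = θ i * twist 1 z := by
    induction z using ExtAlg.induction with
    | one => rw [one_mul, map_one, mul_one]
    | smul f z hz => rw [smul_mul_assoc, hz, twist, if_pos rfl, parity_smul, mul_smul_comm]
    | θ_mul j z hz =>
      rw [mul_assoc, hz, ← mul_assoc, θ_mul_swap, map_mul, twist_of_mem (θ_mem_degPart j),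
        koszul_one_one, neg_one_smul, neg_mul, mul_assoc, ← mul_neg, neg_mul]
    | add u v hu hv => rw [add_mul, hu, hv, map_add, mul_add]
  have h (z : ExtAlg) : y * z = twist q z * y := by
    induction z using ExtAlg.induction with
    | one => rw [mul_one, map_one, one_mul]
    | smul f z hz =>
      rw [mul_smul_comm, hz, ← incl_mul, ← incl_mul, map_mul, twist_of_mem (incl_mem_degPart f),
        koszul_zero_right, one_smul, mul_assoc]
    | θ_mul j z hz =>
      rw [← mul_assoc, hθ, twist_of_mem hy, mul_smul_comm, smul_mul_assoc, mul_assoc, hz, map_mul,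
        twist_of_mem (θ_mem_degPart j), koszul_comm, smul_mul_assoc, smul_mul_assoc, mul_assoc]
    | add u v hu hv => rw [mul_add, hu, hv, map_add, add_mul]
  rw [h x, twist_of_mem hx, koszul_comm, smul_mul_assoc, smul_smul, koszul_mul_self, one_smul]

/-! ### Contractions and coefficients of forms -/

/-- The contraction with the `i`-th coordinate, an odd derivation of `ℳ` over `𝒜`. -/
def contract (i : Fin 3) : ExtAlg →ₗ[FunAlg] ExtAlg :=
  TensorProduct.AlgebraTensorModule.lTensor FunAlg FunAlg
    (CliffordAlgebra.contractLeft (Q := (0 : QuadraticForm ℂ (Fin 3 → ℂ)))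
      (LinearMap.proj i : (Fin 3 → ℂ) →ₗ[ℂ] ℂ))

theorem contract_tmul (i : Fin 3) (f : FunAlg) (w : Forms) :
    contract i (f ⊗ₜ w) = f ⊗ₜ CliffordAlgebra.contractLeft
      (Q := (0 : QuadraticForm ℂ (Fin 3 → ℂ))) (LinearMap.proj i : (Fin 3 → ℂ) →ₗ[ℂ] ℂ) w :=
  rfl

@[simp]
theorem contract_one (i : Fin 3) : contract i 1 = 0 := by
  rw [Algebra.TensorProduct.one_def, contract_tmul, CliffordAlgebra.contractLeft_one,
    TensorProduct.tmul_zero]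

@[simp]
theorem contract_incl (i : Fin 3) (f : FunAlg) : contract i (incl f) = 0 := by
  rw [incl_eq_smul, map_smul, contract_one, smul_zero]

theorem contract_θ_mul (i j : Fin 3) (x : ExtAlg) :
    contract i (θ j * x) = (Pi.single j 1 : Fin 3 → ℂ) i • x - θ j * contract i x := by
  induction x using TensorProduct.induction_on with
  | zero => simp only [mul_zero, map_zero, smul_zero, sub_zero]
  | add x y hx hy => rw [mul_add, map_add, hx, hy, map_add, smul_add, mul_add, add_sub_add_comm]
  | tmul f w =>
    rw [θ, Algebra.TensorProduct.tmul_mul_tmul, one_mul, contract_tmul, contract_tmul,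
      Algebra.TensorProduct.tmul_mul_tmul, one_mul, ← TensorProduct.tmul_smul,
      ← TensorProduct.tmul_sub]
    exact congrArg _ (CliffordAlgebra.contractLeft_ι_mul _ _ _)

@[simp]
theorem contract_θ (i j : Fin 3) : contract i (θ j) = if i = j then 1 else 0 := by
  have h := contract_θ_mul i j 1
  rw [mul_one, contract_one, mul_zero, sub_zero, Pi.single_apply, ite_smul, one_smul, zero_smul]
    at h
  exact h

theorem parity_contract (i : Fin 3) (x : ExtAlg) :
    parity (contract i x) = -contract i (parity x) := by
  induction x using ExtAlg.induction with
  | one => rw [contract_one, map_zero, map_one, contract_one, neg_zero]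
  | smul f x hx => rw [(contract i).map_smul, parity_smul, parity_smul, map_smul, hx, smul_neg]
  | θ_mul j x hx =>
    rw [contract_θ_mul, map_sub, map_smul, map_mul, hx, map_mul, parity_θ, neg_mul, neg_mul,
      map_neg, contract_θ_mul, neg_neg, mul_neg, neg_neg]
  | add x y hx hy => simp only [map_add, hx, hy, neg_add]

theorem contract_mem_degPart {p : ZMod 2} {x : ExtAlg} (i : Fin 3) (hx : x ∈ degPart p) :
    contract i x ∈ degPart (1 + p) := by
  rw [mem_degPart] at hx ⊢
  rw [parity_contract, hx, koszul_add_left, koszul_one_one, LinearMap.map_smul_of_tower,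
    neg_one_mul, neg_smul]

theorem contract_mul (i : Fin 3) (x y : ExtAlg) :
    contract i (x * y) = contract i x * y + twist 1 x * contract i y := by
  induction x using ExtAlg.induction with
  | one => rw [one_mul, contract_one, zero_mul, zero_add, map_one, one_mul]
  | smul f x hx =>
    rw [smul_mul_assoc, map_smul, map_smul, hx, smul_add, ← incl_mul f x, map_mul,
      twist_of_mem (incl_mem_degPart f), koszul_zero_right, one_smul, mul_assoc, incl_mul,
      smul_mul_assoc]
  | θ_mul j x hx =>
    rw [mul_assoc, contract_θ_mul, hx, contract_θ_mul, map_mul, twist_of_mem (θ_mem_degPart j),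
      koszul_one_one, neg_one_smul, neg_mul, neg_mul, sub_mul, smul_mul_assoc, mul_add, mul_assoc,
      mul_assoc, sub_add_eq_sub_sub, sub_eq_add_neg _ (θ j * (_ * contract i y))]
  | add u v hu hv => simp only [add_mul, map_add, hu, hv, add_add_add_comm]

/-- The projection of `ℳ` onto its forms of degree zero. -/
def aug : ExtAlg →ₗ[FunAlg] FunAlg :=
  (TensorProduct.AlgebraTensorModule.rid ℂ FunAlg FunAlg).toLinearMap ∘ₗ
    TensorProduct.AlgebraTensorModule.lTensor FunAlg FunAlg
      (ExteriorAlgebra.algebraMapInv : Forms →ₐ[ℂ] ℂ).toLinearMap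

theorem aug_tmul (f : FunAlg) (w : Forms) :
    aug (f ⊗ₜ w) = (ExteriorAlgebra.algebraMapInv w : ℂ) • f :=
  rfl

@[simp]
theorem aug_one : aug 1 = 1 := by
  rw [Algebra.TensorProduct.one_def, aug_tmul, map_one, one_smul]

@[simp]
theorem aug_θ_mul (i : Fin 3) (x : ExtAlg) : aug (θ i * x) = 0 := by
  induction x using TensorProduct.induction_on with
  | zero => rw [mul_zero, map_zero]
  | add x y hx hy => rw [mul_add, map_add, hx, hy, add_zero]
  | tmul f w =>
    rw [θ, Algebra.TensorProduct.tmul_mul_tmul, aug_tmul, map_mul]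
    simp [ExteriorAlgebra.algebraMapInv]

/-- The quadratic form `θᵏ⁺¹ θᵏ⁺²`, indices modulo `3`. -/
def quadFrame (k : Fin 3) : ExtAlg := θ (k + 1) * θ (k + 2)

theorem θ_mul_θ_eq_quadFrame :
    θ 1 * θ 2 = quadFrame 0 ∧ θ 2 * θ 0 = quadFrame 1 ∧ θ 0 * θ 1 = quadFrame 2 :=
  ⟨rfl, rfl, rfl⟩

/-- The coefficient of `quadFrame k`. -/
def quadCoeff (k : Fin 3) : ExtAlg →ₗ[FunAlg] FunAlg :=
  aug ∘ₗ contract (k + 2) ∘ₗ contract (k + 1)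

/-- The basis of the odd part of `ℳ` over `𝒜`: the forms `θⁱ` and the volume form `θ⁰ θ¹ θ²`, the
latter with index `none`. -/
def oddFrame : Option (Fin 3) → ExtAlg
  | some i => θ i
  | none => θ 0 * (θ 1 * θ 2)

/-- The coefficient of `oddFrame k`. -/
def oddCoeff : Option (Fin 3) → ExtAlg →ₗ[FunAlg] FunAlg
  | some i => aug ∘ₗ contract i
  | none => aug ∘ₗ contract 2 ∘ₗ contract 1 ∘ₗ contract 0

theorem quadCoeff_quadFrame (k l : Fin 3) :
    quadCoeff k (quadFrame l) = if k = l then 1 else 0 := by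
  fin_cases k <;> fin_cases l <;> simp [quadCoeff, quadFrame, contract_θ_mul]

theorem oddCoeff_oddFrame (k l : Option (Fin 3)) :
    oddCoeff k (oddFrame l) = if k = l then 1 else 0 := by
  match k, l with
  | some i, some j => simp [oddCoeff, oddFrame, apply_ite aug]
  | some i, none => simp [oddCoeff, oddFrame, contract_θ_mul]
  | none, some j => fin_cases j <;> simp [oddCoeff, oddFrame]
  | none, none => simp [oddCoeff, oddFrame, contract_θ_mul]

theorem θ_mul_θ_mem_span (i j : Fin 3) :
    θ i * θ j ∈ Submodule.span FunAlg (Set.range quadFrame) := by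
  have hpos (k : Fin 3) : θ (k + 1) * θ (k + 2) ∈ Submodule.span FunAlg (Set.range quadFrame) :=
    Submodule.subset_span ⟨k, rfl⟩
  have hneg (k : Fin 3) : θ (k + 2) * θ (k + 1) ∈ Submodule.span FunAlg (Set.range quadFrame) := by
    rw [θ_mul_swap]
    exact neg_mem (hpos k)
  obtain rfl | rfl | rfl : j = i ∨ j = i + 1 ∨ j = i + 2 := by decide +revert
  · rw [θ_mul_self]
    exact zero_mem _
  · simpa [add_assoc] using hpos (i + 2)
  · simpa [add_assoc] using hneg (i + 1)

theorem quadFrame_expansion {x : ExtAlg}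
    (hx : x ∈ Submodule.span FunAlg (Set.range quadFrame)) :
    x = ∑ k, quadCoeff k x • quadFrame k := by
  obtain ⟨c, rfl⟩ := (Submodule.mem_span_range_iff_exists_fun FunAlg).mp hx
  simp only [map_sum, map_smul, quadCoeff_quadFrame, smul_eq_mul, mul_ite, mul_one, mul_zero,
    Finset.sum_ite_eq, Finset.mem_univ, if_true]

theorem θ_mul_quadFrame (i k : Fin 3) :
    θ i * quadFrame k = if i = k then θ 0 * (θ 1 * θ 2) else 0 := by
  have hcycle (i j k : Fin 3) : θ i * (θ j * θ k) = θ k * (θ i * θ j) := by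
    rw [θ_mul_swap j k, mul_neg, ← mul_assoc, θ_mul_swap i k, neg_mul, neg_neg, mul_assoc]
  have hrepeat (i j : Fin 3) : θ i * (θ i * θ j) = 0 ∧ θ i * (θ j * θ i) = 0 := by
    rw [hcycle i j, ← mul_assoc, θ_mul_self, zero_mul, and_self]
  fin_cases i <;> fin_cases k <;>
    simp [quadFrame, hrepeat, hcycle 1 2 0, hcycle 2 0 1]

theorem θ_mul_mem_span_oddFrame (i : Fin 3) {x : ExtAlg}
    (hx : x ∈ Submodule.span FunAlg (insert 1 (Set.range quadFrame))) :
    θ i * x ∈ Submodule.span FunAlg (Set.range oddFrame) := by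
  have hmap : Submodule.span FunAlg (insert 1 (Set.range quadFrame)) ≤
      (Submodule.span FunAlg (Set.range oddFrame)).comap (LinearMap.mulLeft FunAlg (θ i)) := by
    rw [Submodule.span_le]
    rintro _ (rfl | ⟨k, rfl⟩)
    · exact Submodule.subset_span ⟨some i, (mul_one _).symm⟩
    · rw [SetLike.mem_coe, Submodule.mem_comap, LinearMap.mulLeft_apply, θ_mul_quadFrame]
      split_ifs
      · exact Submodule.subset_span ⟨none, rfl⟩
      · exact zero_mem _
  exact hmap hx

theorem θ_mul_mem_span_quadFrame (i : Fin 3) {x : ExtAlg}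
    (hx : x ∈ Submodule.span FunAlg (Set.range oddFrame)) :
    θ i * x ∈ Submodule.span FunAlg (insert 1 (Set.range quadFrame)) := by
  have hmap : Submodule.span FunAlg (Set.range oddFrame) ≤
      (Submodule.span FunAlg (Set.range quadFrame)).comap (LinearMap.mulLeft FunAlg (θ i)) := by
    rw [Submodule.span_le]
    rintro _ ⟨k | k, rfl⟩
    · have hvolume : θ i * quadFrame i = oddFrame none := by
        rw [θ_mul_quadFrame, if_pos rfl, oddFrame]
      rw [SetLike.mem_coe, Submodule.mem_comap, LinearMap.mulLeft_apply, ← hvolume, ← mul_assoc,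
        θ_mul_self, zero_mul]
      exact zero_mem _
    · exact θ_mul_θ_mem_span i k
  exact Submodule.span_mono (Set.subset_insert _ _) (hmap hx)

theorem oddFrame_expansion {x : ExtAlg} (hx : x ∈ degPart 1) :
    x = ∑ k, oddCoeff k x • oddFrame k := by
  have hsplit (y : ExtAlg) :
      y + parity y ∈ Submodule.span FunAlg (insert 1 (Set.range quadFrame)) ∧
        y - parity y ∈ Submodule.span FunAlg (Set.range oddFrame) := by
    induction y using ExtAlg.induction with
    | one =>
      rw [map_one, sub_self]
      have hone := Submodule.subset_span (R := FunAlg) (Set.mem_insert 1 (Set.range quadFrame))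
      exact ⟨add_mem hone hone, zero_mem _⟩
    | smul f y hy =>
      rw [parity_smul, ← smul_add, ← smul_sub]
      exact ⟨Submodule.smul_mem _ f hy.1, Submodule.smul_mem _ f hy.2⟩
    | θ_mul i y hy =>
      rw [map_mul, parity_θ, neg_mul, ← sub_eq_add_neg, sub_neg_eq_add, ← mul_sub, ← mul_add]
      exact ⟨θ_mul_mem_span_quadFrame i hy.2, θ_mul_mem_span_oddFrame i hy.1⟩
    | add y z hy hz =>
      rw [map_add, add_add_add_comm, add_sub_add_comm]
      exact ⟨add_mem hy.1 hz.1, add_mem hy.2 hz.2⟩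
  have hspan : x ∈ Submodule.span FunAlg (Set.range oddFrame) := by
    have h := (hsplit x).2
    rw [mem_degPart.mp hx, koszul_one_one, neg_one_smul, sub_neg_eq_add, ← two_smul ℂ x] at h
    rw [← inv_smul_smul₀ (two_ne_zero (α := ℂ)) x]
    exact Submodule.smul_of_tower_mem _ _ h
  obtain ⟨c, rfl⟩ := (Submodule.mem_span_range_iff_exists_fun FunAlg).mp hspan
  simp only [map_sum, map_smul, oddCoeff_oddFrame, smul_eq_mul, mul_ite, mul_one, mul_zero,
    Finset.sum_ite_eq, Finset.mem_univ, if_true]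

/-! ### Graded derivations and graded brackets -/

/-- The homogeneous generators of `ℳ`, with their degrees. -/
inductive IsGenerator : ZMod 2 → ExtAlg → Prop
  | incl (f : FunAlg) : IsGenerator 0 (incl f)
  | θ (i : Fin 3) : IsGenerator 1 (θ i)

theorem IsGenerator.mem_degPart {p : ZMod 2} {x : ExtAlg} (hx : IsGenerator p x) :
    x ∈ degPart p := by
  cases hx with
  | incl f => exact incl_mem_degPart f
  | θ i => exact θ_mem_degPart i

/-- A graded derivation of degree `p` of `ℳ`, acting from the left. -/
structure IsGradedDer (p : ZMod 2) (D : ExtAlg →ₗ[ℂ] ExtAlg) : Prop where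
  degree : ∀ {q : ZMod 2} {x : ExtAlg}, x ∈ degPart q → D x ∈ degPart (p + q)
  leibniz : ∀ {q : ZMod 2} {x : ExtAlg}, x ∈ degPart q → ∀ y,
    D (x * y) = D x * y + koszul p q • (x * D y)

namespace IsGradedDer

variable {p q : ZMod 2} {D D' : ExtAlg →ₗ[ℂ] ExtAlg}

theorem apply_one (hD : IsGradedDer p D) : D 1 = 0 := by
  have h := hD.leibniz (incl_mem_degPart 1) 1
  rw [map_one, koszul_zero_right, one_smul, mul_one, mul_one, one_mul] at h
  exact left_eq_add.mp h

theorem apply_smul (hD : IsGradedDer p D) (f : FunAlg) (x : ExtAlg) :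
    D (f • x) = D (incl f) * x + f • D x := by
  rw [← incl_mul, hD.leibniz (incl_mem_degPart f), koszul_zero_right, one_smul, incl_mul]

theorem ext (hD : IsGradedDer p D) (hD' : IsGradedDer p D')
    (h : ∀ r x, IsGenerator r x → D x = D' x) : D = D' := by
  refine LinearMap.ext fun x => ?_
  induction x using ExtAlg.induction with
  | one => rw [hD.apply_one, hD'.apply_one]
  | smul f x hx => rw [hD.apply_smul, hD'.apply_smul, hx, h _ _ (.incl f)]
  | θ_mul i x hx =>
    rw [hD.leibniz (θ_mem_degPart i), hD'.leibniz (θ_mem_degPart i), hx, h _ _ (.θ i)]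
  | add x y hx hy => rw [map_add, map_add, hx, hy]

theorem zero : IsGradedDer p 0 where
  degree _ := zero_mem _
  leibniz _ _ := by simp only [LinearMap.zero_apply, zero_mul, mul_zero, smul_zero, add_zero]

theorem add (hD : IsGradedDer p D) (hD' : IsGradedDer p D') : IsGradedDer p (D + D') where
  degree hx := add_mem (hD.degree hx) (hD'.degree hx)
  leibniz hx y := by
    simp only [LinearMap.add_apply, hD.leibniz hx, hD'.leibniz hx, add_mul, mul_add, smul_add,
      add_add_add_comm]

theorem smul (hD : IsGradedDer p D) (s : ℂ) : IsGradedDer p (s • D) where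
  degree hx := Submodule.smul_mem _ s (hD.degree hx)
  leibniz hx y := by
    simp only [LinearMap.smul_apply, hD.leibniz hx, smul_add, smul_mul_assoc, mul_smul_comm,
      smul_comm s]

theorem sub (hD : IsGradedDer p D) (hD' : IsGradedDer p D') : IsGradedDer p (D - D') := by
  rw [sub_eq_add_neg, ← neg_one_smul ℂ D']
  exact hD.add (hD'.smul (-1))

theorem mulLeft_comp (hD : IsGradedDer p D) {u : ExtAlg} (hu : u ∈ degPart q) :
    IsGradedDer (q + p) (LinearMap.mulLeft ℂ u ∘ₗ D) where
  degree hx := by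
    rw [add_assoc]
    exact mul_mem_degPart hu (hD.degree hx)
  leibniz hx y := by
    simp only [LinearMap.comp_apply, LinearMap.mulLeft_apply, hD.leibniz hx, mul_add,
      mul_smul_comm]
    rw [← mul_assoc u _ (D y), mul_comm_of_mem hu hx, koszul_add_left]
    simp only [smul_mul_assoc, smul_smul, mul_assoc, mul_comm]

theorem commutator (hD : IsGradedDer p D) (hD' : IsGradedDer q D') :
    IsGradedDer (p + q) (D ∘ₗ D' - koszul p q • (D' ∘ₗ D)) where
  degree hx := by
    refine sub_mem ?_ (Submodule.smul_mem _ _ ?_)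
    · exact (add_assoc p q _).symm ▸ hD.degree (hD'.degree hx)
    · exact (add_left_comm q p _).trans (add_assoc p q _).symm ▸ hD'.degree (hD.degree hx)
  leibniz {r x} hx y := by
    simp only [LinearMap.sub_apply, LinearMap.smul_apply, LinearMap.comp_apply, hD.leibniz hx,
      hD'.leibniz hx, map_add, map_smul, hD.leibniz (hD'.degree hx), hD'.leibniz (hD.degree hx),
      koszul_add_left, koszul_add_right, koszul_comm q p, smul_add, smul_smul, sub_mul, mul_sub,
      smul_sub, smul_mul_assoc, mul_smul_comm]
    rw [← mul_assoc (koszul p q) (koszul p q), koszul_mul_self, one_mul]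
    module

end IsGradedDer

namespace IsGradedBracket

variable {B B' : Bracket}

theorem isGradedDer (hB : IsGradedBracket B) {p : ZMod 2} {x : ExtAlg} (hx : x ∈ degPart p) :
    IsGradedDer p (B x) where
  degree hy := hB.degree _ _ _ _ hx hy
  leibniz {q y} hy z := by
    have hhom {r : ZMod 2} {z : ExtAlg} (hz : z ∈ degPart r) :
        B x (y * z) = B x y * z + koszul p q • (y * B x z) := by
      rw [hB.symm _ _ _ _ hx (mul_mem_degPart hy hz), hB.leibniz _ _ _ _ _ _ hy hz hx,
        hB.symm _ _ _ _ hz hx, hB.symm _ _ _ _ hy hx, koszul_add_right, koszul_comm q p,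
        koszul_comm r p]
      simp only [mul_neg, neg_mul, smul_neg, smul_add, neg_add, neg_neg, mul_smul_comm,
        smul_mul_assoc, smul_smul]
      rw [mul_assoc (koszul p q), koszul_mul_self, mul_one, mul_comm (koszul p r) (koszul p q),
        mul_mul_mul_comm, koszul_mul_self, koszul_mul_self, mul_one, one_smul, add_comm]
    obtain ⟨z₀, hz₀, z₁, hz₁, rfl⟩ := exists_degPart_add z
    rw [mul_add, map_add, hhom hz₀, hhom hz₁, map_add, mul_add, mul_add, smul_add,
      add_add_add_comm]

theorem of_isGradedDer (hder : ∀ p x, x ∈ degPart p → IsGradedDer p (B x))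
    (hsymm : ∀ p q x y, x ∈ degPart p → y ∈ degPart q → B x y = -(koszul p q • B y x)) :
    IsGradedBracket B where
  degree p q x y hx hy := (hder p x hx).degree hy
  symm := hsymm
  leibniz p q r x y z hx hy hz := by
    rw [hsymm _ _ _ _ (mul_mem_degPart hx hy) hz, (hder r z hz).leibniz hx, hsymm _ _ _ _ hz hx,
      hsymm _ _ _ _ hz hy, koszul_add_left, koszul_comm r p, koszul_comm r q]
    simp only [mul_neg, neg_mul, smul_neg, smul_add, neg_add, neg_neg, mul_smul_comm,
      smul_mul_assoc, smul_smul]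
    rw [mul_right_comm, koszul_mul_self, one_mul, mul_mul_mul_comm, koszul_mul_self,
      koszul_mul_self, mul_one, one_smul, add_comm]

theorem zero : IsGradedBracket 0 :=
  of_isGradedDer (fun _ _ _ => .zero) fun _ _ _ _ _ _ => by
    simp only [LinearMap.zero_apply, smul_zero, neg_zero]

theorem add (hB : IsGradedBracket B) (hB' : IsGradedBracket B') : IsGradedBracket (B + B') :=
  of_isGradedDer (fun _ _ hx => (hB.isGradedDer hx).add (hB'.isGradedDer hx))
    fun p q x y hx hy => by
      rw [LinearMap.add_apply, LinearMap.add_apply, hB.symm p q x y hx hy,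
        hB'.symm p q x y hx hy, ← neg_add, ← smul_add, LinearMap.add_apply, LinearMap.add_apply]

theorem sub (hB : IsGradedBracket B) (hB' : IsGradedBracket B') : IsGradedBracket (B - B') :=
  of_isGradedDer (fun _ _ hx => (hB.isGradedDer hx).sub (hB'.isGradedDer hx))
    fun p q x y hx hy => by
      rw [LinearMap.sub_apply, LinearMap.sub_apply, hB.symm p q x y hx hy,
        hB'.symm p q x y hx hy, LinearMap.sub_apply, LinearMap.sub_apply, smul_sub, neg_sub_neg,
        neg_sub]

theorem incl_right (hB : IsGradedBracket B) (x : ExtAlg) (f : FunAlg) :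
    B x (incl f) = -B (incl f) x := by
  obtain ⟨y, hy, z, hz, rfl⟩ := exists_degPart_add x
  rw [map_add, LinearMap.add_apply, hB.symm _ _ _ _ hy (incl_mem_degPart f),
    hB.symm _ _ _ _ hz (incl_mem_degPart f), map_add, koszul_zero_right, koszul_zero_right,
    one_smul, one_smul, neg_add]

theorem ext_of_generators (hB : IsGradedBracket B) (hB' : IsGradedBracket B')
    (hff : ∀ f h, B (incl f) (incl h) = B' (incl f) (incl h))
    (hθf : ∀ i f, B (θ i) (incl f) = B' (θ i) (incl f))
    (hθθ : ∀ i j, B (θ i) (θ j) = B' (θ i) (θ j)) : B = B' := by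
  have heq {p : ZMod 2} {x : ExtAlg} (hx : x ∈ degPart p)
      (hgen : ∀ q y, IsGenerator q y → B y x = B' y x) : B x = B' x := by
    refine (hB.isGradedDer hx).ext (hB'.isGradedDer hx) fun q y hy => ?_
    rw [hB.symm _ _ _ _ hx hy.mem_degPart, hB'.symm _ _ _ _ hx hy.mem_degPart, hgen q y hy]
  have hgen (p : ZMod 2) (x : ExtAlg) (hx : IsGenerator p x) : B x = B' x := by
    refine heq hx.mem_degPart fun q y hy => ?_
    cases hx with
    | incl f =>
      cases hy with
      | incl h => exact hff h f
      | θ j => exact hθf j f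
    | θ i =>
      cases hy with
      | incl h => rw [← neg_inj, ← hB.incl_right, ← hB'.incl_right, hθf]
      | θ j => exact hθθ j i
  have hhom {p : ZMod 2} {x : ExtAlg} (hx : x ∈ degPart p) : B x = B' x :=
    heq hx fun q y hy => by rw [hgen q y hy]
  refine LinearMap.ext fun x => ?_
  obtain ⟨y, hy, z, hz, rfl⟩ := exists_degPart_add x
  rw [map_add, map_add, hhom hy, hhom hz]

end IsGradedBracket

/-- The graded bracket of the bivector field `D ∧ D'`, for graded derivations `D`, `D'` of
degree `s`. -/
def derPair (s : ZMod 2) (D D' : ExtAlg →ₗ[ℂ] ExtAlg) : Bracket :=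
  (LinearMap.mul ℂ ExtAlg).compl₁₂ ((twist s).toLinearMap ∘ₗ D) D' -
    koszul s s • (LinearMap.mul ℂ ExtAlg).compl₁₂ ((twist s).toLinearMap ∘ₗ D') D

theorem derPair_apply (s : ZMod 2) (D D' : ExtAlg →ₗ[ℂ] ExtAlg) (x y : ExtAlg) :
    derPair s D D' x y = twist s (D x) * D' y - koszul s s • (twist s (D' x) * D y) :=
  rfl

theorem IsGradedDer.derPair_apply_of_mem {s p : ZMod 2} {D D' : ExtAlg →ₗ[ℂ] ExtAlg}
    (hD : IsGradedDer s D) (hD' : IsGradedDer s D') {x : ExtAlg} (hx : x ∈ degPart p) :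
    derPair s D D' x = (koszul s s * koszul s p) • (LinearMap.mulLeft ℂ (D x) ∘ₗ D') -
      koszul s p • (LinearMap.mulLeft ℂ (D' x) ∘ₗ D) := by
  refine LinearMap.ext fun y => ?_
  simp only [derPair_apply, twist_of_mem (hD.degree hx), twist_of_mem (hD'.degree hx),
    koszul_add_right, smul_mul_assoc, smul_smul, LinearMap.sub_apply, LinearMap.smul_apply,
    LinearMap.comp_apply, LinearMap.mulLeft_apply]
  rw [← mul_assoc, koszul_mul_self, one_mul]

theorem IsGradedDer.isGradedBracket_derPair {s : ZMod 2} {D D' : ExtAlg →ₗ[ℂ] ExtAlg}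
    (hD : IsGradedDer s D) (hD' : IsGradedDer s D') : IsGradedBracket (derPair s D D') := by
  refine .of_isGradedDer (fun p x hx => ?_) fun p q x y hx hy => ?_
  · have hdeg : s + p + s = p := by rw [add_right_comm, CharTwo.add_self_eq_zero, zero_add]
    have hleft := hD'.mulLeft_comp (hD.degree hx)
    have hright := hD.mulLeft_comp (hD'.degree hx)
    rw [hdeg] at hleft hright
    rw [hD.derPair_apply_of_mem hD' hx]
    exact (hleft.smul _).sub (hright.smul _)
  · rw [hD.derPair_apply_of_mem hD' hx, hD.derPair_apply_of_mem hD' hy]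
    simp only [LinearMap.sub_apply, LinearMap.smul_apply, LinearMap.comp_apply,
      LinearMap.mulLeft_apply, mul_comm_of_mem (hD.degree hx) (hD'.degree hy),
      mul_comm_of_mem (hD'.degree hx) (hD.degree hy)]
    obtain rfl | rfl := zmod_two_cases s <;> obtain rfl | rfl := zmod_two_cases p <;>
      obtain rfl | rfl := zmod_two_cases q <;>
      simp [CharTwo.add_self_eq_zero] <;> abel

/-! ### The Jacobi identity -/

/-- The defect of the graded derivation `{x, ·}` from being a derivation of the bracket, for `x`
of degree `p` and `y` of degree `q`. -/
def jacobiator (B : Bracket) (p q : ZMod 2) (x y : ExtAlg) : ExtAlg →ₗ[ℂ] ExtAlg :=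
  B x ∘ₗ B y - koszul p q • (B y ∘ₗ B x) - B (B x y)

theorem jacobiator_apply (B : Bracket) (p q : ZMod 2) (x y z : ExtAlg) :
    jacobiator B p q x y z = B x (B y z) - koszul p q • B y (B x z) - B (B x y) z :=
  rfl

namespace IsGradedBracket

variable {B : Bracket} {p q r : ZMod 2} {x y z : ExtAlg}

theorem isGradedDer_jacobiator (hB : IsGradedBracket B) (hx : x ∈ degPart p)
    (hy : y ∈ degPart q) : IsGradedDer (p + q) (jacobiator B p q x y) :=
  ((hB.isGradedDer hx).commutator (hB.isGradedDer hy)).sub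
    (hB.isGradedDer (hB.degree _ _ _ _ hx hy))

theorem jacobi_eq_jacobiator (hB : IsGradedBracket B) (hx : x ∈ degPart p) (hy : y ∈ degPart q)
    (hz : z ∈ degPart r) :
    koszul p r • B (B x y) z + koszul q r • B (B z x) y + koszul p q • B (B y z) x =
      -(koszul p r • jacobiator B p q x y z) := by
  rw [hB.symm _ _ _ _ (hB.degree _ _ _ _ hz hx) hy, hB.symm _ _ _ _ hz hx,
    hB.symm _ _ _ _ (hB.degree _ _ _ _ hy hz) hx, jacobiator_apply]
  obtain rfl | rfl := zmod_two_cases p <;> obtain rfl | rfl := zmod_two_cases q <;>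
    obtain rfl | rfl := zmod_two_cases r <;> simp [CharTwo.add_self_eq_zero] <;> abel

theorem jacobiator_rotate (hB : IsGradedBracket B) (hx : x ∈ degPart p) (hy : y ∈ degPart q)
    (hz : z ∈ degPart r) (h : jacobiator B p q x y z = 0) : jacobiator B q r y z x = 0 := by
  have hcyclic := hB.jacobi_eq_jacobiator hx hy hz
  have hne : koszul q p ≠ 0 := left_ne_zero_of_mul_eq_one (koszul_mul_self q p)
  rw [h, smul_zero, neg_zero, koszul_comm p r, koszul_comm p q] at hcyclic
  rw [← smul_eq_zero_iff_right hne, ← neg_eq_zero, ← hB.jacobi_eq_jacobiator hy hz hx, ← hcyclic]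
  abel

theorem jacobiator_generators_eq_zero (hB : IsGradedBracket B)
    (hfff : ∀ f g h, jacobiator B 0 0 (incl f) (incl g) (incl h) = 0)
    (hθff : ∀ i f g, jacobiator B 1 0 (θ i) (incl f) (incl g) = 0)
    (hθθf : ∀ i j f, jacobiator B 1 1 (θ i) (θ j) (incl f) = 0)
    (hθθθ : ∀ i j k, jacobiator B 1 1 (θ i) (θ j) (θ k) = 0)
    (hx : IsGenerator p x) (hy : IsGenerator q y) (hz : IsGenerator r z) :
    jacobiator B p q x y z = 0 := by
  have hrotate {p q r : ZMod 2} {x y z : ExtAlg} (hx : IsGenerator p x) (hy : IsGenerator q y)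
      (hz : IsGenerator r z) :=
    hB.jacobiator_rotate hx.mem_degPart hy.mem_degPart hz.mem_degPart
  cases hx with
  | incl f =>
    cases hy with
    | incl g =>
      cases hz with
      | incl h => exact hfff f g h
      | θ k => exact hrotate (.θ k) (.incl f) (.incl g) (hθff k f g)
    | θ j =>
      cases hz with
      | incl h =>
        exact hrotate (.incl h) (.incl f) (.θ j)
          (hrotate (.θ j) (.incl h) (.incl f) (hθff j h f))
      | θ k =>
        exact hrotate (.θ k) (.incl f) (.θ j) (hrotate (.θ j) (.θ k) (.incl f) (hθθf j k f))
  | θ i =>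
    cases hy with
    | incl g =>
      cases hz with
      | incl h => exact hθff i g h
      | θ k => exact hrotate (.θ k) (.θ i) (.incl g) (hθθf k i g)
    | θ j =>
      cases hz with
      | incl h => exact hθθf i j h
      | θ k => exact hθθθ i j k

theorem isGradedPoisson_of_generators (hB : IsGradedBracket B)
    (hfff : ∀ f g h, jacobiator B 0 0 (incl f) (incl g) (incl h) = 0)
    (hθff : ∀ i f g, jacobiator B 1 0 (θ i) (incl f) (incl g) = 0)
    (hθθf : ∀ i j f, jacobiator B 1 1 (θ i) (θ j) (incl f) = 0)
    (hθθθ : ∀ i j k, jacobiator B 1 1 (θ i) (θ j) (θ k) = 0) : IsGradedPoisson B := by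
  have heq_zero {p q : ZMod 2} {x y : ExtAlg} (hx : x ∈ degPart p) (hy : y ∈ degPart q)
      (hgen : ∀ r z, IsGenerator r z → jacobiator B r p z x y = 0) :
      jacobiator B p q x y = 0 :=
    (hB.isGradedDer_jacobiator hx hy).ext .zero fun r z hz =>
      hB.jacobiator_rotate hz.mem_degPart hx hy (hgen r z hz)
  have hgg {p q : ZMod 2} {x y : ExtAlg} (hx : IsGenerator p x) (hy : IsGenerator q y) :
      jacobiator B p q x y = 0 :=
    heq_zero hx.mem_degPart hy.mem_degPart fun _ _ hz =>
      hB.jacobiator_generators_eq_zero hfff hθff hθθf hθθθ hz hx hy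
  have hg {p q : ZMod 2} {x y : ExtAlg} (hx : IsGenerator p x) (hy : y ∈ degPart q) :
      jacobiator B p q x y = 0 :=
    heq_zero hx.mem_degPart hy fun _ _ hz => by rw [hgg hz hx, LinearMap.zero_apply]
  refine ⟨hB, fun p q r x y z hx hy hz => ?_⟩
  rw [hB.jacobi_eq_jacobiator hx hy hz,
    heq_zero hx hy fun _ _ hz => by rw [hg hz hx, LinearMap.zero_apply], LinearMap.zero_apply,
    smul_zero, neg_zero]

end IsGradedBracket

theorem IsGradedPoisson.jacobiator_eq_zero {B : Bracket} (hB : IsGradedPoisson B) {p q r : ZMod 2}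
    {x y z : ExtAlg} (hx : x ∈ degPart p) (hy : y ∈ degPart q) (hz : z ∈ degPart r) :
    jacobiator B p q x y z = 0 := by
  have h := hB.jacobi p q r x y z hx hy hz
  rwa [hB.jacobi_eq_jacobiator hx hy hz, neg_eq_zero,
    smul_eq_zero_iff_right (left_ne_zero_of_mul_eq_one (koszul_mul_self p r))] at h

theorem IsGradedBracket.mixedJacobi_iff {B : Bracket} (hB : IsGradedBracket B) :
    MixedJacobi B ↔ ∀ i f h, jacobiator B 1 0 (θ i) (incl f) (incl h) = 0 := by
  refine forall_congr' fun i => forall₂_congr fun f h => ?_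
  have hcyclic := hB.jacobi_eq_jacobiator (θ_mem_degPart i) (incl_mem_degPart f)
    (incl_mem_degPart h)
  simp only [koszul_zero_right, one_smul] at hcyclic
  rw [hcyclic, neg_eq_zero]

/-! ### Brackets with functions -/

theorem forall_T_iff {p : FunAlg → Prop} : (∀ i j, p (T i j)) ↔ p a ∧ p b ∧ p c ∧ p d := by
  simp only [Fin.forall_fin_two, and_assoc]
  rfl

/-- The restriction of a graded derivation of `ℳ` to a derivation `𝒜 → ℳ`. -/
def IsGradedDer.onFun {p : ZMod 2} {D : ExtAlg →ₗ[ℂ] ExtAlg} (hD : IsGradedDer p D) :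
    Derivation ℂ FunAlg ExtAlg :=
  Derivation.mk' (D ∘ₗ incl.toLinearMap) fun f g => by
    simp only [LinearMap.comp_apply, AlgHom.toLinearMap_apply, map_mul]
    rw [incl_mul, hD.apply_smul, mul_incl, add_comm]

theorem IsGradedDer.onFun_apply {p : ZMod 2} {D : ExtAlg →ₗ[ℂ] ExtAlg} (hD : IsGradedDer p D)
    (f : FunAlg) : hD.onFun f = D (incl f) :=
  rfl

/-- The derivation `∑ₖ Xₖ(·) eₖ : 𝒜 → ℳ` with coefficients the vector fields `X`. -/
def fieldForm {ι : Type*} [Fintype ι] (X : ι → Derivation ℂ FunAlg FunAlg) (e : ι → ExtAlg) :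
    Derivation ℂ FunAlg ExtAlg :=
  ∑ k, (LinearMap.toSpanSingleton FunAlg ExtAlg (e k)).compDer (X k)

theorem fieldForm_apply {ι : Type*} [Fintype ι] (X : ι → Derivation ℂ FunAlg FunAlg)
    (e : ι → ExtAlg) (f : FunAlg) : fieldForm X e f = ∑ k, X k f • e k := by
  rw [fieldForm, derivation_sum_apply]
  rfl

theorem prolongsSklyanin_iff {B : Bracket} (hB : IsGradedBracket B) :
    ProlongsSklyanin B ↔ ∀ f h, B (incl f) (incl h) = incl (sklyanin f h) := by
  refine ⟨fun hS => ?_, fun h => ?_⟩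
  · have hswap {f h : FunAlg} (hfh : B (incl f) (incl h) = incl (sklyanin f h)) :
        B (incl h) (incl f) = incl (sklyanin h f) := by
      rw [hB.incl_right, hfh, sklyanin_swap h f, map_neg]
    have hself (f : FunAlg) : B (incl f) (incl f) = incl (sklyanin f f) := by
      have htwo : (2 : ℂ) • B (incl f) (incl f) = 0 := by
        rw [two_smul, ← eq_neg_iff_add_eq_zero]
        exact hB.incl_right _ f
      rw [sklyanin_self, map_zero]
      exact (smul_eq_zero_iff_right two_ne_zero).mp htwo
    have hext (f : FunAlg) (hf : ∀ i j, B (incl f) (incl (T i j)) = incl (sklyanin f (T i j)))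
        (h : FunAlg) : B (incl f) (incl h) = incl (sklyanin f h) := by
      have heq : (hB.isGradedDer (incl_mem_degPart f)).onFun =
          (LinearMap.toSpanSingleton FunAlg ExtAlg 1).compDer (sklyanin f) :=
        derivation_ext fun i j => (hf i j).trans (incl_eq_smul _)
      exact (DFunLike.congr_fun heq h).trans (incl_eq_smul _).symm
    have hab : B (incl a) (incl b) = incl (sklyanin a b) := by rw [hS.ab, sklyanin_a_b]
    have hac : B (incl a) (incl c) = incl (sklyanin a c) := by rw [hS.ac, sklyanin_a_c]
    have had : B (incl a) (incl d) = incl (sklyanin a d) := by rw [hS.ad, sklyanin_a_d]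
    have hcb : B (incl c) (incl b) = incl (sklyanin c b) := by rw [hS.cb, sklyanin_c_b, map_zero]
    have hbd : B (incl b) (incl d) = incl (sklyanin b d) := by rw [hS.bd, sklyanin_b_d]
    have hcd : B (incl c) (incl d) = incl (sklyanin c d) := by rw [hS.cd, sklyanin_c_d]
    have hTT : ∀ i j k l, B (incl (T i j)) (incl (T k l)) = incl (sklyanin (T i j) (T k l)) := by
      simp only [Fin.forall_fin_two]
      exact ⟨⟨⟨⟨hself a, hab⟩, hac, had⟩, ⟨hswap hab, hself b⟩, hswap hcb, hbd⟩,
        ⟨⟨hswap hac, hcb⟩, hself c, hcd⟩, ⟨hswap had, hswap hbd⟩, hswap hcd, hself d⟩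
    exact fun f h => hext f (fun i j => hswap (hext _ (hTT i j) f)) h
  · exact ⟨by rw [h, sklyanin_a_b], by rw [h, sklyanin_b_d], by rw [h, sklyanin_c_b, map_zero],
      by rw [h, sklyanin_a_c], by rw [h, sklyanin_c_d], by rw [h, sklyanin_a_d]⟩

/-- The value at the unit of the vector field `{θⁱ, ·}ʲ` in the bracket with parameter `η`. -/
def mixedParam (η : ℂ) : Fin 3 → Fin 3 → Fin 3 → ℂ :=
  ![![0, ![0, η, 0], ![0, 0, -(2 + η)]],
    ![![0, 0, 4 + 2 * η], ![-(1 + η), 0, 0], 0],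
    ![![0, -2 * η, 0], 0, ![1 + η, 0, 0]]]

theorem mixedFamily_iff {B : Bracket} (hB : IsGradedBracket B) (η : ℂ) :
    MixedFamily η B ↔ ∀ i f, B (θ i) (incl f) = ∑ j, rightField (mixedParam η i j) f • θ j := by
  refine ⟨fun h i f => ?_, fun h => ?_⟩
  · have heq : (hB.isGradedDer (θ_mem_degPart i)).onFun =
        fieldForm (fun j => rightField (mixedParam η i j)) θ := by
      refine derivation_ext
        ((forall_T_iff (p := fun t => B (θ i) (incl t) = fieldForm _ _ t)).mpr ?_)
      simp only [fieldForm_apply]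
      revert i
      simp only [Fin.forall_fin_succ, Fin.succ_zero_eq_one, Fin.succ_one_eq_two, IsEmpty.forall_iff,
        and_true, h.θ0a, h.θ0b, h.θ0c, h.θ0d, h.θ1a, h.θ1b, h.θ1c, h.θ1d, h.θ2a, h.θ2b, h.θ2c,
        h.θ2d]
      refine ⟨⟨?_, ?_, ?_, ?_⟩, ⟨?_, ?_, ?_, ?_⟩, ?_, ?_, ?_, ?_⟩ <;>
        simp [mixedParam, Fin.sum_univ_three] <;> module
    exact (DFunLike.congr_fun heq f).trans (fieldForm_apply _ _ f)
  · constructor <;> rw [h] <;>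
      simp [mixedParam, Fin.sum_univ_three] <;> module

/-! ### Construction of the brackets -/

/-- The extension to `ℳ` of a derivation of `𝒜`, vanishing on the forms `θⁱ`. -/
def liftField (D : Derivation ℂ FunAlg FunAlg) : ExtAlg →ₗ[ℂ] ExtAlg :=
  D.toLinearMap.rTensor Forms

theorem liftField_tmul (D : Derivation ℂ FunAlg FunAlg) (f : FunAlg) (w : Forms) :
    liftField D (f ⊗ₜ w) = D f ⊗ₜ w :=
  rfl

@[simp]
theorem liftField_incl (D : Derivation ℂ FunAlg FunAlg) (f : FunAlg) :
    liftField D (incl f) = incl (D f) :=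
  rfl

@[simp]
theorem liftField_θ (D : Derivation ℂ FunAlg FunAlg) (i : Fin 3) : liftField D (θ i) = 0 := by
  rw [θ, liftField_tmul, Derivation.map_one_eq_zero, TensorProduct.zero_tmul]

theorem isGradedDer_liftField (D : Derivation ℂ FunAlg FunAlg) :
    IsGradedDer 0 (liftField D) where
  degree hx := by
    have hparity (y : ExtAlg) : parity (liftField D y) = liftField D (parity y) := by
      induction y using TensorProduct.induction_on with
      | zero => simp only [map_zero]
      | tmul f w => simp only [parity, liftField_tmul, Algebra.TensorProduct.map_tmul,
          AlgHom.id_apply]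
      | add y z hy hz => simp only [map_add, hy, hz]
    rw [mem_degPart] at hx
    rw [zero_add, mem_degPart, hparity, hx, map_smul]
  leibniz {q x} hx y := by
    rw [koszul_zero_left, one_smul]
    clear hx
    induction x using TensorProduct.induction_on with
    | zero => simp only [zero_mul, map_zero, add_zero]
    | add x z hx hz => rw [add_mul, map_add, hx, hz, map_add]; noncomm_ring
    | tmul f w =>
      induction y using TensorProduct.induction_on with
      | zero => simp only [mul_zero, map_zero, add_zero]
      | add y z hy hz => rw [mul_add, map_add, hy, hz, map_add]; noncomm_ring
      | tmul g v =>
        simp only [Algebra.TensorProduct.tmul_mul_tmul, liftField_tmul, Derivation.leibniz,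
          smul_eq_mul, TensorProduct.add_tmul]
        rw [add_comm, mul_comm g]

theorem isGradedDer_contract (i : Fin 3) : IsGradedDer 1 ((contract i).restrictScalars ℂ) where
  degree hx := contract_mem_degPart i hx
  leibniz hx y := by
    rw [LinearMap.restrictScalars_apply, contract_mul, twist_of_mem hx, smul_mul_assoc]
    rfl

theorem quadFrame_mem_degPart (k : Fin 3) : quadFrame k ∈ degPart 0 := by
  have h := mul_mem_degPart (θ_mem_degPart (k + 1)) (θ_mem_degPart (k + 2))
  rwa [CharTwo.add_self_eq_zero] at h

section Extension

/-- The graded derivation with `f ↦ ∑ⱼ pⱼ(f) θʲ` and `θʲ ↦ ½ ∑ₖ qⱼₖ quadFrame k`, where `pⱼ(f)` is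
the right-invariant vector field `pⱼ` applied to `f`. -/
def extensionDer (p q : Fin 3 → Fin 3 → ℂ) : ExtAlg →ₗ[ℂ] ExtAlg :=
  ∑ j, (LinearMap.mulLeft ℂ (θ j) ∘ₗ liftField (rightField (p j)) +
    LinearMap.mulLeft ℂ (∑ k, (2⁻¹ * q j k) • quadFrame k) ∘ₗ (contract j).restrictScalars ℂ)

theorem isGradedDer_extensionDer (p q : Fin 3 → Fin 3 → ℂ) :
    IsGradedDer 1 (extensionDer p q) := by
  refine Finset.sum_induction _ _ (fun _ _ => .add) .zero fun j _ => .add ?_ ?_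
  · exact (isGradedDer_liftField _).mulLeft_comp (θ_mem_degPart j)
  · exact (isGradedDer_contract j).mulLeft_comp
      (sum_mem fun k _ => Submodule.smul_mem _ _ (quadFrame_mem_degPart k))

theorem extensionDer_incl (p q : Fin 3 → Fin 3 → ℂ) (f : FunAlg) :
    extensionDer p q (incl f) = ∑ j, rightField (p j) f • θ j := by
  simp [extensionDer, LinearMap.sum_apply, mul_incl]

theorem extensionDer_θ (p q : Fin 3 → Fin 3 → ℂ) (j : Fin 3) :
    extensionDer p q (θ j) = ∑ k, (2⁻¹ * q j k) • quadFrame k := by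
  simp [extensionDer, LinearMap.sum_apply, contract_θ]

variable (p q : Fin 3 → Fin 3 → Fin 3 → ℂ)

/-- The graded bracket that extends the Sklyanin bracket with `{θⁱ, f} = ∑ⱼ pᵢⱼ(f) θʲ`, where
`pᵢⱼ(f)` is the right-invariant vector field `pᵢⱼ` applied to `f`, and
`{θⁱ, θʲ} = ½ ∑ₖ (qᵢⱼₖ + qⱼᵢₖ) quadFrame k`. -/
def sklyaninExtension : Bracket :=
  derPair 0 (liftField (leftField ![0, 1, 0])) (liftField (leftField ![0, 0, 1])) -
    derPair 0 (liftField (rightField ![0, 1, 0])) (liftField (rightField ![0, 0, 1])) +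
    ∑ i, derPair 1 ((contract i).restrictScalars ℂ) (extensionDer (p i) (q i))

theorem isGradedBracket_sklyaninExtension : IsGradedBracket (sklyaninExtension p q) :=
  .add (.sub ((isGradedDer_liftField _).isGradedBracket_derPair (isGradedDer_liftField _))
      ((isGradedDer_liftField _).isGradedBracket_derPair (isGradedDer_liftField _)))
    (Finset.sum_induction _ _ (fun _ _ => .add) .zero fun _ _ =>
      (isGradedDer_contract _).isGradedBracket_derPair (isGradedDer_extensionDer _ _))

theorem twist_zero_apply (x : ExtAlg) : twist 0 x = x := by
  rw [twist, if_neg zero_ne_one, AlgHom.id_apply]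

theorem sklyaninExtension_incl_incl (f h : FunAlg) :
    sklyaninExtension p q (incl f) (incl h) = incl (sklyanin f h) := by
  simp [sklyaninExtension, LinearMap.sum_apply, derPair_apply, twist_zero_apply, sklyanin,
    wedge_apply]

theorem sklyaninExtension_θ_incl (i : Fin 3) (f : FunAlg) :
    sklyaninExtension p q (θ i) (incl f) = ∑ j, rightField (p i j) f • θ j := by
  simp [sklyaninExtension, LinearMap.sum_apply, derPair_apply, extensionDer_incl, contract_θ,
    apply_ite (twist 1), ite_mul]

theorem sklyaninExtension_θ_θ (i j : Fin 3) :
    sklyaninExtension p q (θ i) (θ j) = ∑ k, (2⁻¹ * (q i j k + q j i k)) • quadFrame k := by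
  have htwist (k : Fin 3) : twist 1 (quadFrame k) = quadFrame k := by
    rw [twist_of_mem (quadFrame_mem_degPart k), koszul_zero_right, one_smul]
  simp [sklyaninExtension, LinearMap.sum_apply, derPair_apply, extensionDer_θ, contract_θ,
    apply_ite (twist 1), ite_mul, htwist, Finset.sum_add_distrib, mul_add, add_smul]

end Extension

/-- The coefficients of the brackets `{θⁱ, θʲ}` on the basis `quadFrame`. -/
def formsParam : Fin 3 → Fin 3 → Fin 3 → ℂ :=
  ![![![-2, 0, 0], ![0, 0, -2], ![0, -2, 0]],
    ![![0, 0, -2], 0, 0],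
    ![![0, -2, 0], 0, 0]]

theorem formsParam_symm (i j : Fin 3) : formsParam i j = formsParam j i := by
  fin_cases i <;> fin_cases j <;> rfl

theorem IsGradedBracket.θ_symm {B : Bracket} (hB : IsGradedBracket B) (i j : Fin 3) :
    B (θ i) (θ j) = B (θ j) (θ i) := by
  rw [hB.symm _ _ _ _ (θ_mem_degPart i) (θ_mem_degPart j), koszul_one_one, neg_one_smul, neg_neg]

theorem formsTable_iff {B : Bracket} (hB : IsGradedBracket B) :
    FormsTable B ↔ ∀ i j, B (θ i) (θ j) = ∑ k, formsParam i j k • quadFrame k := by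
  have htwo (x : ExtAlg) : 2 * x = (2 : ℂ) • x := by
    rw [two_mul, two_smul]
  refine ⟨fun h i j => ?_, fun h => ?_⟩
  · fin_cases i <;> fin_cases j <;>
      simp [formsParam, Fin.sum_univ_three, hB.θ_symm 1 0, hB.θ_symm 2 0, hB.θ_symm 2 1,
        h.θ00, h.θ01, h.θ02, h.θ11, h.θ12, h.θ22, htwo, θ_mul_swap 0 2, θ_mul_θ_eq_quadFrame]
  · constructor <;> rw [h] <;>
      simp [formsParam, Fin.sum_univ_three, htwo, θ_mul_swap 0 2, θ_mul_θ_eq_quadFrame]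

/-- The bracket of the one-parameter family, extended by the table of the `{θⁱ, θʲ}`. -/
def familyBracket (η : ℂ) : Bracket := sklyaninExtension (mixedParam η) formsParam

theorem isGradedBracket_familyBracket (η : ℂ) : IsGradedBracket (familyBracket η) :=
  isGradedBracket_sklyaninExtension _ _

theorem familyBracket_incl_incl (η : ℂ) (f h : FunAlg) :
    familyBracket η (incl f) (incl h) = incl (sklyanin f h) :=
  sklyaninExtension_incl_incl _ _ f h

theorem familyBracket_θ_incl (η : ℂ) (i : Fin 3) (f : FunAlg) :
    familyBracket η (θ i) (incl f) = ∑ j, rightField (mixedParam η i j) f • θ j :=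
  sklyaninExtension_θ_incl _ _ i f

theorem familyBracket_θ_θ (η : ℂ) (i j : Fin 3) :
    familyBracket η (θ i) (θ j) = ∑ k, formsParam i j k • quadFrame k := by
  simp only [familyBracket, sklyaninExtension_θ_θ, formsParam_symm j i, ← two_mul,
    inv_mul_cancel_left₀ (two_ne_zero (α := ℂ))]

theorem prolongsSklyanin_familyBracket (η : ℂ) : ProlongsSklyanin (familyBracket η) :=
  (prolongsSklyanin_iff (isGradedBracket_familyBracket η)).mpr (familyBracket_incl_incl η)

theorem mixedFamily_familyBracket (η : ℂ) : MixedFamily η (familyBracket η) :=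
  (mixedFamily_iff (isGradedBracket_familyBracket η) η).mpr (familyBracket_θ_incl η)

theorem formsTable_familyBracket (η : ℂ) : FormsTable (familyBracket η) :=
  (formsTable_iff (isGradedBracket_familyBracket η)).mpr (familyBracket_θ_θ η)

theorem eq_familyBracket {B : Bracket} {η : ℂ} (hB : IsGradedBracket B) (hS : ProlongsSklyanin B)
    (hM : MixedFamily η B) (hF : FormsTable B) : B = familyBracket η :=
  hB.ext_of_generators (isGradedBracket_familyBracket η)
    (fun f h => by rw [(prolongsSklyanin_iff hB).mp hS, familyBracket_incl_incl])
    (fun i f => by rw [(mixedFamily_iff hB η).mp hM, familyBracket_θ_incl])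
    fun i j => by rw [(formsTable_iff hB).mp hF, familyBracket_θ_θ]

/-! ### The Jacobi identity on the generators -/

section FieldFrame

variable {B : Bracket} {ι : Type*} [Fintype ι] {e : ι → ExtAlg} {P : ι → ι → Fin 3 → ℂ}

open scoped Matrix in
/-- The failure of the Jacobi identity of `e k` with two functions when
`{e k, f} = ∑ₗ P k l (f) e l`: the value at the unit of the right-invariant bivector field which is
the coefficient of `e l`. -/
def curvature (P : ι → ι → Fin 3 → ℂ) (k l : ι) : Fin 3 → ℂ :=
  ![0, P k l 2, -P k l 1] - ∑ j, P k j ⨯₃ P j l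

theorem bracket_incl_sum_smul (hB : IsGradedBracket B)
    (hff : ∀ f h, B (incl f) (incl h) = incl (sklyanin f h))
    (hP : ∀ k f, B (e k) (incl f) = ∑ l, rightField (P k l) f • e l) (f : FunAlg) (g : ι → FunAlg) :
    B (incl f) (∑ k, g k • e k) =
      ∑ l, (sklyanin f (g l) - ∑ k, g k * rightField (P k l) f) • e l := by
  have hfe (k : ι) : B (incl f) (e k) = -∑ l, rightField (P k l) f • e l := by
    rw [← hP, hB.incl_right, neg_neg]
  simp only [map_sum, (hB.isGradedDer (incl_mem_degPart f)).apply_smul, hff, incl_mul, hfe,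
    smul_neg, Finset.smul_sum, smul_smul, Finset.sum_add_distrib, Finset.sum_neg_distrib]
  rw [Finset.sum_comm, ← sub_eq_add_neg, ← Finset.sum_sub_distrib]
  exact Finset.sum_congr rfl fun l _ => by rw [sub_smul, Finset.sum_smul]

theorem jacobiator_frame (hB : IsGradedBracket B)
    (hff : ∀ f h, B (incl f) (incl h) = incl (sklyanin f h))
    (hP : ∀ k f, B (e k) (incl f) = ∑ l, rightField (P k l) f • e l) (p : ZMod 2) (k : ι)
    (f h : FunAlg) :
    jacobiator B p 0 (e k) (incl f) (incl h) = ∑ l, rightWedge (curvature P k l) f h • e l := by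
  have hcurv (l : ι) : rightWedge (curvature P k l) f h =
      rightWedge ![0, P k l 2, -P k l 1] f h -
        ∑ j, (rightField (P k j) f * rightField (P j l) h -
          rightField (P j l) f * rightField (P k j) h) := by
    simp only [curvature, map_sub, map_sum, ← wedge_rightField, LinearMap.sub_apply,
      Derivation.sub_apply, LinearMap.sum_apply, derivation_sum_apply, ← wedge_apply]
  rw [jacobiator_apply, koszul_zero_right, one_smul, hB.incl_right (B (e k) (incl f)), hff,
    hP k (sklyanin f h), hP k f, hP k h, bracket_incl_sum_smul hB hff hP,
    bracket_incl_sum_smul hB hff hP, sub_neg_eq_add, ← Finset.sum_sub_distrib,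
    ← Finset.sum_add_distrib]
  refine Finset.sum_congr rfl fun l _ => ?_
  rw [← sub_smul, ← add_smul, rightField_sklyanin, hcurv, Finset.sum_sub_distrib,
    sklyanin_swap h, Finset.sum_congr rfl fun j _ => mul_comm (rightField (P j l) f) _]
  congr 1
  ring

theorem forall_jacobiator_frame_eq_zero_iff [DecidableEq ι] {φ : ι → ExtAlg →ₗ[FunAlg] FunAlg}
    (hφ : ∀ k l, φ k (e l) = if k = l then 1 else 0) (hB : IsGradedBracket B)
    (hff : ∀ f h, B (incl f) (incl h) = incl (sklyanin f h))
    (hP : ∀ k f, B (e k) (incl f) = ∑ l, rightField (P k l) f • e l) (p : ZMod 2) (k : ι) :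
    (∀ f h, jacobiator B p 0 (e k) (incl f) (incl h) = 0) ↔ ∀ l, curvature P k l = 0 := by
  simp only [jacobiator_frame hB hff hP, ← rightWedge_eq_zero_iff]
  refine ⟨fun h l f g => ?_, fun h f g => Finset.sum_eq_zero fun l _ => by rw [h, zero_smul]⟩
  simpa only [map_sum, map_smul, hφ, smul_eq_mul, mul_ite, mul_one, mul_zero, Finset.sum_ite_eq,
    Finset.mem_univ, if_true, map_zero] using congrArg (φ l) (h f g)

end FieldFrame

theorem curvature_mixedParam (η : ℂ) : curvature (mixedParam η) =
    (η * (η + 2)) • ![![0, ![0, 0, -1], ![0, 1, 0]], ![![0, -2, 0], ![2, 0, 0], 0],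
      ![![0, 0, 2], 0, ![-2, 0, 0]]] := by
  ext k l m
  fin_cases k <;> fin_cases l <;> fin_cases m <;>
    simp [curvature, mixedParam, Fin.sum_univ_three, cross_apply] <;> ring

theorem curvature_mixedParam_eq_zero_iff {η : ℂ} :
    (∀ k l, curvature (mixedParam η) k l = 0) ↔ η = 0 ∨ η = -2 := by
  rw [eq_neg_iff_add_eq_zero, ← mul_eq_zero, curvature_mixedParam]
  refine ⟨fun h => ?_, fun h k l => by rw [h, zero_smul]; rfl⟩
  simpa using congrFun (h 0 1) 2

theorem mixedJacobi_iff_of_mixedFamily {B : Bracket} {η : ℂ} (hB : IsGradedBracket B)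
    (hS : ProlongsSklyanin B) (hM : MixedFamily η B) : MixedJacobi B ↔ η = 0 ∨ η = -2 := by
  have hθ (k l : Fin 3) : oddCoeff (some k) (θ l) = if k = l then 1 else 0 := by
    simpa [oddFrame] using oddCoeff_oddFrame (some k) (some l)
  simp only [hB.mixedJacobi_iff, ← curvature_mixedParam_eq_zero_iff,
    forall_jacobiator_frame_eq_zero_iff hθ hB ((prolongsSklyanin_iff hB).mp hS)
      ((mixedFamily_iff hB η).mp hM)]

theorem sum_smul_θ_mul_θ (g : Fin 3 → Fin 3 → FunAlg) :
    ∑ m, ∑ n, g m n • (θ m * θ n) = ∑ k, (g (k + 1) (k + 2) - g (k + 2) (k + 1)) • quadFrame k := by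
  simp [Fin.sum_univ_three, θ_mul_self, θ_mul_swap 1 0, θ_mul_swap 2 1, θ_mul_swap 0 2,
    θ_mul_θ_eq_quadFrame]
  module

section ThetaFrame

variable {B : Bracket} {p q : Fin 3 → Fin 3 → Fin 3 → ℂ}

/-- The values at the unit of the vector fields `{quadFrame k, ·}` when
`{θⁱ, f} = ∑ⱼ pᵢⱼ(f) θʲ`. -/
def quadParam (p : Fin 3 → Fin 3 → Fin 3 → ℂ) (k l : Fin 3) : Fin 3 → ℂ :=
  (if k = l then ∑ j, p j j else 0) - p l k

theorem bracket_quadFrame_incl (hB : IsGradedBracket B)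
    (hp : ∀ i f, B (θ i) (incl f) = ∑ j, rightField (p i j) f • θ j) (k : Fin 3) (f : FunAlg) :
    B (quadFrame k) (incl f) = ∑ l, rightField (quadParam p k l) f • quadFrame l := by
  have hleibniz (i j : Fin 3) :
      B (θ i * θ j) (incl f) = B (θ i) (incl f) * θ j + θ i * B (θ j) (incl f) := by
    rw [hB.leibniz _ _ _ _ _ _ (θ_mem_degPart i) (θ_mem_degPart j) (incl_mem_degPart f),
      koszul_zero_right, one_smul, add_comm]
  rw [quadFrame, hleibniz, hp, hp]
  fin_cases k <;>
    simp [quadParam, Fin.sum_univ_three, add_mul, mul_add, θ_mul_self, θ_mul_swap 1 0,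
      θ_mul_swap 2 1, θ_mul_swap 0 2, θ_mul_θ_eq_quadFrame] <;> module

theorem bracket_θ_sum_smul (hB : IsGradedBracket B)
    (hp : ∀ i f, B (θ i) (incl f) = ∑ j, rightField (p i j) f • θ j)
    (hq : ∀ i j, B (θ i) (θ j) = ∑ k, q i j k • quadFrame k) (i : Fin 3) (g : Fin 3 → FunAlg) :
    B (θ i) (∑ j, g j • θ j) =
      (∑ m, ∑ n, rightField (p i m) (g n) • (θ m * θ n)) +
        ∑ k, (∑ j, q i j k • g j) • quadFrame k := by
  simp only [map_sum, (hB.isGradedDer (θ_mem_degPart i)).apply_smul, hp, hq, Finset.sum_add_distrib,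
    Finset.sum_mul, smul_mul_assoc, Finset.smul_sum, Finset.sum_smul]
  rw [Finset.sum_comm, add_right_inj, Finset.sum_comm]
  exact Finset.sum_congr rfl fun k _ => Finset.sum_congr rfl fun j _ => by
    rw [smul_comm, smul_assoc]

/-- The value at the unit of the vector field which is the coefficient of `quadFrame k` in the
Jacobi identity of `θⁱ`, `θʲ` and a function, when `{θⁱ, f} = ∑ⱼ pᵢⱼ(f) θʲ` and
`{θⁱ, θʲ} = ∑ₖ qᵢⱼₖ quadFrame k`. -/
def mixedDefect (p q : Fin 3 → Fin 3 → Fin 3 → ℂ) (i j k : Fin 3) : Fin 3 → ℂ :=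
  sl2Lie (p j (k + 2)) (p i (k + 1)) - sl2Lie (p j (k + 1)) (p i (k + 2)) +
    ∑ l, (q i l k • p j l + q j l k • p i l - q i j l • quadParam p l k)

theorem jacobiator_θ_θ_incl (hB : IsGradedBracket B)
    (hp : ∀ i f, B (θ i) (incl f) = ∑ j, rightField (p i j) f • θ j)
    (hq : ∀ i j, B (θ i) (θ j) = ∑ k, q i j k • quadFrame k) (i j : Fin 3) (f : FunAlg) :
    jacobiator B 1 1 (θ i) (θ j) (incl f) =
      ∑ k, rightField (mixedDefect p q i j k) f • quadFrame k := by
  have hlie (X Y : Fin 3 → ℂ) : rightField (sl2Lie Y X) f =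
      rightField X (rightField Y f) - rightField Y (rightField X f) := by
    rw [← rightField_lie, Derivation.commutator_apply]
  rw [jacobiator_apply, hp i, hp j, hq, koszul_one_one, neg_one_smul, sub_neg_eq_add,
    bracket_θ_sum_smul hB hp hq, bracket_θ_sum_smul hB hp hq, sum_smul_θ_mul_θ, sum_smul_θ_mul_θ,
    map_sum, LinearMap.sum_apply]
  simp only [map_smul, LinearMap.smul_apply, bracket_quadFrame_incl hB hp, Finset.smul_sum]
  rw [Finset.sum_comm, ← Finset.sum_add_distrib, ← Finset.sum_add_distrib,
    ← Finset.sum_add_distrib, ← Finset.sum_sub_distrib]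
  refine Finset.sum_congr rfl fun k _ => ?_
  simp only [mixedDefect, map_add, map_sub, map_sum, map_smul, Derivation.add_apply,
    Derivation.sub_apply, derivation_sum_apply, Derivation.smul_apply, hlie, ← smul_assoc,
    ← Finset.sum_smul, ← add_smul, ← sub_smul, Finset.sum_add_distrib, Finset.sum_sub_distrib]
  refine congrArg (· • quadFrame k) ?_
  abel

/-- The coefficient of the volume form in `{θⁱ, quadFrame k}` when
`{θⁱ, θʲ} = ∑ₖ qᵢⱼₖ quadFrame k`. -/
def volumeParam (q : Fin 3 → Fin 3 → Fin 3 → ℂ) (i k : Fin 3) : ℂ :=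
  q i (k + 1) (k + 2) - q i (k + 2) (k + 1)

theorem bracket_θ_quadFrame (hB : IsGradedBracket B)
    (hq : ∀ i j, B (θ i) (θ j) = ∑ k, q i j k • quadFrame k) (i k : Fin 3) :
    B (θ i) (quadFrame k) = volumeParam q i k • oddFrame none := by
  have hcomm (m n : Fin 3) : quadFrame m * θ n = θ n * quadFrame m := by
    rw [mul_comm_of_mem (quadFrame_mem_degPart m) (θ_mem_degPart n), koszul_zero_left, one_smul]
  rw [quadFrame, (hB.isGradedDer (θ_mem_degPart i)).leibniz (θ_mem_degPart _), koszul_one_one, hq,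
    hq, Finset.sum_mul, Finset.mul_sum]
  simp only [smul_mul_assoc, mul_smul_comm, hcomm, θ_mul_quadFrame, smul_ite, smul_zero,
    Finset.sum_ite_eq, Finset.mem_univ, if_true]
  rw [volumeParam, sub_smul, neg_one_smul, ← sub_eq_add_neg, oddFrame]

theorem jacobiator_θ_θ_θ (hB : IsGradedBracket B)
    (hq : ∀ i j, B (θ i) (θ j) = ∑ k, q i j k • quadFrame k) (i j k : Fin 3) :
    jacobiator B 1 1 (θ i) (θ j) (θ k) =
      (∑ l, (q j k l * volumeParam q i l + q i k l * volumeParam q j l +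
        q i j l * volumeParam q k l)) • oddFrame none := by
  have hsymm (l : Fin 3) : B (quadFrame l) (θ k) = -(volumeParam q k l • oddFrame none) := by
    rw [hB.symm _ _ _ _ (quadFrame_mem_degPart l) (θ_mem_degPart k), koszul_zero_left, one_smul,
      bracket_θ_quadFrame hB hq]
  rw [jacobiator_apply, hq j k, hq i k, hq i j, koszul_one_one, neg_one_smul, sub_neg_eq_add]
  simp only [map_sum, map_smul, LinearMap.sum_apply, LinearMap.smul_apply,
    bracket_θ_quadFrame hB hq, hsymm, smul_neg, Finset.sum_neg_distrib, sub_neg_eq_add, smul_smul,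
    ← Finset.sum_smul, ← add_smul, Finset.sum_add_distrib]

end ThetaFrame

theorem sum_mixedParam_diag (η : ℂ) : ∑ j, mixedParam η j j = 0 := by
  simp [mixedParam, Fin.sum_univ_three]

theorem quadParam_mixedParam (η : ℂ) (k l : Fin 3) :
    quadParam (mixedParam η) k l = -mixedParam η l k := by
  rw [quadParam, sum_mixedParam_diag, ite_self, zero_sub]

theorem mixedDefect_mixedParam {η : ℂ} (hη : η = 0 ∨ η = -2) (i j k : Fin 3) :
    mixedDefect (mixedParam η) formsParam i j k = 0 := by
  have hII : mixedParam 0 =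
      ![![0, 0, ![0, 0, -2]], ![![0, 0, 4], ![-1, 0, 0], 0], ![0, 0, ![1, 0, 0]]] := by
    simp [mixedParam]
  have hI : mixedParam (-2) =
      ![![0, ![0, -2, 0], 0], ![0, ![1, 0, 0], 0], ![![0, 4, 0], 0, ![-1, 0, 0]]] := by
    norm_num [mixedParam, eq_iff_true_of_subsingleton]
  simp only [mixedDefect, quadParam_mixedParam, Fin.sum_univ_three]
  obtain rfl | rfl := hη <;> fin_cases i <;> fin_cases j <;> fin_cases k <;>
    simp [hI, hII, formsParam, sl2Lie] <;> norm_num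

theorem isGradedPoisson_familyBracket {η : ℂ} (hη : η = 0 ∨ η = -2) :
    IsGradedPoisson (familyBracket η) := by
  have hB := isGradedBracket_familyBracket η
  refine hB.isGradedPoisson_of_generators (fun f g h => ?_) ?_ (fun i j f => ?_) fun i j k => ?_
  · rw [jacobiator_apply, koszul_zero_left, one_smul]
    simp only [familyBracket_incl_incl]
    rw [← sklyanin_lie, Derivation.commutator_apply, map_sub, sub_self]
  · exact hB.mixedJacobi_iff.mp ((mixedJacobi_iff_of_mixedFamily hB
      (prolongsSklyanin_familyBracket η) (mixedFamily_familyBracket η)).mpr hη)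
  · rw [jacobiator_θ_θ_incl hB (familyBracket_θ_incl η) (familyBracket_θ_θ η)]
    exact Finset.sum_eq_zero fun k _ => by
      rw [mixedDefect_mixedParam hη, map_zero, Derivation.zero_apply, zero_smul]
  · rw [jacobiator_θ_θ_θ hB (familyBracket_θ_θ η)]
    fin_cases i <;> fin_cases j <;> fin_cases k <;>
      simp [volumeParam, formsParam, Fin.sum_univ_three]

/-! ### The bracket on the tensor square -/

theorem degProj_zero_incl (f : FunAlg) : degProj 0 (incl f) = incl f := by
  simp [degProj, ← add_smul]
  norm_num

theorem degProj_one_incl (f : FunAlg) : degProj 1 (incl f) = 0 := by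
  simp [degProj]

theorem degProj_add (x : ExtAlg) : degProj 0 x + degProj 1 x = x := by
  simp only [degProj, koszul_zero_left, koszul_one_one, LinearMap.smul_apply, LinearMap.add_apply,
    LinearMap.id_apply, AlgHom.toLinearMap_apply, one_smul, neg_smul, ← smul_add]
  module

theorem sum_zmod_two {M : Type*} [AddCommMonoid M] (g : ZMod 2 → M) : ∑ p, g p = g 0 + g 1 :=
  Fin.sum_univ_two g

theorem tensorBracket_tmul (B : Bracket) (x y z w : ExtAlg) :
    tensorBracket B (x ⊗ₜ y) (z ⊗ₜ w) = ∑ p : ZMod 2, ∑ q : ZMod 2, koszul p q •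
      (B x (degProj q z) ⊗ₜ (degProj p y * w) + (x * degProj q z) ⊗ₜ B (degProj p y) w) := by
  simp only [tensorBracket, LinearMap.sum_apply, LinearMap.smul_apply, LinearMap.add_apply,
    TensorProduct.map₂_apply_tmul, TensorProduct.map_tmul, LinearMap.compl₂_apply,
    LinearMap.comp_apply, LinearMap.mul_apply']

theorem tensorBracket_incl_left (B : Bracket) (x y : ExtAlg) (h : FunAlg) (z : ExtAlg) :
    tensorBracket B (x ⊗ₜ y) (incl h ⊗ₜ z) =
      B x (incl h) ⊗ₜ (y * z) + (x * incl h) ⊗ₜ B y z := by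
  conv_rhs => rw [← degProj_add y]
  simp only [tensorBracket_tmul, sum_zmod_two, degProj_zero_incl, degProj_one_incl,
    koszul_zero_right, one_smul, map_zero, mul_zero, TensorProduct.zero_tmul, smul_zero, add_zero,
    map_add, LinearMap.add_apply, add_mul, TensorProduct.tmul_add]
  abel

theorem tensorBracket_incl_right (B : Bracket) (x : ExtAlg) (f : FunAlg) (y z : ExtAlg) :
    tensorBracket B (x ⊗ₜ incl f) (y ⊗ₜ z) =
      B x y ⊗ₜ (incl f * z) + (x * y) ⊗ₜ B (incl f) z := by
  conv_rhs => rw [← degProj_add y]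
  simp only [tensorBracket_tmul, sum_zmod_two, degProj_zero_incl, degProj_one_incl,
    koszul_zero_left, koszul_zero_right, one_smul, map_zero, zero_mul, LinearMap.zero_apply,
    TensorProduct.tmul_zero, smul_zero, add_zero, map_add, mul_add, TensorProduct.add_tmul]
  abel

/-- The inclusion `𝒜 ⊗ ℳ ⊆ ℳ ⊗ ℳ`. -/
def inclL : FunAlg ⊗[ℂ] ExtAlg →ₗ[ℂ] ExtAlg ⊗[ℂ] ExtAlg :=
  TensorProduct.map incl.toLinearMap LinearMap.id

/-- The inclusion `ℳ ⊗ 𝒜 ⊆ ℳ ⊗ ℳ`. -/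
def inclR : ExtAlg ⊗[ℂ] FunAlg →ₗ[ℂ] ExtAlg ⊗[ℂ] ExtAlg :=
  TensorProduct.map LinearMap.id incl.toLinearMap

/-- The inclusion `𝒜 ⊗ 𝒜 ⊆ 𝒜 ⊗ ℳ`. -/
def inclAL : FunAlg ⊗[ℂ] FunAlg →ₐ[ℂ] FunAlg ⊗[ℂ] ExtAlg :=
  Algebra.TensorProduct.map (AlgHom.id ℂ FunAlg) incl

/-- The inclusion `𝒜 ⊗ 𝒜 ⊆ ℳ ⊗ 𝒜`. -/
def inclAR : FunAlg ⊗[ℂ] FunAlg →ₐ[ℂ] ExtAlg ⊗[ℂ] FunAlg :=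
  Algebra.TensorProduct.map incl (AlgHom.id ℂ FunAlg)

theorem inclL_tmul (f : FunAlg) (x : ExtAlg) : inclL (f ⊗ₜ x) = incl f ⊗ₜ x := rfl

theorem inclR_tmul (x : ExtAlg) (f : FunAlg) : inclR (x ⊗ₜ f) = x ⊗ₜ incl f := rfl

theorem inclAL_tmul (f h : FunAlg) : inclAL (f ⊗ₜ h) = f ⊗ₜ incl h := rfl

theorem inclAR_tmul (f h : FunAlg) : inclAR (f ⊗ₜ h) = incl f ⊗ₜ h := rfl

theorem aug_incl (f : FunAlg) : aug (incl f) = f := by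
  rw [incl_eq_smul, map_smul, aug_one, smul_eq_mul, mul_one]

theorem inclL_injective : Function.Injective inclL := by
  refine Function.LeftInverse.injective
    (g := TensorProduct.map (aug.restrictScalars ℂ) LinearMap.id) fun u => ?_
  induction u using TensorProduct.induction_on with
  | zero => rw [map_zero, map_zero]
  | tmul f x => simp [inclL_tmul, aug_incl]
  | add u v hu hv => rw [map_add, map_add, hu, hv]

theorem inclR_injective : Function.Injective inclR := by
  refine Function.LeftInverse.injective
    (g := TensorProduct.map LinearMap.id (aug.restrictScalars ℂ)) fun u => ?_
  induction u using TensorProduct.induction_on with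
  | zero => rw [map_zero, map_zero]
  | tmul f x => simp [inclR_tmul, aug_incl]
  | add u v hu hv => rw [map_add, map_add, hu, hv]

/-- The bracket of `ℳ ⊗ ℳ` restricted to `𝒜 ⊗ ℳ`, for a bracket that prolongs the Sklyanin
bracket. -/
def bracketL (B : Bracket) :
    FunAlg ⊗[ℂ] ExtAlg →ₗ[ℂ] FunAlg ⊗[ℂ] ExtAlg →ₗ[ℂ] FunAlg ⊗[ℂ] ExtAlg :=
  TensorProduct.map₂ (LinearMap.mk₂ ℂ (fun f h => sklyanin f h)
      (fun f g h => by rw [map_add, Derivation.add_apply])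
      (fun r f h => by rw [map_smul, Derivation.smul_apply])
      (fun f g h => map_add _ _ _) (fun r f h => Derivation.map_smul _ _ _))
    (LinearMap.mul ℂ ExtAlg) + TensorProduct.map₂ (LinearMap.mul ℂ FunAlg) B

theorem bracketL_tmul (B : Bracket) (f h : FunAlg) (x y : ExtAlg) :
    bracketL B (f ⊗ₜ x) (h ⊗ₜ y) = sklyanin f h ⊗ₜ (x * y) + (f * h) ⊗ₜ B x y := rfl

theorem tensorBracket_inclL {B : Bracket} (hB : IsGradedBracket B) (hS : ProlongsSklyanin B)
    (u v : FunAlg ⊗[ℂ] ExtAlg) :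
    tensorBracket B (inclL u) (inclL v) = inclL (bracketL B u v) := by
  induction u using TensorProduct.induction_on with
  | zero => simp only [map_zero, LinearMap.zero_apply]
  | add u w hu hw => simp only [map_add, LinearMap.add_apply, hu, hw]
  | tmul f x =>
    induction v using TensorProduct.induction_on with
    | zero => simp only [map_zero]
    | add v w hv hw => simp only [map_add, hv, hw]
    | tmul h y =>
      rw [inclL_tmul, inclL_tmul, tensorBracket_incl_left, (prolongsSklyanin_iff hB).mp hS,
        bracketL_tmul, map_add, inclL_tmul, inclL_tmul, map_mul]

/-! ### The comultiplications -/

theorem ΔL_apply (x : ExtAlg) : ΔL x = inclL (comulL x) := rfl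

theorem ΔR_apply (x : ExtAlg) : ΔR x = inclR (comulR x) := rfl

theorem inclR_inclAR (u : FunAlg ⊗[ℂ] FunAlg) : inclR (inclAR u) = inclL (inclAL u) := by
  induction u using TensorProduct.induction_on with
  | zero => simp only [map_zero]
  | tmul g h => rfl
  | add u v hu hv => simp only [map_add, hu, hv]

theorem ΔA_apply (f : FunAlg) : ΔA f = inclL (inclAL (comul f)) := by
  change TensorProduct.map incl.toLinearMap incl.toLinearMap (comul f) = _
  induction comul f using TensorProduct.induction_on with
  | zero => simp only [map_zero]
  | tmul g h => rfl
  | add u v hu hv => simp only [map_add, hu, hv]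

theorem liftForms_ι {X : Type*} [Ring X] [Algebra ℂ X] (x : Fin 3 → X)
    (h : ∀ i j, x i * x j = -(x j * x i)) (i : Fin 3) :
    liftForms x h (ExteriorAlgebra.ι ℂ (Pi.single i 1)) = x i := by
  simp [liftForms]

theorem comulL_incl (f : FunAlg) : comulL (incl f) = inclAL (comul f) := by
  rw [comulL, incl_apply, Algebra.TensorProduct.lift_tmul, map_one, mul_one]; rfl

theorem comulR_incl (f : FunAlg) : comulR (incl f) = inclAR (comul f) := by
  rw [comulR, incl_apply, Algebra.TensorProduct.lift_tmul, map_one, mul_one]; rfl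

theorem comulL_θ (i : Fin 3) : comulL (θ i) = ∑ j, adMat i j ⊗ₜ θ j := by
  rw [comulL, θ, Algebra.TensorProduct.lift_tmul, map_one, one_mul, liftForms_ι]; rfl

theorem comulR_θ (i : Fin 3) : comulR (θ i) = θ i ⊗ₜ 1 := by
  rw [comulR, θ, Algebra.TensorProduct.lift_tmul, map_one, one_mul, liftForms_ι]; rfl

theorem comulL_smul (f : FunAlg) (x : ExtAlg) : comulL (f • x) = inclAL (comul f) * comulL x := by
  rw [← incl_mul, map_mul, comulL_incl]

theorem comulR_smul (f : FunAlg) (x : ExtAlg) : comulR (f • x) = inclAR (comul f) * comulR x := by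
  rw [← incl_mul, map_mul, comulR_incl]

theorem comul_T (i j : Fin 2) : comul (T i j) = ∑ k, T i k ⊗ₜ T k j := by
  rw [← quot_X (i, j)]
  refine (MvPolynomial.aeval_X _ _).trans ?_
  simp [comulT, Matrix.mul_apply]

theorem comul_a : comul a = a ⊗ₜ a + b ⊗ₜ c := (comul_T 0 0).trans (Fin.sum_univ_two _)

theorem comul_b : comul b = a ⊗ₜ b + b ⊗ₜ d := (comul_T 0 1).trans (Fin.sum_univ_two _)

theorem comul_c : comul c = c ⊗ₜ a + d ⊗ₜ c := (comul_T 1 0).trans (Fin.sum_univ_two _)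

theorem comul_d : comul d = c ⊗ₜ b + d ⊗ₜ d := (comul_T 1 1).trans (Fin.sum_univ_two _)

/-! ### Vector fields and the comultiplication -/

theorem algHom_ext {R : Type*} [Semiring R] [Algebra ℂ R] {φ ψ : FunAlg →ₐ[ℂ] R}
    (h : ∀ i j, φ (T i j) = ψ (T i j)) : φ = ψ := by
  ext f
  induction f using FunAlg.induction with
  | algebraMap r => rw [AlgHom.commutes, AlgHom.commutes]
  | T i j => exact h i j
  | add f g hf hg => rw [map_add, map_add, hf, hg]
  | mul f g hf hg => rw [map_mul, map_mul, hf, hg]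

/-- The map `id ⊗ ε : 𝒜 ⊗ 𝒜 → 𝒜`, for the counit `ε`. -/
def counitRight : FunAlg ⊗[ℂ] FunAlg →ₐ[ℂ] FunAlg :=
  Algebra.TensorProduct.lift (AlgHom.id ℂ FunAlg) ((Algebra.ofId ℂ FunAlg).comp counit)
    fun _ _ => Commute.all _ _

/-- The map `ε ⊗ id : 𝒜 ⊗ 𝒜 → 𝒜`, for the counit `ε`. -/
def counitLeft : FunAlg ⊗[ℂ] FunAlg →ₐ[ℂ] FunAlg :=
  Algebra.TensorProduct.lift ((Algebra.ofId ℂ FunAlg).comp counit) (AlgHom.id ℂ FunAlg)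
    fun _ _ => Commute.all _ _

theorem counitRight_tmul (f h : FunAlg) :
    counitRight (f ⊗ₜ h) = f * algebraMap ℂ FunAlg (counit h) :=
  rfl

theorem counitLeft_tmul (f h : FunAlg) :
    counitLeft (f ⊗ₜ h) = algebraMap ℂ FunAlg (counit f) * h :=
  rfl

theorem counitRight_comul (f : FunAlg) : counitRight (comul f) = f := by
  have h : counitRight.comp comul = AlgHom.id ℂ FunAlg := algHom_ext fun i j => by
    simp only [AlgHom.comp_apply, comul_T, map_sum, counitRight_tmul, counit_T, AlgHom.id_apply]
    revert j
    simp [Fin.forall_fin_two, Fin.sum_univ_two]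
  exact AlgHom.congr_fun h f

theorem counitLeft_comul (f : FunAlg) : counitLeft (comul f) = f := by
  have h : counitLeft.comp comul = AlgHom.id ℂ FunAlg := algHom_ext fun i j => by
    simp only [AlgHom.comp_apply, comul_T, map_sum, counitLeft_tmul, counit_T, AlgHom.id_apply]
    revert i
    simp [Fin.forall_fin_two, Fin.sum_univ_two]
  exact AlgHom.congr_fun h f

/-- The derivation `D ⊗ id` of `𝒜 ⊗ 𝒜`. -/
def derLeft : Derivation ℂ FunAlg FunAlg →ₗ[ℂ] FunAlg ⊗[ℂ] FunAlg →ₗ[ℂ] FunAlg ⊗[ℂ] FunAlg where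
  toFun D := (D : FunAlg →ₗ[ℂ] FunAlg).rTensor FunAlg
  map_add' _ _ := LinearMap.rTensor_add _ _ _
  map_smul' _ _ := LinearMap.rTensor_smul _ _ _

/-- The derivation `id ⊗ D` of `𝒜 ⊗ 𝒜`. -/
def derRight : Derivation ℂ FunAlg FunAlg →ₗ[ℂ] FunAlg ⊗[ℂ] FunAlg →ₗ[ℂ] FunAlg ⊗[ℂ] FunAlg where
  toFun D := (D : FunAlg →ₗ[ℂ] FunAlg).lTensor FunAlg
  map_add' _ _ := LinearMap.lTensor_add _ _ _
  map_smul' _ _ := LinearMap.lTensor_smul _ _ _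

theorem derLeft_tmul (D : Derivation ℂ FunAlg FunAlg) (f h : FunAlg) :
    derLeft D (f ⊗ₜ h) = D f ⊗ₜ h :=
  rfl

theorem derRight_tmul (D : Derivation ℂ FunAlg FunAlg) (f h : FunAlg) :
    derRight D (f ⊗ₜ h) = f ⊗ₜ D h :=
  rfl

theorem derLeft_mul (D : Derivation ℂ FunAlg FunAlg) (u v : FunAlg ⊗[ℂ] FunAlg) :
    derLeft D (u * v) = derLeft D u * v + u * derLeft D v := by
  induction u using TensorProduct.induction_on with
  | zero => simp only [zero_mul, map_zero, add_zero]
  | add u w hu hw => rw [add_mul, map_add, hu, hw, map_add]; ring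
  | tmul f h =>
    induction v using TensorProduct.induction_on with
    | zero => simp only [mul_zero, map_zero, add_zero]
    | add v w hv hw => rw [mul_add, map_add, hv, hw, map_add]; ring
    | tmul f' h' =>
      simp only [Algebra.TensorProduct.tmul_mul_tmul, derLeft_tmul, Derivation.leibniz,
        smul_eq_mul, TensorProduct.add_tmul, mul_comm f' (D f), add_comm]

theorem derRight_mul (D : Derivation ℂ FunAlg FunAlg) (u v : FunAlg ⊗[ℂ] FunAlg) :
    derRight D (u * v) = derRight D u * v + u * derRight D v := by
  induction u using TensorProduct.induction_on with
  | zero => simp only [zero_mul, map_zero, add_zero]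
  | add u w hu hw => rw [add_mul, map_add, hu, hw, map_add]; ring
  | tmul f h =>
    induction v using TensorProduct.induction_on with
    | zero => simp only [mul_zero, map_zero, add_zero]
    | add v w hv hw => rw [mul_add, map_add, hv, hw, map_add]; ring
    | tmul f' h' =>
      simp only [Algebra.TensorProduct.tmul_mul_tmul, derRight_tmul, Derivation.leibniz,
        smul_eq_mul, TensorProduct.tmul_add, mul_comm h' (D h), add_comm]

theorem derLeft_smul (f : FunAlg) (D : Derivation ℂ FunAlg FunAlg) (u : FunAlg ⊗[ℂ] FunAlg) :
    derLeft (f • D) u = f ⊗ₜ 1 * derLeft D u := by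
  induction u using TensorProduct.induction_on with
  | zero => simp only [map_zero, mul_zero]
  | tmul g h =>
    rw [derLeft_tmul, derLeft_tmul, Algebra.TensorProduct.tmul_mul_tmul, one_mul,
      Derivation.smul_apply, smul_eq_mul]
  | add u v hu hv => rw [map_add, hu, hv, map_add, mul_add]

theorem eq_of_leibniz_comul {P P' : FunAlg →ₗ[ℂ] FunAlg ⊗[ℂ] FunAlg}
    (hP : ∀ f h, P (f * h) = P f * comul h + comul f * P h)
    (hP' : ∀ f h, P' (f * h) = P' f * comul h + comul f * P' h)
    (hT : ∀ i j, P (T i j) = P' (T i j)) : P = P' := by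
  have map_one_eq_zero {P : FunAlg →ₗ[ℂ] FunAlg ⊗[ℂ] FunAlg}
      (hP : ∀ f h, P (f * h) = P f * comul h + comul f * P h) : P 1 = 0 := by
    have h := hP 1 1
    rwa [map_one comul, mul_one, mul_one, one_mul, left_eq_add] at h
  refine LinearMap.ext fun f => ?_
  induction f using FunAlg.induction with
  | algebraMap r =>
    rw [Algebra.algebraMap_eq_smul_one, map_smul, map_smul, map_one_eq_zero hP,
      map_one_eq_zero hP']
  | T i j => exact hT i j
  | add f h hf hh => rw [map_add, map_add, hf, hh]
  | mul f h hf hh => rw [hP, hP', hf, hh]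

theorem leibniz_comul_derivation (D : Derivation ℂ FunAlg FunAlg) (f h : FunAlg) :
    comul (D (f * h)) = comul (D f) * comul h + comul f * comul (D h) := by
  rw [Derivation.leibniz, smul_eq_mul, smul_eq_mul, map_add, map_mul, map_mul]
  ring

theorem leibniz_derLeft_comul (D : Derivation ℂ FunAlg FunAlg) (f h : FunAlg) :
    derLeft D (comul (f * h)) = derLeft D (comul f) * comul h + comul f * derLeft D (comul h) := by
  rw [map_mul, derLeft_mul]

theorem leibniz_derRight_comul (D : Derivation ℂ FunAlg FunAlg) (f h : FunAlg) :
    derRight D (comul (f * h)) =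
      derRight D (comul f) * comul h + comul f * derRight D (comul h) := by
  rw [map_mul, derRight_mul]

theorem comul_rightField (X : Fin 3 → ℂ) (f : FunAlg) :
    comul (rightField X f) = derLeft (rightField X) (comul f) := by
  refine LinearMap.congr_fun (eq_of_leibniz_comul
    (P := comul.toLinearMap ∘ₗ (rightField X : FunAlg →ₗ[ℂ] FunAlg))
    (P' := derLeft (rightField X) ∘ₗ comul.toLinearMap) (leibniz_comul_derivation (rightField X))
    (leibniz_derLeft_comul _) ((forall_T_iff (p := fun t => comul (rightField X t) =
      derLeft (rightField X) (comul t))).mpr ?_)) f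
  simp only [rightField_a, rightField_b, rightField_c, rightField_d, map_add, map_sub, map_smul,
    comul_a, comul_b, comul_c, comul_d, derLeft_tmul, TensorProduct.add_tmul,
    TensorProduct.sub_tmul, ← TensorProduct.smul_tmul']
  refine ⟨?_, ?_, ?_, ?_⟩ <;> module

theorem comul_leftField (X : Fin 3 → ℂ) (f : FunAlg) :
    comul (leftField X f) = derRight (leftField X) (comul f) := by
  refine LinearMap.congr_fun (eq_of_leibniz_comul
    (P := comul.toLinearMap ∘ₗ (leftField X : FunAlg →ₗ[ℂ] FunAlg))
    (P' := derRight (leftField X) ∘ₗ comul.toLinearMap) (leibniz_comul_derivation (leftField X))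
    (leibniz_derRight_comul _) ((forall_T_iff (p := fun t => comul (leftField X t) =
      derRight (leftField X) (comul t))).mpr ?_)) f
  simp only [leftField_a, leftField_b, leftField_c, leftField_d, map_add, map_sub, map_smul,
    comul_a, comul_b, comul_c, comul_d, derRight_tmul, TensorProduct.tmul_add,
    TensorProduct.tmul_sub, TensorProduct.tmul_smul]
  refine ⟨?_, ?_, ?_, ?_⟩ <;> module

theorem derRight_rightField_comul (X : Fin 3 → ℂ) (f : FunAlg) :
    derRight (rightField X) (comul f) = derLeft (leftField X) (comul f) := by
  refine LinearMap.congr_fun (eq_of_leibniz_comul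
    (P := derRight (rightField X) ∘ₗ comul.toLinearMap)
    (P' := derLeft (leftField X) ∘ₗ comul.toLinearMap) (leibniz_derRight_comul _)
    (leibniz_derLeft_comul _) ((forall_T_iff (p := fun t => derRight (rightField X) (comul t) =
      derLeft (leftField X) (comul t))).mpr ?_)) f
  simp only [rightField_a, rightField_b, rightField_c, rightField_d, leftField_a, leftField_b,
    leftField_c, leftField_d, map_add, comul_a, comul_b, comul_c, comul_d, derLeft_tmul,
    derRight_tmul, TensorProduct.add_tmul, TensorProduct.sub_tmul, TensorProduct.tmul_add,
    TensorProduct.tmul_sub, ← TensorProduct.smul_tmul', TensorProduct.tmul_smul]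
  refine ⟨?_, ?_, ?_, ?_⟩ <;> module

theorem counitRight_derLeft (D : Derivation ℂ FunAlg FunAlg) (u : FunAlg ⊗[ℂ] FunAlg) :
    counitRight (derLeft D u) = D (counitRight u) := by
  induction u using TensorProduct.induction_on with
  | zero => simp only [map_zero]
  | tmul f h =>
    rw [derLeft_tmul, counitRight_tmul, counitRight_tmul, Derivation.leibniz,
      Derivation.map_algebraMap, smul_zero, zero_add, smul_eq_mul, mul_comm]
  | add u v hu hv => simp only [map_add, hu, hv]

theorem derLeft_comul_inj {D D' : Derivation ℂ FunAlg FunAlg} :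
    (∀ f, derLeft D (comul f) = derLeft D' (comul f)) ↔ D = D' := by
  refine ⟨fun h => Derivation.ext fun f => ?_, fun h f => by rw [h]⟩
  have hf := congrArg counitRight (h f)
  rwa [counitRight_derLeft, counitRight_derLeft, counitRight_comul] at hf

theorem exists_eq_rightField {D : Derivation ℂ FunAlg FunAlg}
    (hD : ∀ f, comul (D f) = derLeft D (comul f)) : ∃ X, D = rightField X := by
  have hvalue (i j : Fin 2) :
      D (T i j) = counit (D (T i 0)) • T 0 j + counit (D (T i 1)) • T 1 j := by
    conv_lhs => rw [← counitLeft_comul (D (T i j)), hD, comul_T, Fin.sum_univ_two]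
    simp only [map_add, derLeft_tmul, counitLeft_tmul, Algebra.smul_def]
  have ha : D a = counit (D a) • a + counit (D b) • c := hvalue 0 0
  have hb : D b = counit (D a) • b + counit (D b) • d := hvalue 0 1
  have hc : D c = counit (D c) • a + counit (D d) • c := hvalue 1 0
  have hd : D d = counit (D c) • b + counit (D d) • d := hvalue 1 1
  have htrace : counit (D d) = -counit (D a) := by
    have h := congrArg (fun f => counit (D f)) det_relation
    simp only [map_sub, Derivation.leibniz, smul_eq_mul, map_add, map_mul, counit_apply,
      Derivation.map_one_eq_zero, map_zero, one_mul, zero_mul, sub_zero, add_zero] at h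
    exact eq_neg_of_add_eq_zero_left h
  have hsub (r : ℂ) (f g : FunAlg) : r • f + counit (D d) • g = r • f - counit (D a) • g := by
    rw [htrace, neg_smul, sub_eq_add_neg]
  refine ⟨![counit (D a), counit (D b), counit (D c)], derivation_ext
    ((forall_T_iff (p := fun t => D t = rightField _ t)).mpr ⟨?_, ?_, ?_, ?_⟩)⟩
  · rw [rightField_a]
    exact ha
  · rw [rightField_b]
    exact hb
  · rw [rightField_c]
    exact hc.trans (hsub _ _ _)
  · rw [rightField_d]
    exact hd.trans (hsub _ _ _)

/-! ### Covariance of the Sklyanin bracket -/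

theorem bracketL_inclAL {B : Bracket} (hB : IsGradedBracket B) (hS : ProlongsSklyanin B)
    (u v : FunAlg ⊗[ℂ] FunAlg) : bracketL B (inclAL u) (inclAL v) =
      inclAL (derLeft (leftField ![0, 1, 0]) u * derLeft (leftField ![0, 0, 1]) v
        - derLeft (leftField ![0, 0, 1]) u * derLeft (leftField ![0, 1, 0]) v
        - (derLeft (rightField ![0, 1, 0]) u * derLeft (rightField ![0, 0, 1]) v
          - derLeft (rightField ![0, 0, 1]) u * derLeft (rightField ![0, 1, 0]) v)
        + (derRight (leftField ![0, 1, 0]) u * derRight (leftField ![0, 0, 1]) v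
          - derRight (leftField ![0, 0, 1]) u * derRight (leftField ![0, 1, 0]) v
          - (derRight (rightField ![0, 1, 0]) u * derRight (rightField ![0, 0, 1]) v
            - derRight (rightField ![0, 0, 1]) u * derRight (rightField ![0, 1, 0]) v))) := by
  induction u using TensorProduct.induction_on with
  | zero => simp only [map_zero, LinearMap.zero_apply, zero_mul, sub_zero, add_zero]
  | add u w hu hw =>
    rw [map_add, map_add, LinearMap.add_apply, hu, hw, ← map_add]
    refine congrArg inclAL ?_
    simp only [map_add]
    ring
  | tmul f x =>
    induction v using TensorProduct.induction_on with
    | zero => simp only [map_zero, mul_zero, sub_zero, add_zero]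
    | add v w hv hw =>
      rw [map_add, map_add, hv, hw, ← map_add]
      refine congrArg inclAL ?_
      simp only [map_add]
      ring
    | tmul h y =>
      rw [inclAL_tmul, inclAL_tmul, bracketL_tmul, (prolongsSklyanin_iff hB).mp hS, ← map_mul,
        ← inclAL_tmul, ← inclAL_tmul, ← map_add]
      simp only [derLeft_tmul, derRight_tmul, Algebra.TensorProduct.tmul_mul_tmul, sklyanin,
        LinearMap.sub_apply, Derivation.sub_apply, wedge_apply, TensorProduct.sub_tmul,
        TensorProduct.tmul_sub]

theorem funCovariant {B : Bracket} (hB : IsGradedBracket B) (hS : ProlongsSklyanin B) :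
    FunCovariant B := by
  intro f h
  have hcov : ΔA (sklyanin f h) = tensorBracket B (ΔA f) (ΔA h) := by
    rw [ΔA_apply, ΔA_apply, ΔA_apply, tensorBracket_inclL hB hS, bracketL_inclAL hB hS]
    refine congrArg (inclL ∘ inclAL) ?_
    simp only [sklyanin, LinearMap.sub_apply, Derivation.sub_apply, wedge_apply, map_sub, map_mul,
      comul_leftField, comul_rightField, derRight_rightField_comul]
    ring
  rw [(prolongsSklyanin_iff hB).mp hS, ΔL_apply, ΔR_apply, comulL_incl, comulR_incl,
    inclR_inclAR, ← ΔA_apply]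
  exact ⟨hcov, hcov⟩

/-! ### Frames and the comultiplications -/

theorem fieldForm_lTensor {ι : Type*} [Fintype ι] (X : ι → Derivation ℂ FunAlg FunAlg)
    (e : ι → ExtAlg) (u : FunAlg ⊗[ℂ] FunAlg) :
    (fieldForm X e : FunAlg →ₗ[ℂ] ExtAlg).lTensor FunAlg u =
      ∑ k, inclAL (derRight (X k) u) * (1 ⊗ₜ e k) := by
  induction u using TensorProduct.induction_on with
  | zero => simp only [map_zero, zero_mul, Finset.sum_const_zero]
  | add u v hu hv => simp only [map_add, hu, hv, add_mul, Finset.sum_add_distrib]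
  | tmul f h =>
    simp only [LinearMap.lTensor_tmul, Derivation.coeFn_coe, fieldForm_apply,
      TensorProduct.tmul_sum, derRight_tmul, inclAL_tmul, Algebra.TensorProduct.tmul_mul_tmul,
      mul_one, incl_mul]

theorem fieldForm_rTensor {ι : Type*} [Fintype ι] (X : ι → Derivation ℂ FunAlg FunAlg)
    (e : ι → ExtAlg) (u : FunAlg ⊗[ℂ] FunAlg) :
    (fieldForm X e : FunAlg →ₗ[ℂ] ExtAlg).rTensor FunAlg u =
      ∑ k, inclAR (derLeft (X k) u) * (e k ⊗ₜ 1) := by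
  induction u using TensorProduct.induction_on with
  | zero => simp only [map_zero, zero_mul, Finset.sum_const_zero]
  | add u v hu hv => simp only [map_add, hu, hv, add_mul, Finset.sum_add_distrib]
  | tmul f h =>
    simp only [LinearMap.rTensor_tmul, Derivation.coeFn_coe, fieldForm_apply,
      TensorProduct.sum_tmul, derLeft_tmul, inclAR_tmul, Algebra.TensorProduct.tmul_mul_tmul,
      mul_one, incl_mul]

section Frame

variable {ι : Type*} [Fintype ι] [DecidableEq ι] {e : ι → ExtAlg}
  {φ : ι → ExtAlg →ₗ[FunAlg] FunAlg}

theorem sum_inclAL_mul_inj (hφ : ∀ k l, φ k (e l) = if k = l then 1 else 0)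
    {u v : ι → FunAlg ⊗[ℂ] FunAlg} :
    ∑ k, inclAL (u k) * (1 ⊗ₜ e k) = ∑ k, inclAL (v k) * (1 ⊗ₜ e k) ↔ ∀ k, u k = v k := by
  refine ⟨fun h k => ?_, fun h => by simp only [h]⟩
  have hcoeff (l : ι) (w : FunAlg ⊗[ℂ] FunAlg) :
      ((φ k).restrictScalars ℂ).lTensor FunAlg (inclAL w * (1 ⊗ₜ e l)) =
        if k = l then w else 0 := by
    induction w using TensorProduct.induction_on with
    | zero => simp only [map_zero, zero_mul, ite_self]
    | add w w' hw hw' =>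
      rw [map_add, add_mul, map_add, hw, hw']
      split_ifs <;> simp only [add_zero]
    | tmul f g =>
      rw [inclAL_tmul, Algebra.TensorProduct.tmul_mul_tmul, mul_one, incl_mul,
        LinearMap.lTensor_tmul, LinearMap.restrictScalars_apply, map_smul, hφ]
      split_ifs <;> simp only [smul_eq_mul, mul_one, mul_zero, TensorProduct.tmul_zero]
  have hk := congrArg (((φ k).restrictScalars ℂ).lTensor FunAlg) h
  simpa only [map_sum, hcoeff, Finset.sum_ite_eq, Finset.mem_univ, if_true] using hk

theorem sum_inclAR_mul_inj (hφ : ∀ k l, φ k (e l) = if k = l then 1 else 0)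
    {u v : ι → FunAlg ⊗[ℂ] FunAlg} :
    ∑ k, inclAR (u k) * (e k ⊗ₜ 1) = ∑ k, inclAR (v k) * (e k ⊗ₜ 1) ↔ ∀ k, u k = v k := by
  refine ⟨fun h k => ?_, fun h => by simp only [h]⟩
  have hcoeff (l : ι) (w : FunAlg ⊗[ℂ] FunAlg) :
      ((φ k).restrictScalars ℂ).rTensor FunAlg (inclAR w * (e l ⊗ₜ 1)) =
        if k = l then w else 0 := by
    induction w using TensorProduct.induction_on with
    | zero => simp only [map_zero, zero_mul, ite_self]
    | add w w' hw hw' =>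
      rw [map_add, add_mul, map_add, hw, hw']
      split_ifs <;> simp only [add_zero]
    | tmul f g =>
      rw [inclAR_tmul, Algebra.TensorProduct.tmul_mul_tmul, mul_one, incl_mul,
        LinearMap.rTensor_tmul, LinearMap.restrictScalars_apply, map_smul, hφ]
      split_ifs <;> simp only [smul_eq_mul, mul_one, mul_zero, TensorProduct.zero_tmul]
  have hk := congrArg (((φ k).restrictScalars ℂ).rTensor FunAlg) h
  simpa only [map_sum, hcoeff, Finset.sum_ite_eq, Finset.mem_univ, if_true] using hk

theorem comulR_fieldForm_iff (hφ : ∀ k l, φ k (e l) = if k = l then 1 else 0)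
    (he : ∀ k, comulR (e k) = e k ⊗ₜ 1) (X : ι → Derivation ℂ FunAlg FunAlg) :
    (∀ f, comulR (fieldForm X e f) =
      (fieldForm X e : FunAlg →ₗ[ℂ] ExtAlg).rTensor FunAlg (comul f)) ↔
      ∃ P : ι → Fin 3 → ℂ, ∀ k, X k = rightField (P k) := by
  simp only [fieldForm_rTensor, fieldForm_apply, map_sum, comulR_smul, he, sum_inclAR_mul_inj hφ]
  refine ⟨fun h => ?_, fun ⟨P, hP⟩ f k => by rw [hP, comul_rightField]⟩
  choose P hP using fun k => exists_eq_rightField fun f => h f k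
  exact ⟨P, hP⟩

end Frame

theorem comulR_oddFrame (k : Option (Fin 3)) : comulR (oddFrame k) = oddFrame k ⊗ₜ 1 := by
  cases k <;> simp only [oddFrame, map_mul, comulR_θ, Algebra.TensorProduct.tmul_mul_tmul, mul_one]

theorem comulR_quadFrame (k : Fin 3) : comulR (quadFrame k) = quadFrame k ⊗ₜ 1 := by
  simp only [quadFrame, map_mul, comulR_θ, Algebra.TensorProduct.tmul_mul_tmul, mul_one]

/-- The second compound of the adjoint matrix: the matrix of the left coaction on `quadFrame`. -/
def adMinor : Matrix (Fin 3) (Fin 3) FunAlg := fun k l =>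
  adMat (k + 1) (l + 1) * adMat (k + 2) (l + 2) - adMat (k + 1) (l + 2) * adMat (k + 2) (l + 1)

theorem sum_tmul_θ_mul_θ (g : Fin 3 → Fin 3 → FunAlg) :
    ∑ m, ∑ n, g m n ⊗ₜ[ℂ] (θ m * θ n) =
      ∑ k, (g (k + 1) (k + 2) - g (k + 2) (k + 1)) ⊗ₜ quadFrame k := by
  simp [Fin.sum_univ_three, θ_mul_self, θ_mul_swap 1 0, θ_mul_swap 2 1, θ_mul_swap 0 2,
    θ_mul_θ_eq_quadFrame, TensorProduct.sub_tmul, TensorProduct.tmul_neg]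
  abel

theorem comulL_quadFrame (k : Fin 3) :
    comulL (quadFrame k) = ∑ l, adMinor k l ⊗ₜ quadFrame l := by
  rw [quadFrame, map_mul, comulL_θ, comulL_θ, Finset.sum_mul_sum]
  simp only [Algebra.TensorProduct.tmul_mul_tmul]
  exact sum_tmul_θ_mul_θ fun m n => adMat (k + 1) m * adMat (k + 2) n

theorem sum_adMat_mul_adMinor : ∑ l, adMat 0 l * adMinor 0 l = 1 := by
  simp [Fin.sum_univ_three, adMat, adMinor]
  linear_combination
    (2 * b * c + (a * d - b * c) + 1 - 2 * b * c * (a * d - b * c + 1)) * det_relation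

/-- The matrix of the left coaction on `oddFrame`; the volume form is invariant. -/
def oddMat : Matrix (Option (Fin 3)) (Option (Fin 3)) FunAlg
  | some i, some j => adMat i j
  | none, none => 1
  | _, _ => 0

theorem comulL_oddFrame (k : Option (Fin 3)) :
    comulL (oddFrame k) = ∑ l, oddMat k l ⊗ₜ oddFrame l := by
  cases k with
  | some i => simp [oddFrame, oddMat, comulL_θ, Fintype.sum_option]
  | none =>
    have hvol : oddFrame none = θ 0 * quadFrame 0 := rfl
    rw [hvol, map_mul, comulL_θ, comulL_quadFrame, Finset.sum_mul_sum]
    simp only [Algebra.TensorProduct.tmul_mul_tmul, θ_mul_quadFrame]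
    simp [Fintype.sum_option, oddMat, oddFrame, ← TensorProduct.sum_tmul, sum_adMat_mul_adMinor,
      apply_ite]

/-! ### First-order covariance -/

theorem tensorBracket_inclR_tmul {B : Bracket} (hB : IsGradedBracket B) (x : ExtAlg)
    (u : FunAlg ⊗[ℂ] FunAlg) : tensorBracket B (inclR (x ⊗ₜ 1)) (inclL (inclAL u)) =
      inclR ((B x ∘ₗ incl.toLinearMap).rTensor FunAlg u) := by
  have hone (h : FunAlg) : B (incl 1) (incl h) = 0 := by
    rw [hB.incl_right, map_one, (hB.isGradedDer (incl_mem_degPart h)).apply_one, neg_zero]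
  induction u using TensorProduct.induction_on with
  | zero => simp only [map_zero]
  | add u v hu hv => simp only [map_add, hu, hv]
  | tmul f h =>
    rw [inclAL_tmul, inclL_tmul, inclR_tmul, tensorBracket_incl_right, hone,
      TensorProduct.tmul_zero, add_zero, map_one, one_mul, LinearMap.rTensor_tmul, inclR_tmul]
    rfl

theorem mixedCovariant_iff_comul {B : Bracket} (hB : IsGradedBracket B) (hS : ProlongsSklyanin B) :
    MixedCovariant B ↔ ∀ i f,
      comulL (B (θ i) (incl f)) = bracketL B (comulL (θ i)) (inclAL (comul f)) ∧
      comulR (B (θ i) (incl f)) = (B (θ i) ∘ₗ incl.toLinearMap).rTensor FunAlg (comul f) := by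
  simp only [MixedCovariant, ΔL_apply, ΔR_apply, ΔA_apply, comulR_θ, tensorBracket_inclL hB hS,
    tensorBracket_inclR_tmul hB, inclL_injective.eq_iff, inclR_injective.eq_iff]

theorem bracketL_comulL_θ (B : Bracket) (i : Fin 3) (u : FunAlg ⊗[ℂ] FunAlg) :
    bracketL B (comulL (θ i)) (inclAL u) =
      ∑ l, inclAL (derLeft (sklyanin (oddMat (some i) l)) u) * (1 ⊗ₜ oddFrame l) +
        ∑ j, adMat i j ⊗ₜ 1 * (B (θ j) ∘ₗ incl.toLinearMap).lTensor FunAlg u := by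
  induction u using TensorProduct.induction_on with
  | zero => simp only [map_zero, zero_mul, mul_zero, Finset.sum_const_zero, add_zero]
  | add u v hu hv =>
    simp only [map_add, hu, hv, add_mul, mul_add, Finset.sum_add_distrib]
    abel
  | tmul f h =>
    simp only [comulL_θ, inclAL_tmul, map_sum, LinearMap.sum_apply, bracketL_tmul, mul_incl,
      derLeft_tmul, Fintype.sum_option, oddMat, oddFrame, map_zero, Derivation.zero_apply,
      TensorProduct.zero_tmul, zero_add, Finset.sum_add_distrib, LinearMap.lTensor_tmul,
      Algebra.TensorProduct.tmul_mul_tmul, mul_one, one_mul, incl_mul]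
    rfl

/-- The conditions on the values `P` at the unit of the coefficients of the `{θⁱ, ·}` that express
the left covariance of these derivations. -/
def MixedEquivariant (P : Fin 3 → Option (Fin 3) → Fin 3 → ℂ) : Prop :=
  ∀ i l, ∑ k, oddMat k l • rightField (P i k) =
    sklyanin (oddMat (some i) l) + ∑ j, adMat i j • leftField (P j l)

theorem inclAL_derLeft_smul (f : FunAlg) (D : Derivation ℂ FunAlg FunAlg)
    (u : FunAlg ⊗[ℂ] FunAlg) : inclAL (derLeft (f • D) u) = f ⊗ₜ 1 * inclAL (derLeft D u) := by
  rw [derLeft_smul, map_mul, inclAL_tmul, map_one]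

theorem inclAL_mul_tmul (u : FunAlg ⊗[ℂ] FunAlg) (f : FunAlg) (x : ExtAlg) :
    inclAL u * (f ⊗ₜ x) = f ⊗ₜ 1 * inclAL u * (1 ⊗ₜ x) := by
  have h : f ⊗ₜ[ℂ] (1 : ExtAlg) = inclAL (f ⊗ₜ 1) := by rw [inclAL_tmul, map_one]
  rw [h, ← map_mul, mul_comm, map_mul, mul_assoc, ← h, Algebra.TensorProduct.tmul_mul_tmul,
    mul_one, one_mul]

theorem comulL_fieldForm (p : Option (Fin 3) → Fin 3 → ℂ) (f : FunAlg) :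
    comulL (fieldForm (fun k => rightField (p k)) oddFrame f) =
      ∑ l, inclAL (derLeft (∑ k, oddMat k l • rightField (p k)) (comul f)) * (1 ⊗ₜ oddFrame l) := by
  simp only [fieldForm_apply, map_sum, comulL_smul, comul_rightField, comulL_oddFrame,
    Finset.mul_sum, LinearMap.sum_apply, Finset.sum_mul, inclAL_derLeft_smul, inclAL_mul_tmul]
  exact Finset.sum_comm

theorem sum_lTensor_fieldForm (i : Fin 3) (P : Fin 3 → Option (Fin 3) → Fin 3 → ℂ) (f : FunAlg) :
    ∑ j, adMat i j ⊗ₜ 1 * (fieldForm (fun k => rightField (P j k)) oddFrame :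
        FunAlg →ₗ[ℂ] ExtAlg).lTensor FunAlg (comul f) =
      ∑ l, inclAL (derLeft (∑ j, adMat i j • leftField (P j l)) (comul f)) *
        (1 ⊗ₜ oddFrame l) := by
  simp only [fieldForm_lTensor, derRight_rightField_comul, map_sum, LinearMap.sum_apply,
    Finset.sum_mul, Finset.mul_sum, inclAL_derLeft_smul, mul_assoc]
  exact Finset.sum_comm

theorem comulL_covariant_iff_mixedEquivariant {B : Bracket}
    {P : Fin 3 → Option (Fin 3) → Fin 3 → ℂ}
    (hP : ∀ i, B (θ i) ∘ₗ incl.toLinearMap = fieldForm (fun k => rightField (P i k)) oddFrame) :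
    (∀ i f, comulL (B (θ i) (incl f)) = bracketL B (comulL (θ i)) (inclAL (comul f))) ↔
      MixedEquivariant P := by
  have hPf (i : Fin 3) (f : FunAlg) :
      B (θ i) (incl f) = fieldForm (fun k => rightField (P i k)) oddFrame f :=
    LinearMap.congr_fun (hP i) f
  simp only [bracketL_comulL_θ, hP, hPf, comulL_fieldForm, sum_lTensor_fieldForm,
    ← Finset.sum_add_distrib, ← add_mul, ← map_add, ← LinearMap.add_apply,
    sum_inclAL_mul_inj oddCoeff_oddFrame]
  refine forall_congr' fun i => forall_comm.trans (forall_congr' fun l => ?_)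
  exact derLeft_comul_inj

theorem exists_eq_fieldForm {D : Derivation ℂ FunAlg ExtAlg} (hD : ∀ f, D f ∈ degPart 1) :
    ∃ X, D = fieldForm X oddFrame := by
  refine ⟨fun k => (oddCoeff k).compDer D, Derivation.ext fun f => ?_⟩
  rw [fieldForm_apply]
  exact oddFrame_expansion (hD f)

theorem mixedCovariant_iff_mixedEquivariant {B : Bracket} (hB : IsGradedBracket B)
    (hS : ProlongsSklyanin B) :
    MixedCovariant B ↔ ∃ P, MixedEquivariant P ∧
      ∀ i, B (θ i) ∘ₗ incl.toLinearMap = fieldForm (fun k => rightField (P i k)) oddFrame := by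
  simp only [mixedCovariant_iff_comul hB hS, forall_and]
  refine ⟨fun ⟨hL, hR⟩ => ?_, fun ⟨P, hE, hP⟩ => ?_⟩
  · have hfield (i : Fin 3) : ∃ p : Option (Fin 3) → Fin 3 → ℂ,
        B (θ i) ∘ₗ incl.toLinearMap = fieldForm (fun k => rightField (p k)) oddFrame := by
      have hder := hB.isGradedDer (θ_mem_degPart i)
      obtain ⟨X, hX⟩ := exists_eq_fieldForm (D := hder.onFun) fun f => by
        rw [hder.onFun_apply, ← add_zero (1 : ZMod 2)]
        exact hder.degree (incl_mem_degPart f)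
      have hXf : B (θ i) ∘ₗ incl.toLinearMap = fieldForm X oddFrame :=
        congrArg (fun D : Derivation ℂ FunAlg ExtAlg => (D : FunAlg →ₗ[ℂ] ExtAlg)) hX
      obtain ⟨p, hp⟩ := (comulR_fieldForm_iff oddCoeff_oddFrame comulR_oddFrame X).mp fun f => by
        rw [← hXf, ← hR i f]
        exact congrArg comulR (LinearMap.congr_fun hXf f).symm
      exact ⟨p, by rw [hXf, funext hp]⟩
    choose P hP using hfield
    exact ⟨P, (comulL_covariant_iff_mixedEquivariant hP).mp hL, hP⟩
  · refine ⟨(comulL_covariant_iff_mixedEquivariant hP).mpr hE, fun i f => ?_⟩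
    rw [hP]
    exact (congrArg comulR (LinearMap.congr_fun (hP i) f)).trans
      ((comulR_fieldForm_iff oddCoeff_oddFrame comulR_oddFrame _).mpr ⟨P i, fun _ => rfl⟩ f)

/-! ### Equivariant coefficients -/

theorem adMat_eq : adMat = !![a * d + b * c, -(a * c), b * d;
    -(a * b + a * b), a * a, -(b * b); c * d + c * d, -(c * c), d * d] := by
  have h : 1 + 2 * b * c = a * d + b * c := by linear_combination -det_relation
  rw [adMat, h]
  simp only [pow_two, two_mul, add_mul]

/-- The frame of `sl(2)` dual to `θ⁰, θ¹, θ²` up to scale, in the coordinates of `sl2Matrix`. -/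
def dualFrame : Fin 3 → Fin 3 → ℂ := ![![1, 0, 0], ![0, 0, 2], ![0, 2, 0]]

theorem rightField_dualFrame (i : Fin 3) :
    rightField (dualFrame i) = ∑ j, adMat i j • leftField (dualFrame j) := by
  refine derivation_ext ((forall_T_iff (p := fun t => _ = _)).mpr ?_)
  have hmul (f : FunAlg) : f = (a * d - b * c) * f := by rw [det_relation, one_mul]
  simp only [derivation_sum_apply, Derivation.smul_apply, adMat_eq]
  -- The two sides agree only modulo `det T = 1`: homogenize the left one.
  rw [hmul (rightField _ a), hmul (rightField _ b), hmul (rightField _ c), hmul (rightField _ d)]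
  revert i
  simp [Fin.forall_fin_succ, dualFrame, Fin.sum_univ_three, Algebra.smul_def,
    map_ofNat (algebraMap ℂ FunAlg) 2]
  grind

theorem mixedParam_equivariant (η : ℂ) (i l : Fin 3) :
    ∑ k, adMat k l • rightField (mixedParam η i k) =
      sklyanin (adMat i l) + ∑ j, adMat i j • leftField (mixedParam η j l) := by
  refine derivation_ext ((forall_T_iff (p := fun t => _ = _)).mpr ?_)
  simp only [derivation_sum_apply, Derivation.add_apply, Derivation.smul_apply, adMat_eq]
  and_intros <;> revert i l <;>
    simp [Fin.forall_fin_succ, mixedParam, Fin.sum_univ_three, sklyanin_mul_left, sklyanin_self,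
      sklyanin_a_b, sklyanin_a_c, sklyanin_a_d, sklyanin_b_a, sklyanin_b_c, sklyanin_b_d,
      sklyanin_c_a, sklyanin_c_b, sklyanin_c_d, sklyanin_d_a, sklyanin_d_b, sklyanin_d_c,
      Algebra.smul_def, map_ofNat (algebraMap ℂ FunAlg)] <;>
    grind

/-- The solutions of `MixedEquivariant`. -/
def oddParam (η x : ℂ) (i : Fin 3) : Option (Fin 3) → Fin 3 → ℂ
  | some j => mixedParam η i j
  | none => x • dualFrame i

theorem mixedEquivariant_oddParam (η x : ℂ) : MixedEquivariant (oddParam η x) := by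
  rintro i (_ | l)
  · simp [Fintype.sum_option, oddMat, oddParam, rightField_dualFrame i, Finset.smul_sum,
      smul_comm x]
  · simp [Fintype.sum_option, oddMat, oddParam, mixedParam_equivariant]

/-- Evaluation at a point of the maximal torus. -/
def torusPoint : FunAlg →ₐ[ℂ] ℂ := point !![2, 0; 0, 1 / 2] (by simp [Matrix.det_fin_two])

theorem torusPoint_apply :
    torusPoint a = 2 ∧ torusPoint b = 0 ∧ torusPoint c = 0 ∧ torusPoint d = 1 / 2 := by
  simp [torusPoint, a, b, c, d]

/-- The eigenvalues of the adjoint action at `torusPoint`, with `1` for the invariant `θ⁰θ¹θ²`. -/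
def torusWeight : Option (Fin 3) → ℂ
  | some i => ![1, 4, 1 / 4] i
  | none => 1

theorem torusPoint_adMat (i j : Fin 3) :
    torusPoint (adMat i j) = if i = j then torusWeight (some i) else 0 := by
  obtain ⟨ha, hb, hc, hd⟩ := torusPoint_apply
  revert i j
  simp [Fin.forall_fin_succ, adMat, ha, hb, hc, hd, torusWeight]
  norm_num

theorem torusPoint_oddMat (k l : Option (Fin 3)) :
    torusPoint (oddMat k l) = if k = l then torusWeight k else 0 := by
  rcases k with _ | k <;> rcases l with _ | l <;> simp [oddMat, torusPoint_adMat, torusWeight]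

theorem torusPoint_rightField_dualFrame (i : Fin 3) (f : FunAlg) :
    torusPoint (rightField (dualFrame i) f) =
      torusWeight (some i) * torusPoint (leftField (dualFrame i) f) := by
  rw [rightField_dualFrame, derivation_sum_apply]
  simp [torusPoint_adMat]

theorem torusPoint_sklyanin (f h : FunAlg) : torusPoint (sklyanin f h) = 0 := by
  have hone : dualFrame 1 = (2 : ℂ) • ![0, 0, 1] := by simp [dualFrame]
  have htwo : dualFrame 2 = (2 : ℂ) • ![0, 1, 0] := by simp [dualFrame]
  have hF (g : FunAlg) : torusPoint (rightField ![0, 0, 1] g) =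
      4 * torusPoint (leftField ![0, 0, 1] g) := by
    have := torusPoint_rightField_dualFrame 1 g
    simp only [hone, map_smul, Derivation.smul_apply, torusWeight, Matrix.cons_val,
      smul_eq_mul] at this
    linear_combination this / 2
  have hE (g : FunAlg) : torusPoint (leftField ![0, 1, 0] g) =
      4 * torusPoint (rightField ![0, 1, 0] g) := by
    have := torusPoint_rightField_dualFrame 2 g
    simp only [htwo, map_smul, Derivation.smul_apply, torusWeight, Matrix.cons_val,
      smul_eq_mul] at this
    linear_combination -2 * this
  simp only [sklyanin, LinearMap.sub_apply, Derivation.sub_apply, wedge_apply, map_sub, map_mul,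
    hE, hF]
  ring

/-- Evaluation at a point of a unipotent subgroup. -/
def unipotentPoint : FunAlg →ₐ[ℂ] ℂ := point !![1, 1; 0, 1] (by simp [Matrix.det_fin_two])

theorem unipotentPoint_apply :
    unipotentPoint a = 1 ∧ unipotentPoint b = 1 ∧ unipotentPoint c = 0 ∧ unipotentPoint d = 1 := by
  simp [unipotentPoint, a, b, c, d]

theorem unipotentPoint_adMat : adMat.map unipotentPoint = !![1, 0, 1; -2, 1, -1; 0, 0, 1] := by
  obtain ⟨ha, hb, hc, hd⟩ := unipotentPoint_apply
  ext i j
  revert i j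
  simp [Fin.forall_fin_succ, adMat, ha, hb, hc, hd, map_ofNat unipotentPoint]

theorem unipotentPoint_sklyanin_adMat (i l : Fin 3) :
    unipotentPoint (sklyanin (adMat i l) a) = !![0, 0, 1; -2, 0, -2; 0, 0, 0] i l ∧
      unipotentPoint (sklyanin (adMat i l) b) = !![0, 0, 1; 2, -2, 0; 0, 0, 2] i l := by
  obtain ⟨ha, hb, hc, hd⟩ := unipotentPoint_apply
  rw [adMat_eq]
  revert i l
  simp [Fin.forall_fin_succ, sklyanin_mul_left, sklyanin_self, sklyanin_b_a, sklyanin_c_a,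
    sklyanin_d_a, sklyanin_a_b, sklyanin_c_b, sklyanin_d_b, ha, hb, hc, hd,
    map_ofNat unipotentPoint]
  norm_num

theorem MixedEquivariant.apply_point {P : Fin 3 → Option (Fin 3) → Fin 3 → ℂ}
    (hP : MixedEquivariant P) (φ : FunAlg →ₐ[ℂ] ℂ) (i : Fin 3) (l : Option (Fin 3)) (t : FunAlg) :
    ∑ k, φ (oddMat k l) * φ (rightField (P i k) t) =
      φ (sklyanin (oddMat (some i) l) t) + ∑ j, φ (adMat i j) * φ (leftField (P j l) t) := by
  simpa [derivation_sum_apply] using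
    congrArg φ (DFunLike.congr_fun (hP i l) t)

theorem MixedEquivariant.torus {P : Fin 3 → Option (Fin 3) → Fin 3 → ℂ}
    (hP : MixedEquivariant P) (i : Fin 3) (l : Option (Fin 3)) (m : Fin 3) :
    (torusWeight l - torusWeight (some m) * torusWeight (some i)) * P i l m = 0 := by
  obtain ⟨ha, hb, hc, hd⟩ := torusPoint_apply
  have h (t : FunAlg) : torusWeight l * torusPoint (rightField (P i l) t) =
      torusWeight (some i) * torusPoint (leftField (P i l) t) := by
    simpa [torusPoint_oddMat, torusPoint_sklyanin, torusPoint_adMat] using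
      hP.apply_point torusPoint i l t
  have hw : torusWeight (some 0) = 1 ∧ torusWeight (some 1) = 4 ∧
    torusWeight (some 2) = 4⁻¹ := by simp [torusWeight]
  have h0 := h a
  have h1 := h b
  have h2 := h c
  simp only [rightField_a, rightField_b, rightField_c, leftField_a, leftField_b, leftField_c,
    map_add, map_sub, map_smul, ha, hb, hc, hd, smul_eq_mul] at h0 h1 h2
  revert m
  simp only [Fin.forall_fin_succ, Fin.succ_zero_eq_one, Fin.succ_one_eq_two, hw, IsEmpty.forall_iff,
    and_true]
  refine ⟨?_, ?_, ?_⟩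
  · linear_combination h0 / 2
  · linear_combination 2 * h1
  · linear_combination h2 / 2

theorem MixedEquivariant.eq_oddParam {P : Fin 3 → Option (Fin 3) → Fin 3 → ℂ}
    (hP : MixedEquivariant P) : ∃ η x, P = oddParam η x := by
  obtain ⟨ha, hb, hc, hd⟩ := unipotentPoint_apply
  have hA (i j : Fin 3) := congrFun (congrFun unipotentPoint_adMat i) j
  simp only [Matrix.map_apply] at hA
  -- The torus leaves only the coefficients of weight zero, which the unipotent point relates.
  have hz := hP.torus
  simp [Fin.forall_fin_succ, torusWeight, Option.forall] at hz
  norm_num at hz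
  have hu := hP.apply_point unipotentPoint
  have hua (i : Fin 3) (l : Option (Fin 3)) := hu i l a
  have hub (i : Fin 3) (l : Option (Fin 3)) := hu i l b
  simp [Fin.forall_fin_succ, Option.forall, Fintype.sum_option, Fin.sum_univ_three, oddMat,
    unipotentPoint_sklyanin_adMat, hA, ha, hb, hc, hd, hz] at hua hub
  have hα : P 0 (some 0) 0 = 0 := by grind
  refine ⟨P 0 (some 1) 1, P 0 none 0, ?_⟩
  ext i k m
  revert i k m
  simp [Fin.forall_fin_succ, Option.forall, oddParam, mixedParam, dualFrame]
  grind

theorem mixedEquivariant_iff {P : Fin 3 → Option (Fin 3) → Fin 3 → ℂ} :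
    MixedEquivariant P ↔ ∃ η x, P = oddParam η x :=
  ⟨MixedEquivariant.eq_oddParam, fun ⟨η, x, h⟩ => h ▸ mixedEquivariant_oddParam η x⟩

/-! ### Brackets of the first order -/

theorem mixedCovariant_iff {B : Bracket} (hB : IsGradedBracket B) (hS : ProlongsSklyanin B) :
    MixedCovariant B ↔ ∃ η x, ∀ i f,
      B (θ i) (incl f) = ∑ k, rightField (oddParam η x i k) f • oddFrame k := by
  have happly (η x : ℂ) (i : Fin 3) : B (θ i) ∘ₗ incl.toLinearMap =
        fieldForm (fun k => rightField (oddParam η x i k)) oddFrame ↔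
      ∀ f, B (θ i) (incl f) = ∑ k, rightField (oddParam η x i k) f • oddFrame k :=
    LinearMap.ext_iff.trans (forall_congr' fun f => by
      rw [← fieldForm_apply]
      rfl)
  simp only [mixedCovariant_iff_mixedEquivariant hB hS, mixedEquivariant_iff, ← happly]
  exact ⟨fun ⟨_, ⟨η, x, h⟩, hP⟩ => ⟨η, x, h ▸ hP⟩, fun ⟨η, x, hP⟩ => ⟨_, ⟨η, x, rfl⟩, hP⟩⟩

theorem mixedFamily_iff_oddParam {B : Bracket} (hB : IsGradedBracket B) (η : ℂ) :
    MixedFamily η B ↔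
      ∀ i f, B (θ i) (incl f) = ∑ k, rightField (oddParam η 0 i k) f • oddFrame k := by
  simp [mixedFamily_iff hB, Fintype.sum_option, oddParam, oddFrame]

theorem mixedCovariant_of_mixedFamily {B : Bracket} {η : ℂ} (hB : IsGradedBracket B)
    (hS : ProlongsSklyanin B) (hM : MixedFamily η B) : MixedCovariant B :=
  (mixedCovariant_iff hB hS).mpr ⟨η, 0, (mixedFamily_iff_oddParam hB η).mp hM⟩

theorem firstOrder_iff_mixedFamily {B : Bracket} (hB : IsGradedBracket B)
    (hS : ProlongsSklyanin B) (hL : MixedLinear B) : FirstOrder B ↔ ∃ η, MixedFamily η B := by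
  refine ⟨fun h => ?_, fun ⟨η, hM⟩ =>
    ⟨funCovariant hB hS, mixedCovariant_of_mixedFamily hB hS hM⟩⟩
  obtain ⟨η, x, hP⟩ := (mixedCovariant_iff hB hS).mp h.2
  have hθ : Submodule.span FunAlg (Set.range θ) ≤ LinearMap.ker (oddCoeff none) := by
    rw [Submodule.span_le]
    rintro _ ⟨j, rfl⟩
    exact oddCoeff_oddFrame none (some j)
  have hxa : x • a = 0 := by
    have hcoeff : oddCoeff none (B (θ 0) (incl a)) = 0 := hθ (hL 0 0 0)
    simpa [hP, oddCoeff_oddFrame, oddParam, dualFrame] using hcoeff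
  have hx : x = 0 := by
    simpa [unipotentPoint_apply.1] using congrArg unipotentPoint hxa
  exact ⟨η, (mixedFamily_iff_oddParam hB η).mpr (hx ▸ hP)⟩

theorem bracket_volume_incl {B : Bracket} {P : Fin 3 → Option (Fin 3) → Fin 3 → ℂ}
    (hB : IsGradedBracket B)
    (hP : ∀ i f, B (θ i) (incl f) = ∑ k, rightField (P i k) f • oddFrame k) (f : FunAlg) :
    B (oddFrame none) (incl f) = rightField (∑ j, P j (some j)) f • oddFrame none := by
  have hleibniz (i : Fin 3) {p : ZMod 2} {y : ExtAlg} (hy : y ∈ degPart p) :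
      B (θ i * y) (incl f) = θ i * B y (incl f) + B (θ i) (incl f) * y := by
    rw [hB.leibniz _ _ _ _ _ _ (θ_mem_degPart i) hy (incl_mem_degPart f), koszul_zero_right,
      one_smul]
  have hself (i : Fin 3) (y : ExtAlg) : θ i * (θ i * y) = 0 := by
    rw [← mul_assoc, θ_mul_self, zero_mul]
  have hswap (i j : Fin 3) (y : ExtAlg) : θ i * (θ j * y) = -(θ j * (θ i * y)) := by
    rw [← mul_assoc, θ_mul_swap, neg_mul, mul_assoc]
  rw [oddFrame, hleibniz 0 (mul_mem_degPart (θ_mem_degPart 1) (θ_mem_degPart 2)),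
    hleibniz 1 (θ_mem_degPart 2), hP, hP, hP]
  simp [Fintype.sum_option, Fin.sum_univ_three, oddFrame, mul_add, add_mul, mul_assoc, hself,
    hswap 1 0, hswap 2 1, θ_mul_self, θ_mul_swap 1 0]
  module

section Jacobi

variable (η x : ℂ)

/-- The parameters `oddParam η x` of the fields `{θⁱ, ·}` together with those, all zero, of
`{θ⁰θ¹θ², ·}`. -/
def fullParam : Option (Fin 3) → Option (Fin 3) → Fin 3 → ℂ
  | some i => oddParam η x i
  | none => 0

theorem curvature_fullParam_some (i l : Fin 3) :
    curvature (fullParam η x) (some i) (some l) = curvature (mixedParam η) i l := by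
  simp [curvature, Fintype.sum_option, fullParam, oddParam]

theorem curvature_fullParam_none :
    curvature (fullParam η x) (some 0) none = ![-(4 * (1 + η) * x), 0, 0] := by
  ext m
  revert m
  simp [curvature, Fintype.sum_option, fullParam, oddParam, mixedParam, dualFrame,
    Fin.sum_univ_three, Fin.forall_fin_succ, cross_apply]
  ring

end Jacobi

theorem mixedFamily_of_isGradedPoisson {B : Bracket} (hB : IsGradedPoisson B)
    (hS : ProlongsSklyanin B) (hF : FirstOrder B) : MixedFamily (-2) B ∨ MixedFamily 0 B := by
  have hG := hB.toIsGradedBracket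
  obtain ⟨η, x, hP⟩ := (mixedCovariant_iff hG hS).mp hF.2
  have hfull : ∀ k f, B (oddFrame k) (incl f) =
      ∑ l, rightField (fullParam η x k l) f • oddFrame l := by
    rintro (_ | i) f
    · simpa [fullParam, oddParam, sum_mixedParam_diag] using bracket_volume_incl hG hP f
    · exact hP i f
  have hcurv (i : Fin 3) : ∀ l, curvature (fullParam η x) (some i) l = 0 :=
    (forall_jacobiator_frame_eq_zero_iff oddCoeff_oddFrame hG ((prolongsSklyanin_iff hG).mp hS)
      hfull 1 (some i)).mp fun f h =>
        hB.jacobiator_eq_zero (θ_mem_degPart i) (incl_mem_degPart f) (incl_mem_degPart h)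
  have hη : η = 0 ∨ η = -2 := curvature_mixedParam_eq_zero_iff.mp fun i l => by
    rw [← curvature_fullParam_some η x, hcurv]
  have hx : x = 0 := by
    have hnone := congrFun (hcurv 0 none) 0
    rw [curvature_fullParam_none] at hnone
    rcases hη with rfl | rfl <;> norm_num at hnone <;> exact hnone
  subst hx
  have hM := (mixedFamily_iff_oddParam hG η).mpr hP
  rcases hη with rfl | rfl
  exacts [.inr hM, .inl hM]

theorem typeI_iff {B : Bracket} : TypeI B ↔ MixedFamily (-2) B := by
  constructor <;> rintro ⟨h1, h2, h3, h4, h5, h6, h7, h8, h9, h10, h11, h12⟩ <;> constructor <;>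
    simp only [h1, h2, h3, h4, h5, h6, h7, h8, h9, h10, h11, h12] <;>
    match_scalars <;> simp [map_ofNat] <;> ring

theorem typeII_iff {B : Bracket} : TypeII B ↔ MixedFamily 0 B := by
  constructor <;> rintro ⟨h1, h2, h3, h4, h5, h6, h7, h8, h9, h10, h11, h12⟩ <;> constructor <;>
    simp only [h1, h2, h3, h4, h5, h6, h7, h8, h9, h10, h11, h12] <;>
    match_scalars <;> simp [map_ofNat]

/-! ### Brackets of the second order -/

theorem sum_tmul_inj {ι : Type*} [Fintype ι] [DecidableEq ι] {e : ι → ExtAlg}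
    {φ : ι → ExtAlg →ₗ[FunAlg] FunAlg} (hφ : ∀ k l, φ k (e l) = if k = l then 1 else 0)
    {u v : ι → FunAlg} :
    ∑ k, u k ⊗ₜ[ℂ] e k = ∑ k, v k ⊗ₜ[ℂ] e k ↔ ∀ k, u k = v k := by
  have htmul (w : ι → FunAlg) :
      ∑ k, w k ⊗ₜ[ℂ] e k = ∑ k, inclAL (w k ⊗ₜ 1) * ((1 : FunAlg) ⊗ₜ e k) := by
    simp only [inclAL_tmul, map_one, Algebra.TensorProduct.tmul_mul_tmul, mul_one, one_mul]
  rw [htmul, htmul, sum_inclAL_mul_inj hφ]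
  refine forall_congr' fun k => ⟨fun h => ?_, fun h => by rw [h]⟩
  simpa only [counitRight_tmul, map_one, mul_one] using congrArg counitRight h

theorem eq_algebraMap_of_comul {f : FunAlg} (hf : comul f = f ⊗ₜ 1) :
    f = algebraMap ℂ FunAlg (counit f) := by
  have h := congrArg counitLeft hf
  rwa [counitLeft_comul, counitLeft_tmul, mul_one] at h

theorem comulR_sum_quadFrame_iff {f : Fin 3 → FunAlg} :
    comulR (∑ k, f k • quadFrame k) = (∑ k, f k • quadFrame k) ⊗ₜ 1 ↔
      ∀ k, f k = algebraMap ℂ FunAlg (counit (f k)) := by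
  have hright : (∑ k, f k • quadFrame k) ⊗ₜ[ℂ] (1 : FunAlg) =
      ∑ k, inclAR (f k ⊗ₜ 1) * (quadFrame k ⊗ₜ 1) := by
    simp only [TensorProduct.sum_tmul, inclAR_tmul, Algebra.TensorProduct.tmul_mul_tmul, mul_one,
      incl_mul]
  simp only [hright, map_sum, comulR_smul, comulR_quadFrame,
    sum_inclAR_mul_inj quadCoeff_quadFrame]
  refine forall_congr' fun k => ⟨eq_algebraMap_of_comul, fun h => ?_⟩
  rw [h, AlgHom.commutes, Algebra.TensorProduct.algebraMap_apply]

theorem formsCovariant_iff_comul {B : Bracket} (hB : IsGradedBracket B)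
    (hS : ProlongsSklyanin B) : FormsCovariant B ↔ ∀ i j,
      comulL (B (θ i) (θ j)) = bracketL B (comulL (θ i)) (comulL (θ j)) ∧
      comulR (B (θ i) (θ j)) = B (θ i) (θ j) ⊗ₜ 1 := by
  have hone : B (incl 1) (incl 1) = 0 := by
    rw [(prolongsSklyanin_iff hB).mp hS, sklyanin_self, map_zero]
  have hright (i j : Fin 3) : tensorBracket B (inclR (θ i ⊗ₜ 1)) (inclR (θ j ⊗ₜ 1)) =
      inclR (B (θ i) (θ j) ⊗ₜ 1) := by
    rw [inclR_tmul, inclR_tmul, tensorBracket_incl_right, hone, TensorProduct.tmul_zero, add_zero,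
      inclR_tmul, map_one, one_mul]
  simp only [FormsCovariant, ΔL_apply, ΔR_apply, comulR_θ, tensorBracket_inclL hB hS, hright,
    inclL_injective.eq_iff, inclR_injective.eq_iff]

/-- The conditions on the constant coefficients `p` of the `{θⁱ, θʲ}` on `quadFrame` that express
the left covariance of these brackets. -/
def FormsEquivariant (p : Fin 3 → Fin 3 → Fin 3 → ℂ) : Prop :=
  ∀ i j l, ∑ k, p i j k • adMinor k l =
    sklyanin (adMat i (l + 1)) (adMat j (l + 2)) - sklyanin (adMat i (l + 2)) (adMat j (l + 1)) +
      ∑ m, ∑ n, p m n l • (adMat i m * adMat j n)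

theorem comulL_covariant_iff_formsEquivariant {B : Bracket} {p : Fin 3 → Fin 3 → Fin 3 → ℂ}
    (hp : ∀ i j, B (θ i) (θ j) = ∑ k, p i j k • quadFrame k) :
    (∀ i j, comulL (B (θ i) (θ j)) = bracketL B (comulL (θ i)) (comulL (θ j))) ↔
      FormsEquivariant p := by
  have hleft (i j : Fin 3) : comulL (B (θ i) (θ j)) =
      ∑ l, (∑ k, p i j k • adMinor k l) ⊗ₜ quadFrame l := by
    simp only [hp, map_sum, map_smul, comulL_quadFrame, Finset.smul_sum, TensorProduct.sum_tmul,
      TensorProduct.smul_tmul']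
    exact Finset.sum_comm
  have hright (i j : Fin 3) : bracketL B (comulL (θ i)) (comulL (θ j)) =
      ∑ l, (sklyanin (adMat i (l + 1)) (adMat j (l + 2)) -
        sklyanin (adMat i (l + 2)) (adMat j (l + 1)) +
        ∑ m, ∑ n, p m n l • (adMat i m * adMat j n)) ⊗ₜ quadFrame l := by
    simp only [comulL_θ, map_sum, LinearMap.sum_apply, bracketL_tmul, hp, Finset.sum_add_distrib,
      TensorProduct.add_tmul, TensorProduct.sum_tmul, TensorProduct.tmul_sum,
      TensorProduct.tmul_smul, TensorProduct.smul_tmul']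
    rw [Finset.sum_comm, sum_tmul_θ_mul_θ fun m n => sklyanin (adMat i m) (adMat j n),
      Finset.sum_comm]
    congr 1
    exact (Finset.sum_congr rfl fun m _ => Finset.sum_comm).trans Finset.sum_comm
  simp only [hleft, hright, sum_tmul_inj quadCoeff_quadFrame, FormsEquivariant]

theorem formsEquivariant_formsParam : FormsEquivariant formsParam := by
  simp only [FormsEquivariant, adMinor, adMat_eq]
  intro i j
  fin_cases i <;> fin_cases j <;>
    simp [Fin.forall_fin_succ, Fin.sum_univ_three, formsParam, sklyanin_mul_left, sklyanin_self,
      sklyanin_a_b, sklyanin_a_c, sklyanin_a_d, sklyanin_b_a, sklyanin_b_c, sklyanin_b_d,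
      sklyanin_c_a, sklyanin_c_b, sklyanin_c_d, sklyanin_d_a, sklyanin_d_b, sklyanin_d_c,
      Algebra.smul_def, map_ofNat (algebraMap ℂ FunAlg)] <;>
    grind

theorem torusPoint_adMinor (k l : Fin 3) :
    torusPoint (adMinor k l) = if k = l then ![1, 1 / 4, 4] k else 0 := by
  revert k l
  simp [Fin.forall_fin_succ, adMinor, torusPoint_adMat, torusWeight]

theorem unipotentPoint_adMinor :
    adMinor.map unipotentPoint = !![1, 2, 0; 0, 1, 0; -1, -1, 1] := by
  have hA (i j : Fin 3) := congrFun (congrFun unipotentPoint_adMat i) j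
  simp only [Matrix.map_apply] at hA
  ext k l
  revert k l
  simp [Fin.forall_fin_succ, adMinor, hA]
  norm_num

theorem eq_zero_of_adMinor_eq_adMat {q : Fin 3 → Fin 3 → Fin 3 → ℂ}
    (hsymm : ∀ i j, q i j = q j i)
    (hq : ∀ i j l, ∑ k, q i j k • adMinor k l = ∑ m, ∑ n, q m n l • (adMat i m * adMat j n)) :
    q = 0 := by
  have hA (i j : Fin 3) := congrFun (congrFun unipotentPoint_adMat i) j
  have hM (i j : Fin 3) := congrFun (congrFun unipotentPoint_adMinor i) j
  simp only [Matrix.map_apply] at hA hM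
  have ht (i j l : Fin 3) := congrArg torusPoint (hq i j l)
  have hu (i j l : Fin 3) := congrArg unipotentPoint (hq i j l)
  -- There is no nonzero equivariant map `Sym² 𝔰𝔩₂ → Λ² 𝔰𝔩₂`: the torus point kills the
  -- coefficients of nonzero weight and the unipotent point the others.
  simp [Fin.forall_fin_succ, Fin.sum_univ_three, torusPoint_adMinor, torusPoint_adMat,
    torusWeight, -mul_eq_mul_left_iff, -mul_eq_mul_right_iff] at ht
  simp [Fin.forall_fin_succ, Fin.sum_univ_three, hA, hM] at hu
  ext i j l
  revert i j l
  simp [Fin.forall_fin_succ, hsymm 1 0, hsymm 2 0, hsymm 2 1] at *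
  grind

theorem formsEquivariant_iff {p : Fin 3 → Fin 3 → Fin 3 → ℂ} (hsymm : ∀ i j, p i j = p j i) :
    FormsEquivariant p ↔ p = formsParam := by
  refine ⟨fun hp => sub_eq_zero.mp (eq_zero_of_adMinor_eq_adMat (fun i j => ?_) fun i j l => ?_),
    fun hp => hp ▸ formsEquivariant_formsParam⟩
  · rw [Pi.sub_apply, Pi.sub_apply, Pi.sub_apply, Pi.sub_apply, hsymm, formsParam_symm]
  · simp only [Pi.sub_apply, sub_smul, Finset.sum_sub_distrib, hp i j l,
      formsEquivariant_formsParam i j l, add_sub_add_left_eq_sub]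

theorem FormsTable.formsQuadratic {B : Bracket} (hB : IsGradedBracket B) (hF : FormsTable B) :
    FormsQuadratic B := by
  intro i j
  rw [(formsTable_iff hB).mp hF]
  exact sum_mem fun k _ => Submodule.smul_of_tower_mem _ _
    (Submodule.subset_span ⟨(k + 1, k + 2), rfl⟩)

theorem FormsQuadratic.expansion {B : Bracket} (hQ : FormsQuadratic B) (i j : Fin 3) :
    B (θ i) (θ j) = ∑ k, quadCoeff k (B (θ i) (θ j)) • quadFrame k :=
  quadFrame_expansion (Submodule.span_le.mpr (by
    rintro _ ⟨k, rfl⟩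
    exact θ_mul_θ_mem_span k.1 k.2) (hQ i j))

theorem formsCovariant_iff_formsTable {B : Bracket} (hB : IsGradedBracket B)
    (hS : ProlongsSklyanin B) (hQ : FormsQuadratic B) : FormsCovariant B ↔ FormsTable B := by
  simp only [formsCovariant_iff_comul hB hS, forall_and, formsTable_iff hB]
  refine ⟨fun ⟨hL, hR⟩ => ?_, fun hF =>
    ⟨(comulL_covariant_iff_formsEquivariant hF).mpr formsEquivariant_formsParam, fun i j => ?_⟩⟩
  · set p : Fin 3 → Fin 3 → Fin 3 → ℂ := fun i j k => counit (quadCoeff k (B (θ i) (θ j)))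
    have hp (i j : Fin 3) : B (θ i) (θ j) = ∑ k, p i j k • quadFrame k := by
      have hij := hR i j
      rw [hQ.expansion i j, comulR_sum_quadFrame_iff] at hij
      conv_lhs => rw [hQ.expansion i j]
      exact Finset.sum_congr rfl fun k _ => by rw [hij k, algebraMap_smul]
    have hsymm (i j : Fin 3) : p i j = p j i :=
      funext fun k => congrArg (fun x => counit (quadCoeff k x)) (hB.θ_symm i j)
    rwa [(formsEquivariant_iff hsymm).mp ((comulL_covariant_iff_formsEquivariant hp).mp hL)] at hp
  · have hconst := comulR_sum_quadFrame_iff.mpr fun k =>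
      (congrArg (algebraMap ℂ FunAlg) (counit.commutes (formsParam i j k))).symm
    simpa only [hF, algebraMap_smul] using hconst

theorem secondOrder_iff_formsTable {B : Bracket} (hB : IsGradedBracket B)
    (hS : ProlongsSklyanin B) (hQ : FormsQuadratic B) : SecondOrder B ↔ FormsTable B :=
  (and_iff_right (funCovariant hB hS)).trans (formsCovariant_iff_formsTable hB hS hQ)

/-! ### Graded Poisson–Lie structures -/

theorem isGradedPoissonLie_familyBracket {η : ℂ} (hη : η = 0 ∨ η = -2) :
    IsGradedPoissonLie (familyBracket η) :=
  have hB := isGradedBracket_familyBracket η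
  have hS := prolongsSklyanin_familyBracket η
  have hF := formsTable_familyBracket η
  { poisson := isGradedPoisson_familyBracket hη
    sklyanin := hS
    quadratic := hF.formsQuadratic hB
    funCov := funCovariant hB hS
    mixedCov := mixedCovariant_of_mixedFamily hB hS (mixedFamily_familyBracket η)
    formsCov := (formsCovariant_iff_formsTable hB hS (hF.formsQuadratic hB)).mpr hF }

theorem isGradedPoissonLie_iff {B : Bracket} :
    IsGradedPoissonLie B ↔ B = familyBracket (-2) ∨ B = familyBracket 0 := by
  refine ⟨fun h => ?_, ?_⟩
  · have hB := h.poisson.toIsGradedBracket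
    have hF := (formsCovariant_iff_formsTable hB h.sklyanin h.quadratic).mp h.formsCov
    exact (mixedFamily_of_isGradedPoisson h.poisson h.sklyanin ⟨h.funCov, h.mixedCov⟩).imp
      (eq_familyBracket hB h.sklyanin · hF) (eq_familyBracket hB h.sklyanin · hF)
  · rintro (rfl | rfl)
    · exact isGradedPoissonLie_familyBracket (.inr rfl)
    · exact isGradedPoissonLie_familyBracket (.inl rfl)

theorem familyBracket_injective : Function.Injective familyBracket := by
  have hcoeff (η : ℂ) :
      counit (oddCoeff (some 1) (familyBracket η (θ 1) (incl a))) = -(1 + η) := by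
    have hθ := oddCoeff_oddFrame (some 1) (some 1)
    rw [(mixedFamily_familyBracket η).θ1a]
    simp_all [oddFrame, counit_apply]
  intro η η' h
  have hη := congrArg (fun B : Bracket => counit (oddCoeff (some 1) (B (θ 1) (incl a)))) h
  simp only [hcoeff] at hη
  linear_combination -hη

end SL2Ext

end

open SL2Ext in
theorem theorem1 :
    -- exactly two graded Poisson-Lie structures prolong the Sklyanin bracket
    (∃ B₁ B₂ : Bracket, B₁ ≠ B₂ ∧
      (TypeI B₁ ∧ FormsTable B₁) ∧ (TypeII B₂ ∧ FormsTable B₂) ∧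
      ∀ B : Bracket, IsGradedPoissonLie B ↔ B = B₁ ∨ B = B₂) ∧
    -- the brackets `{θ, t}` of a first-order structure are of type I or of type II
    (∀ B : Bracket, IsGradedPoisson B → ProlongsSklyanin B → FirstOrder B →
      TypeI B ∨ TypeII B) ∧
    -- they are cut out by the Jacobi identity from a one-parameter family
    (∀ B : Bracket, IsGradedBracket B → ProlongsSklyanin B → MixedLinear B →
      (FirstOrder B ↔ ∃ η : ℂ, MixedFamily η B)) ∧
    (∀ η : ℂ, ∃ B : Bracket, IsGradedBracket B ∧ ProlongsSklyanin B ∧ MixedFamily η B) ∧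
    (∀ (η : ℂ) (B : Bracket), IsGradedBracket B → ProlongsSklyanin B → MixedFamily η B →
      (MixedJacobi B ↔ η = 0 ∨ η = -2)) ∧
    (∀ B : Bracket, (TypeI B ↔ MixedFamily (-2) B) ∧ (TypeII B ↔ MixedFamily 0 B)) ∧
    -- the brackets `{θ, θ}` are forced by bicovariance
    (∀ B : Bracket, IsGradedBracket B → ProlongsSklyanin B → FormsQuadratic B →
      (SecondOrder B ↔ FormsTable B)) := by
  refine ⟨⟨familyBracket (-2), familyBracket 0, familyBracket_injective.ne (by norm_num),
    ⟨typeI_iff.mpr (mixedFamily_familyBracket _), formsTable_familyBracket _⟩,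
    ⟨typeII_iff.mpr (mixedFamily_familyBracket _), formsTable_familyBracket _⟩,
    fun B => isGradedPoissonLie_iff⟩,
    fun B hP hS hF => (mixedFamily_of_isGradedPoisson hP hS hF).imp typeI_iff.mpr typeII_iff.mpr,
    fun B hB hS hL => firstOrder_iff_mixedFamily hB hS hL,
    fun η => ⟨familyBracket η, isGradedBracket_familyBracket η, prolongsSklyanin_familyBracket η,
      mixedFamily_familyBracket η⟩,
    fun η B hB hS hM => mixedJacobi_iff_of_mixedFamily hB hS hM,
    fun B => ⟨typeI_iff, typeII_iff⟩,
    fun B hB hS hQ => secondOrder_iff_formsTable hB hS hQ⟩
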